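/- Let $\Omega\subset\mathbb R^3$ be the complement of a nonempty compact, strictly convex set with smooth boundary, and let $T>0$. Let $P=I-Q$ be the Leray projector of $L^2(\Omega;\mathbb R^3)$, where $Q$ is the orthogonal projection onto the closure of the gradients (so that $QF=\nabla\Lambda$ solves, weakly, $\Delta\Lambda=\operatorname{div}F$ in $\Omega$ with the natural Neumann condition); $P$ is the orthogonal projection onto the $L^2$ fields $K$ with $\operatorname{div}K=0$ in $\Omega$ and $K\cdot n=0$ on $\partial\Omega$, i.e. $\int_\Omega K\cdot\nabla\varphi\,dx=0$ for all $\varphi\in C_c^\infty(\mathbb R^3)$. Let $\varepsilon_n>0$, $\varepsilon_n\to0$, and for each $n$ (writing $\varepsilon=\varepsilon_n$) let $(u^\varepsilon,p^\varepsilon)$ be a finite energy weak solution on $(0,T)\times\Omega$ of $$\partial_tu^\varepsilon+\nabla p^\varepsilon=\Delta u^\varepsilon-(u^\varepsilon\cdot\nabla)u^\varepsilon-\tfrac12(\operatorname{div}u^\varepsilon)u^\varepsilon,\qquad \varepsilon\,\partial_tp^\varepsilon+\operatorname{div}u^\varepsilon=0,\qquad u^\varepsilon|_{\partial\Omega}=0,$$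 with initial data $u_0^\varepsilon\in L^2(\Omega;\mathbb R^3)$, $p_0^\varepsilon\in L^2(\Omega)$. This means that $u^\varepsilon\in L^\infty(0,T;L^2(\Omega))\cap L^2(0,T;H^1_0(\Omega))$, $p^\varepsilon\in L^\infty(0,T;L^2(\Omega))$, the two equations and the initial conditions hold in the sense of distributions (test functions in $C_c^\infty((-\infty,T)\times\Omega)$), and for almost every $t\in(0,T)$ $$\tfrac12\|u^\varepsilon(t)\|_{L^2}^2+\tfrac\varepsilon2\|p^\varepsilon(t)\|_{L^2}^2+\int_0^t\|\nabla u^\varepsilon(s)\|_{L^2}^2\,ds\le\tfrac12\|u^\varepsilon_0\|_{L^2}^2+\tfrac\varepsilon2\|p^\varepsilon_0\|_{L^2}^2 .$$ No boundary condition on $p^\varepsilon$ is assumed. Suppose that, as $n\to\infty$, $u_0^\varepsilon\to u_0$ strongly in $L^2(\Omega)$ and $\sqrt\varepsilon\,p_0^\varepsilon\to0$ strongly in $L^2(\Omega)$. Then: 1. there is a constant $C$, independent of $n$ and $h$, such that for all $n$ and all $h\in(0,1)$ $$\|Pu^{\varepsilon}(\cdot+h)-Pu^{\varepsilon}(\cdot)\|_{L^2((0,T-h);L^2(\Omega))}\le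 C\,h^{1/5}$$ (the left side is $0$ if $h\ge T$); 2. along some subsequence, $u^{\varepsilon}$ converges weakly in $L^2(0,T;\dot H^1(\Omega))$ to some $u\in L^\infty(0,T;L^2(\Omega))\cap L^2(0,T;H^1_0(\Omega))$; 3. whenever $u^{\varepsilon}$ converges, along the whole sequence or along a subsequence, weakly in $L^2(0,T;\dot H^1(\Omega))$ to such a $u$, then along the same (sub)sequence $$Pu^{\varepsilon}\longrightarrow Pu\qquad\text{strongly in }L^2(0,T;L^2_{loc}(\Omega)),$$ i.e. in $L^2((0,T)\times K)$ for every compact $K\subset\Omega$. -/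

import Mathlib

open MeasureTheory Set Filter Topology
open scoped ContDiff

noncomputable section

/-- The Euclidean space `ℝ³`. -/
abbrev E3 : Type := EuclideanSpace ℝ (Fin 3)

/-- The `i`-th vector of the standard basis of `ℝ³`. -/
abbrev e3 (i : Fin 3) : E3 := EuclideanSpace.single i (1 : ℝ)

/-- `Ω` is the exterior of a nonempty compact strictly convex obstacle with smooth boundary
(`ρ` is a smooth defining function of the obstacle, regular on its zero set). -/
def IsExteriorDomain (Ω : Set E3) : Prop :=
  ∃ K : Set E3, Ω = Kᶜ ∧ K.Nonempty ∧ IsCompact K ∧ StrictConvex ℝ K ∧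
    ∃ ρ : E3 → ℝ, ContDiff ℝ ∞ ρ ∧ K = {x | ρ x ≤ 0} ∧ ∀ x, ρ x = 0 → fderiv ℝ ρ x ≠ 0

/-- `L²(Ω; ℝ³)`. -/
abbrev L2V (Ω : Set E3) : Type := Lp E3 2 (volume.restrict Ω)

/-- `L²(Ω; ℝ)`. -/
abbrev L2S (Ω : Set E3) : Type := Lp ℝ 2 (volume.restrict Ω)

/-- `v ∈ H¹₀(Ω; ℝ³)` and `g i = ∂ᵢ v`: the pair `(v, ∇v)` is an `L²` limit of pairs `(φ, ∇φ)`
with `φ ∈ C_c^∞(Ω; ℝ³)`. -/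
def HasH10Grad (Ω : Set E3) (v : L2V Ω) (g : Fin 3 → L2V Ω) : Prop :=
  (v, g) ∈ closure {q : L2V Ω × (Fin 3 → L2V Ω) |
    ∃ φ : E3 → E3, ContDiff ℝ ∞ φ ∧ HasCompactSupport φ ∧ tsupport φ ⊆ Ω ∧
      (q.1 : E3 → E3) =ᵐ[volume.restrict Ω] φ ∧
      ∀ i, (q.2 i : E3 → E3) =ᵐ[volume.restrict Ω] fun x => fderiv ℝ φ x (e3 i)}

/-- `u ∈ L^∞(0,T; L²(Ω)) ∩ L²(0,T; H¹₀(Ω))` and `G · i = ∂ᵢ u`. -/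
structure IsEnergyClass (Ω : Set E3) (T : ℝ) (u : ℝ → L2V Ω) (G : ℝ → Fin 3 → L2V Ω) :
    Prop where
  memLp : MemLp u ⊤ (volume.restrict (Ioo 0 T))
  grad_memLp : ∀ i, MemLp (fun t => G t i) 2 (volume.restrict (Ioo 0 T))
  grad : ∀ᵐ t ∂(volume.restrict (Ioo 0 T)), HasH10Grad Ω (u t) (G t)

/-- The gradients `∇φ` restricted to `Ω`, where `φ ∈ C_c^∞(ℝ³)` (no condition on `∂Ω`). -/
def testGradients (Ω : Set E3) : Set (L2V Ω) :=
  {g | ∃ φ : E3 → ℝ, ContDiff ℝ ∞ φ ∧ HasCompactSupport φ ∧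
    (g : E3 → E3) =ᵐ[volume.restrict Ω] fun x => gradient φ x}

/-- The complementary projector `Q`, that is the `L²`-orthogonal projection onto the closure of the
gradients: `Q F = ∇Λ` is given by the weak form `∫_Ω ∇Λ · ∇φ = ∫_Ω F · ∇φ`, `φ ∈ C_c^∞(ℝ³)`, of the
Neumann problem `ΔΛ = div F` for `Λ`. -/
def lerayQ (Ω : Set E3) : L2V Ω →L[ℝ] L2V Ω :=
  (Submodule.span ℝ (testGradients Ω)).topologicalClosure.starProjection

/-- The Leray projector `P = I - Q`, that is the `L²`-orthogonal projection onto the fields `K` with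
`∫_Ω K · ∇φ = 0` for all `φ ∈ C_c^∞(ℝ³)`, the weak form of `div K = 0` in `Ω` and `K · n = 0` on
`∂Ω`. -/
def lerayP (Ω : Set E3) : L2V Ω →L[ℝ] L2V Ω :=
  ContinuousLinearMap.id ℝ (L2V Ω) - lerayQ Ω

/-- `(u, p)` is a finite energy weak solution on `(0,T) × Ω` of
`∂ₜu + ∇p = Δu - (u·∇)u - ½ (div u) u`,  `ε ∂ₜp + div u = 0`,  `u = 0` on `∂Ω`,
`u(0) = u₀`, `p(0) = p₀`. Here `G` is the gradient of `u`, that is `G t i = ∂ᵢ u(t)`. -/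
structure IsWeakSolution (Ω : Set E3) (T ε : ℝ) (u₀ : L2V Ω) (p₀ : L2S Ω)
    (u : ℝ → L2V Ω) (G : ℝ → Fin 3 → L2V Ω) (p : ℝ → L2S Ω) : Prop where
  velocity : IsEnergyClass Ω T u G
  pressure : MemLp p ⊤ (volume.restrict (Ioo 0 T))
  momentum : ∀ φ : ℝ × E3 → E3, ContDiff ℝ ∞ φ → HasCompactSupport φ →
    tsupport φ ⊆ Iio T ×ˢ Ω →
    ∫ t in Ioo 0 T, ∫ x in Ω,
      (-(inner ℝ (u t x) (fderiv ℝ φ (t, x) (1, 0)))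
        + ∑ i, inner ℝ (G t i x) (fderiv ℝ φ (t, x) (0, e3 i))
        + inner ℝ ((∑ i, u t x i • G t i x) + (1 / 2 : ℝ) • (∑ i, G t i x i) • u t x) (φ (t, x))
        - p t x * ∑ i, fderiv ℝ φ (t, x) (0, e3 i) i)
      = ∫ x in Ω, inner ℝ (u₀ x) (φ (0, x))
  continuity : ∀ ψ : ℝ × E3 → ℝ, ContDiff ℝ ∞ ψ → HasCompactSupport ψ →
    tsupport ψ ⊆ Iio T ×ˢ Ω →
    ∫ t in Ioo 0 T, ∫ x in Ω,
      (-(ε * p t x * fderiv ℝ ψ (t, x) (1, 0)) + (∑ i, G t i x i) * ψ (t, x))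
      = ε * ∫ x in Ω, p₀ x * ψ (0, x)
  energy : ∀ᵐ t ∂(volume.restrict (Ioo 0 T)),
    1 / 2 * ‖u t‖ ^ 2 + ε / 2 * ‖p t‖ ^ 2 + ∫ s in Ioo 0 t, ∑ i, ‖G s i‖ ^ 2
      ≤ 1 / 2 * ‖u₀‖ ^ 2 + ε / 2 * ‖p₀‖ ^ 2

/-- `v ∈ L^∞(0,T; L²(Ω)) ∩ L²(0,T; H¹₀(Ω))` is the limit, weakly in `L²(0,T; Ḣ¹(Ω))`, of the
sequence of fields with the gradients `G n`. -/
def IsLimitProfile (Ω : Set E3) (T : ℝ) (G : ℕ → ℝ → Fin 3 → L2V Ω) (v : ℝ → L2V Ω) : Prop :=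
  ∃ H : ℝ → Fin 3 → L2V Ω, IsEnergyClass Ω T v H ∧
    ∀ Φ : ℝ → Fin 3 → L2V Ω, (∀ i, MemLp (fun t => Φ t i) 2 (volume.restrict (Ioo 0 T))) →
      Tendsto (fun n => ∫ t in Ioo 0 T, ∑ i, inner ℝ (G n t i) (Φ t i)) atTop
        (𝓝 (∫ t in Ioo 0 T, ∑ i, inner ℝ (H t i) (Φ t i)))

/-- `w n → w∞` strongly in `L²(0,T; L²_loc(Ω))`. -/
def TendstoL2Loc (Ω : Set E3) (T : ℝ) (w : ℕ → ℝ → L2V Ω) (wlim : ℝ → L2V Ω) : Prop :=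
  ∀ K : Set E3, IsCompact K → K ⊆ Ω →
    Tendsto (fun n => ∫⁻ t in Ioo 0 T, ∫⁻ x in K, ‖w n t x - wlim t x‖ₑ ^ 2) atTop (𝓝 0)

end

/-!
Write `P` for the Leray projector, `z = u(t + h) - u(t)` and `K = P z`, so that `‖K‖² = ⟨z, K⟩`.

**Time modulus.** The identity `‖K‖² = ⟨z, K⟩` suggests using `K` as a test field in the momentum
equation, but `K` is only solenoidal and tangent to the boundary, whereas a test field has to be
smooth and to vanish near `∂Ω`. As the obstacle is convex with an interior point, there is a smooth
compactly supported vector field `θ` such that `x ↦ x + αθ(x)` moves `Ω` into itself, at distance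
at least `cα` from the obstacle (`IsExteriorDomain.exists_outward_field`). The push-forward of `K`
under this map, smoothed at the length `α`, is the field `W` of `IsRegularization`: it is smooth,
supported in `Ω`, and still divergence-free (`div_carry_eq_zero`), so that the pressure disappears
from the equation. No uniform bound on the pressure is needed. Since `z ∈ H¹₀(Ω)`, replacing `K`
by `W` changes `⟨z, K⟩` by at most `Cα(‖z‖ + ‖∇z‖)‖K‖`, and the equation, integrated in time
(`IsWeakSolution.ae_integral_inner_eq`), bounds `⟨z, W⟩` by
`Cα^{-3/2} ‖K‖ ∫ₜ^{t+h} ‖∇u‖`, because `|∇W| ≤ Cα^{-1}` in `L²` and `|W| ≤ Cα^{-3/2}` uniformly.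
The choice `α = h^{2/5}` balances the two errors and gives `∫ ‖K‖² ≤ C h^{2/5}`
(`IsExteriorDomain.exists_time_modulus`).

**Weak compactness.** The pairs `(u, ∇u)` with `u ∈ H¹₀(Ω)` form a closed subspace of a separable
Hilbert space, and bounds in `L^∞(0,T;L²)` pass to weak limits; so bounded sequences in the energy
class have weakly convergent subsequences in the class (`exists_subseq_energyClass`). A field in
`H¹₀(Ω)` is determined by its gradient, hence weak convergence of the gradients implies that of
the fields (`tendstoWeakly_of_grad`).

**Strong convergence.** In space, `f = P z` has interior increments of order `|y|^{1/2}`: for a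
cutoff `χ` and `D f = f(· + y) - f`, one has `∫ χ |D f|² = ⟨χ D f, D z⟩ - ⟨χ D f, D(z - f)⟩`. The
first term is `O(|y|)` since `z ∈ H¹₀(Ω)`. In the second, `z - f` is a limit of gradients `∇φ`, and
`D f` is orthogonal to `∇(χ D φ)`, which leaves the term `⟨D f, (D φ) ∇χ⟩ = O(|y|)`
(`IsCutoff.setLIntegral_increment_le`). So `P z` is close, in the interior and uniformly, to its
smoothings, and smoothing followed by the restriction to a compact set is a compact operator
(`tendsto_smoothing`). In time, the modulus makes `P u` close to its means over `(t, t + h)`, which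
converge weakly for each `t`. Hence a weakly null sequence with a time modulus becomes strongly null
after smoothing (`tendsto_lintegral_of_weakly_null`), and the two approximations together give the
strong interior convergence (`tendstoL2Loc_lerayP`).
-/

noncomputable section

open scoped ENNReal NNReal

/-! ### Outward fields for a convex obstacle -/

theorem IsExteriorDomain.isOpen {Ω : Set E3} (hΩ : IsExteriorDomain Ω) : IsOpen Ω := by
  obtain ⟨K, rfl, -, hK, -⟩ := hΩ
  exact hK.isClosed.isOpen_compl

theorem IsExteriorDomain.exists_ball_subset {Ω : Set E3} (hΩ : IsExteriorDomain Ω) :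
    ∃ (a : E3) (r : ℝ), 0 < r ∧ Metric.ball a r ⊆ Ωᶜ := by
  obtain ⟨K, rfl, ⟨x, hx⟩, -, -, ρ, hρ, rfl, hreg⟩ := hΩ
  have hc : Continuous ρ := hρ.continuous
  suffices h : ∃ y, ρ y < 0 by
    obtain ⟨y, hy⟩ := h
    obtain ⟨r, hr, hb⟩ := Metric.isOpen_iff.1 (isOpen_lt hc continuous_const) y hy
    refine ⟨y, r, hr, fun z hz => ?_⟩
    simpa using le_of_lt (show ρ z < 0 from hb hz)
  by_contra! hneg
  have h0 : ρ x = 0 := le_antisymm hx (hneg x)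
  exact hreg x h0 (IsLocalMin.fderiv_eq_zero (Eventually.of_forall fun y => by rw [h0]; exact hneg y))

/-- A compactly supported smooth field `θ` along which the exterior domain is pushed away from the
obstacle at unit rate: `x + α θ(x)` keeps a distance comparable to `α` from the obstacle. Near the
obstacle, `θ` is the radial field of an interior point of the convex obstacle. -/
theorem IsExteriorDomain.exists_outward_field {Ω : Set E3} (hΩ : IsExteriorDomain Ω) :
    ∃ θ : E3 → E3, ContDiff ℝ ∞ θ ∧ HasCompactSupport θ ∧ ∃ c : ℝ, 0 < c ∧
      ∀ α : ℝ, 0 < α → α ≤ 1 → ∀ x ∈ Ω, Metric.closedBall (x + α • θ x) (c * α) ⊆ Ω := by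
  obtain ⟨a, r, hr, hball⟩ := hΩ.exists_ball_subset
  obtain ⟨K, rfl, -, hK, hconv, -⟩ := hΩ
  rw [compl_compl] at hball
  obtain ⟨R, hR0, hR⟩ := hK.isBounded.subset_closedBall_lt 0 a
  let g : ContDiffBump a := ⟨2 * R, 3 * R, by positivity, by linarith⟩
  refine ⟨fun x => g x • (x - a), ?_, ?_, min (r / 2) R, by positivity, ?_⟩
  · exact g.contDiff.smul (contDiff_id.sub contDiff_const)
  · exact g.hasCompactSupport.smul_right
  intro α hα hα1 x hx y hy hyK
  rw [Metric.mem_closedBall, dist_eq_norm] at hy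
  beta_reduce at hy
  have hyR : ‖y - a‖ ≤ R := by simpa [dist_eq_norm] using hR hyK
  rcases le_or_gt ‖x - a‖ (2 * R) with h | h
  · have hg : g x = 1 := g.one_of_mem_closedBall (by simpa [dist_eq_norm] using h)
    rw [hg, one_smul] at hy
    -- `x` is a convex combination of `y ∈ K` and of a point of the ball inside the obstacle.
    have hb : a + α⁻¹ • (x + α • (x - a) - y) ∈ K := by
      apply hball
      rw [Metric.mem_ball, dist_eq_norm, add_sub_cancel_left, norm_smul, norm_inv, Real.norm_eq_abs,
        abs_of_pos hα, norm_sub_rev, inv_mul_lt_iff₀ hα]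
      calc _ ≤ min (r / 2) R * α := hy
        _ ≤ r / 2 * α := by gcongr; exact min_le_left _ _
        _ < α * r := by nlinarith
    have h1 : 0 < 1 + α := by linarith
    have := hconv.convex hyK hb (a := (1 + α)⁻¹) (b := α * (1 + α)⁻¹) (by positivity) (by positivity)
      (by field_simp)
    apply hx
    convert this using 1
    rw [smul_add, smul_smul, mul_right_comm, mul_inv_cancel₀ hα.ne', one_mul, mul_comm α, mul_smul,
      ← smul_add, ← smul_add, eq_inv_smul_iff₀ h1.ne']
    module
  · have h1 : ‖x + α • g x • (x - a) - a‖ = (1 + α * g x) * ‖x - a‖ := by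
      have : x + α • g x • (x - a) - a = (1 + α * g x) • (x - a) := by module
      rw [this, norm_smul, Real.norm_of_nonneg]
      have := g.nonneg (x := x); positivity
    have h2 : ‖x - a‖ ≤ ‖x + α • g x • (x - a) - a‖ := by
      rw [h1]
      have := mul_nonneg hα.le (g.nonneg (x := x))
      nlinarith [norm_nonneg (x - a)]
    have h3 : ‖x + α • g x • (x - a) - a‖ ≤ ‖y - (x + α • g x • (x - a))‖ + ‖y - a‖ := by
      rw [norm_sub_rev y]
      simpa using norm_add_le (x + α • g x • (x - a) - y) (y - a)
    have h4 : min (r / 2) R * α ≤ R * 1 := by gcongr; exact min_le_right _ _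
    linarith

/-! ### Small displacements -/

theorem antilipschitzWith_id_add {ξ : E3 → E3} (hξ : LipschitzWith (1 / 2) ξ) :
    AntilipschitzWith 2 fun x => x + ξ x := by
  refine AntilipschitzWith.of_le_mul_dist fun x y => ?_
  have h := hξ.dist_le_mul x y
  rw [dist_eq_norm] at *
  rw [dist_eq_norm] at *
  have : ‖x - y‖ ≤ ‖x + ξ x - (y + ξ y)‖ + ‖ξ x - ξ y‖ := by
    have := norm_sub_le (x + ξ x - (y + ξ y)) (ξ x - ξ y)
    rwa [show x + ξ x - (y + ξ y) - (ξ x - ξ y) = x - y by abel] at this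
  norm_num at h ⊢
  linarith

theorem volume_preimage_id_add_le {ξ : E3 → E3} (hξ : LipschitzWith (1 / 2) ξ) (s : Set E3) :
    volume ((fun x => x + ξ x) ⁻¹' s) ≤ 8 * volume s := by
  have h := (antilipschitzWith_id_add hξ).hausdorffMeasure_preimage_le (d := (3 : ℕ)) (by simp) s
  rw [← EuclideanSpace.euclideanHausdorffMeasure_eq_volume 3]
  simp only [Measure.euclideanHausdorffMeasure, Measure.smul_apply]
  simp only [ENNReal.smul_def, smul_eq_mul]
  rw [mul_left_comm]
  gcongr
  rw [ENNReal.rpow_natCast] at h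
  refine h.trans (le_of_eq ?_)
  norm_num

/-- A perturbation of the identity by a `1/2`-Lipschitz field distorts volumes at most by the
factor `2³`. -/
theorem lintegral_comp_id_add_le {ξ : E3 → E3} (hξ : LipschitzWith (1 / 2) ξ) {f : E3 → ℝ≥0∞}
    (hf : Measurable f) : ∫⁻ x, f (x + ξ x) ≤ 8 * ∫⁻ x, f x := by
  have hm : Measurable fun x => x + ξ x := by
    have := hξ.continuous
    fun_prop
  rw [← lintegral_map hf hm, ← smul_eq_mul, ← lintegral_smul_measure]
  refine lintegral_mono' (Measure.le_iff.2 fun s hs => ?_) le_rfl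
  rw [Measure.map_apply hm hs]
  simpa using volume_preimage_id_add_le hξ s

theorem sq_lintegral_mul_le {α : Type*} [MeasurableSpace α] {μ : Measure α} {f g : α → ℝ≥0∞}
    (hf : AEMeasurable f μ) (hg : AEMeasurable g μ) :
    (∫⁻ a, f a * g a ∂μ) ^ 2 ≤ (∫⁻ a, f a ^ 2 ∂μ) * ∫⁻ a, g a ^ 2 ∂μ := by
  have h := ENNReal.lintegral_mul_le_Lp_mul_Lq μ Real.HolderConjugate.two_two hf hg
  simp only [Pi.mul_apply, ENNReal.rpow_two] at h
  calc _ ≤ ((∫⁻ a, f a ^ 2 ∂μ) ^ (1 / 2 : ℝ) * (∫⁻ a, g a ^ 2 ∂μ) ^ (1 / 2 : ℝ)) ^ 2 := by gcongr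
    _ = _ := by
      rw [mul_pow, ← ENNReal.rpow_natCast, ← ENNReal.rpow_mul, ← ENNReal.rpow_natCast,
        ← ENNReal.rpow_mul]
      norm_num

/-- The Cauchy–Schwarz inequality with respect to the weight `k`. -/
theorem sq_lintegral_weight_mul_le {α : Type*} [MeasurableSpace α] {μ : Measure α}
    {k f : α → ℝ≥0∞} (hk : AEMeasurable k μ) (hf : AEMeasurable f μ) :
    (∫⁻ a, k a * f a ∂μ) ^ 2 ≤ (∫⁻ a, k a ∂μ) * ∫⁻ a, k a * f a ^ 2 ∂μ := by
  have hs : ∀ x : ℝ≥0∞, (x ^ (1 / 2 : ℝ)) ^ 2 = x := fun x => by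
    rw [← ENNReal.rpow_natCast, ← ENNReal.rpow_mul]; norm_num
  have h := sq_lintegral_mul_le (f := fun a => k a ^ (1 / 2 : ℝ))
    (g := fun a => k a ^ (1 / 2 : ℝ) * f a) (hk.pow_const _) ((hk.pow_const _).mul hf)
  simp only [mul_pow, hs, ← mul_assoc, ← sq] at h
  exact h

/-- The mean value inequality in `L²` along a small displacement `ξ`, localized: only the values of
the derivative on a set `U` that contains the segments from `x ∈ S` to `x + ξ x` are used. -/
theorem lintegral_displacement_le {F : Type*} [NormedAddCommGroup F] [NormedSpace ℝ F]
    [CompleteSpace F] {φ : E3 → F} (hφ : ContDiff ℝ 1 φ) {ξ : E3 → E3}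
    (hξ : LipschitzWith (1 / 2) ξ) {δ : ℝ} (hδ : ∀ x, ‖ξ x‖ ≤ δ) {S U : Set E3}
    (hS : MeasurableSet S) (hU : MeasurableSet U)
    (hSU : ∀ x ∈ S, ∀ s ∈ Icc (0 : ℝ) 1, x + s • ξ x ∈ U) :
    ∫⁻ x in S, ‖φ (x + ξ x) - φ x‖ₑ ^ 2 ≤
      8 * ENNReal.ofReal δ ^ 2 * ∫⁻ x in U, ‖fderiv ℝ φ x‖ₑ ^ 2 := by
  have hcd : Continuous (fderiv ℝ φ) := hφ.continuous_fderiv one_ne_zero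
  have hcξ := hξ.continuous
  let D : E3 → ℝ≥0∞ := U.indicator fun x => ‖fderiv ℝ φ x‖ₑ ^ 2
  have hD : Measurable D := (by fun_prop : Measurable fun x => ‖fderiv ℝ φ x‖ₑ ^ 2).indicator hU
  have hD' : Measurable fun p : E3 × ℝ => D (p.1 + p.2 • ξ p.1) := hD.comp (by fun_prop)
  have key : ∀ x ∈ S, ‖φ (x + ξ x) - φ x‖ₑ ^ 2 ≤
      ENNReal.ofReal δ ^ 2 * ∫⁻ s in Icc (0 : ℝ) 1, D (x + s • ξ x) := by
    intro x hx
    have hder : ∀ s ∈ uIcc (0 : ℝ) 1, HasDerivAt (fun s : ℝ => φ (x + s • ξ x))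
        (fderiv ℝ φ (x + s • ξ x) (ξ x)) s := by
      intro s _
      have h1 : HasDerivAt (fun s : ℝ => x + s • ξ x) (ξ x) s := by
        simpa using ((hasDerivAt_id s).smul_const (ξ x)).const_add x
      exact ((hφ.differentiable one_ne_zero _).hasFDerivAt).comp_hasDerivAt s h1
    have hcont : Continuous fun s : ℝ => fderiv ℝ φ (x + s • ξ x) (ξ x) := by fun_prop
    have h := intervalIntegral.integral_eq_sub_of_hasDerivAt hder (hcont.intervalIntegrable _ _)
    simp only [one_smul, zero_smul, add_zero] at h
    rw [← h, intervalIntegral.integral_of_le zero_le_one]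
    have h2 : ‖∫ s in Ioc (0 : ℝ) 1, fderiv ℝ φ (x + s • ξ x) (ξ x)‖ₑ ≤
        ∫⁻ s in Ioc (0 : ℝ) 1, 1 * (ENNReal.ofReal δ * ‖fderiv ℝ φ (x + s • ξ x)‖ₑ) := by
      refine (enorm_integral_le_lintegral_enorm _).trans (lintegral_mono fun s => ?_)
      rw [one_mul, mul_comm]
      refine (ContinuousLinearMap.le_opENorm _ _).trans ?_
      gcongr
      rw [← ofReal_norm]
      exact ENNReal.ofReal_le_ofReal (hδ x)
    refine (pow_le_pow_left' h2 2).trans ((sq_lintegral_mul_le (by fun_prop) (by fun_prop)).trans ?_)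
    simp only [mul_pow, one_pow]
    rw [lintegral_const_mul _ (by fun_prop), setLIntegral_one, Real.volume_Ioc]
    simp only [sub_zero, ENNReal.ofReal_one, one_mul]
    rw [Measure.restrict_congr_set Ioc_ae_eq_Icc]
    gcongr 1
    refine setLIntegral_mono' measurableSet_Icc fun s hs => ?_
    simp only [D]
    rw [indicator_of_mem (hSU x hx s hs)]
  calc ∫⁻ x in S, ‖φ (x + ξ x) - φ x‖ₑ ^ 2
      ≤ ∫⁻ x in S, ENNReal.ofReal δ ^ 2 * ∫⁻ s in Icc (0 : ℝ) 1, D (x + s • ξ x) :=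
        setLIntegral_mono' hS key
    _ ≤ ∫⁻ x, ENNReal.ofReal δ ^ 2 * ∫⁻ s in Icc (0 : ℝ) 1, D (x + s • ξ x) :=
        lintegral_mono' Measure.restrict_le_self le_rfl
    _ = ENNReal.ofReal δ ^ 2 * ∫⁻ s in Icc (0 : ℝ) 1, ∫⁻ x, D (x + s • ξ x) := by
        rw [lintegral_const_mul _ hD'.lintegral_prod_right', lintegral_lintegral_swap]
        exact hD'.aemeasurable
    _ ≤ ENNReal.ofReal δ ^ 2 * ∫⁻ s in Icc (0 : ℝ) 1, 8 * ∫⁻ x, D x := by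
        gcongr 1
        refine setLIntegral_mono' measurableSet_Icc fun s hs => ?_
        refine lintegral_comp_id_add_le (ξ := fun x => s • ξ x) ?_ hD
        refine LipschitzWith.of_dist_le_mul fun x y => ?_
        have := hξ.dist_le_mul x y
        rw [dist_smul₀, Real.norm_of_nonneg hs.1]
        nlinarith [hs.2, dist_nonneg (x := ξ x) (y := ξ y)]
    _ = _ := by
        simp only [D]
        rw [lintegral_indicator hU]
        simp
        ring

/-! ### Kernel operators along a displaced identity -/

/-- The integral operator `f ↦ ∫_Ω ζ(· - x - ξ(x)) f(x) dx`: the field `f` is carried along the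
displacement `ξ`, then smoothed by the kernel `ζ`. -/
def kernelOp (Ω : Set E3) (ξ : E3 → E3) (ζ : E3 → ℝ) (f : E3 → E3) (y : E3) : E3 :=
  ∫ x in Ω, ζ (y - (x + ξ x)) • f x

theorem lintegral_kernel_le {ξ : E3 → E3} (hξ : LipschitzWith (1 / 2) ξ) {ζ : E3 → ℝ≥0∞}
    (hζ : Measurable ζ) (Ω : Set E3) (y : E3) :
    ∫⁻ x in Ω, ζ (y - (x + ξ x)) ≤ 8 * ∫⁻ x, ζ x := by
  calc _ ≤ ∫⁻ x, ζ (y - (x + ξ x)) := lintegral_mono' Measure.restrict_le_self le_rfl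
    _ ≤ 8 * ∫⁻ x, ζ (y - x) :=
      lintegral_comp_id_add_le hξ (f := fun x => ζ (y - x)) (hζ.comp (measurable_const.sub measurable_id))
    _ = _ := by rw [lintegral_sub_left_eq_self]

theorem enorm_kernelOp_sq_le {Ω : Set E3} {ξ : E3 → E3} (hξ : LipschitzWith (1 / 2) ξ)
    {ζ : E3 → ℝ} (hζ : Continuous ζ) {f : E3 → E3}
    (hf : AEStronglyMeasurable f (volume.restrict Ω)) (y : E3) :
    ‖kernelOp Ω ξ ζ f y‖ₑ ^ 2 ≤ 8 * (∫⁻ x, ‖ζ x‖ₑ ^ 2) * ∫⁻ x in Ω, ‖f x‖ₑ ^ 2 := by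
  have hc := hξ.continuous
  have h1 : ‖kernelOp Ω ξ ζ f y‖ₑ ≤ ∫⁻ x in Ω, ‖ζ (y - (x + ξ x))‖ₑ * ‖f x‖ₑ := by
    refine (enorm_integral_le_lintegral_enorm _).trans_eq ?_
    simp only [enorm_smul]
  refine (pow_le_pow_left' h1 2).trans ((sq_lintegral_mul_le
    (Continuous.measurable (by fun_prop)).aemeasurable hf.enorm).trans ?_)
  gcongr
  exact lintegral_kernel_le hξ (ζ := fun x => ‖ζ x‖ₑ ^ 2) (by fun_prop) Ω y

/-- Schur's test for the kernel operators. -/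
theorem lintegral_kernelOp_sq_le {Ω : Set E3} {ξ : E3 → E3} (hξ : LipschitzWith (1 / 2) ξ)
    {ζ : E3 → ℝ} (hζ : Continuous ζ) {f : E3 → E3}
    (hf : AEStronglyMeasurable f (volume.restrict Ω)) :
    ∫⁻ y, ‖kernelOp Ω ξ ζ f y‖ₑ ^ 2 ≤ 8 * (∫⁻ x, ‖ζ x‖ₑ) ^ 2 * ∫⁻ x in Ω, ‖f x‖ₑ ^ 2 := by
  have hc := hξ.continuous
  have hm : Measurable fun p : E3 × E3 => ‖ζ (p.1 - (p.2 + ξ p.2))‖ₑ :=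
    Continuous.measurable (by fun_prop)
  have key : ∀ y, ‖kernelOp Ω ξ ζ f y‖ₑ ^ 2 ≤
      (8 * ∫⁻ x, ‖ζ x‖ₑ) * ∫⁻ x in Ω, ‖ζ (y - (x + ξ x))‖ₑ * ‖f x‖ₑ ^ 2 := by
    intro y
    have h1 : ‖kernelOp Ω ξ ζ f y‖ₑ ≤ ∫⁻ x in Ω, ‖ζ (y - (x + ξ x))‖ₑ * ‖f x‖ₑ := by
      refine (enorm_integral_le_lintegral_enorm _).trans_eq ?_
      simp only [enorm_smul]
    refine (pow_le_pow_left' h1 2).trans ((sq_lintegral_weight_mul_le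
      (Continuous.measurable (by fun_prop)).aemeasurable hf.enorm).trans ?_)
    gcongr
    exact lintegral_kernel_le hξ (ζ := fun x => ‖ζ x‖ₑ) (by fun_prop) Ω y
  have hj : AEMeasurable (fun p : E3 × E3 => ‖ζ (p.1 - (p.2 + ξ p.2))‖ₑ * ‖f p.2‖ₑ ^ 2)
      (volume.prod (volume.restrict Ω)) :=
    hm.aemeasurable.mul ((hf.enorm.comp_snd (μ := volume)).pow_const 2)
  calc _ ≤ ∫⁻ y, (8 * ∫⁻ x, ‖ζ x‖ₑ) * ∫⁻ x in Ω, ‖ζ (y - (x + ξ x))‖ₑ * ‖f x‖ₑ ^ 2 :=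
        lintegral_mono key
    _ = (8 * ∫⁻ x, ‖ζ x‖ₑ) * ∫⁻ x in Ω, ∫⁻ y, ‖ζ (y - (x + ξ x))‖ₑ * ‖f x‖ₑ ^ 2 := by
        rw [lintegral_const_mul'' _ hj.lintegral_prod_right', lintegral_lintegral_swap hj]
    _ = (8 * ∫⁻ x, ‖ζ x‖ₑ) * ∫⁻ x in Ω, (∫⁻ y, ‖ζ y‖ₑ) * ‖f x‖ₑ ^ 2 := by
        congr 2
        ext x
        rw [lintegral_mul_const _ (Continuous.measurable (by fun_prop)),
          lintegral_sub_right_eq_self (fun y => ‖ζ y‖ₑ) (x + ξ x)]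
    _ = _ := by
        rw [lintegral_const_mul'' _ (hf.enorm.pow_const 2)]
        ring

theorem integrable_kernel_smul {Ω : Set E3} {ξ : E3 → E3} (hξ : LipschitzWith (1 / 2) ξ)
    {ζ : E3 → ℝ} (hζ : Continuous ζ) (hζs : HasCompactSupport ζ) {f : E3 → E3}
    (hf : MemLp f 2 (volume.restrict Ω)) (y : E3) :
    Integrable (fun x => ζ (y - (x + ξ x)) • f x) (volume.restrict Ω) := by
  have hc := hξ.continuous
  have hcc : Continuous fun x => ζ (y - (x + ξ x)) := by fun_prop
  have hk : MemLp (fun x => ζ (y - (x + ξ x))) 2 (volume.restrict Ω) := by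
    refine ⟨hcc.aestronglyMeasurable, ?_⟩
    rw [eLpNorm_lt_top_iff_lintegral_rpow_enorm_lt_top (by simp) (by simp)]
    simp only [ENNReal.toReal_ofNat, ENNReal.rpow_two]
    refine (lintegral_kernel_le hξ (ζ := fun x => ‖ζ x‖ₑ ^ 2) (by fun_prop) Ω y).trans_lt ?_
    refine ENNReal.mul_lt_top (by simp) ?_
    have := (hζ.memLp_of_hasCompactSupport hζs (p := 2) (μ := volume)).2
    rw [eLpNorm_lt_top_iff_lintegral_rpow_enorm_lt_top (by simp) (by simp)] at this
    simpa using this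
  exact memLp_one_iff_integrable.1 (hf.smul hk (p := 2) (q := 2) (r := 1))

theorem hasFDerivAt_kernelOp {Ω : Set E3} {ξ : E3 → E3} (hξ : LipschitzWith (1 / 2) ξ)
    {ζ : E3 → ℝ} (hζ : ContDiff ℝ 1 ζ) (hζs : HasCompactSupport ζ) {f : E3 → E3}
    (hf : MemLp f 2 (volume.restrict Ω)) (y : E3) :
    HasFDerivAt (kernelOp Ω ξ ζ f)
      (∫ x in Ω, (fderiv ℝ ζ (y - (x + ξ x))).smulRight (f x)) y := by
  have hc := hξ.continuous
  have hd : Continuous (fderiv ℝ ζ) := hζ.continuous_fderiv one_ne_zero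
  obtain ⟨B, hB⟩ := (hζs.fderiv (𝕜 := ℝ)).exists_bound_of_continuous hd
  obtain ⟨ρ, hρ⟩ := hζs.isCompact.isBounded.subset_closedBall 0
  -- The kernels centred at the points near `y` live on one set of finite measure.
  let S : Set E3 := (fun x => x + ξ x) ⁻¹' Metric.closedBall y (ρ + 1)
  have hS : MeasurableSet S :=
    (Metric.isClosed_closedBall.preimage (by fun_prop)).measurableSet
  have hSfin : volume S < ⊤ := (volume_preimage_id_add_le hξ _).trans_lt
    (ENNReal.mul_lt_top (by simp) measure_closedBall_lt_top)
  have hint : Integrable (S.indicator fun x => B * ‖f x‖) (volume.restrict Ω) := by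
    rw [integrable_indicator_iff hS]
    have : IsFiniteMeasure ((volume.restrict Ω).restrict S) := by
      refine ⟨?_⟩
      rw [Measure.restrict_apply_univ]
      exact (Measure.restrict_apply_le _ _).trans_lt hSfin
    exact ((hf.restrict S).integrable (by norm_num)).norm.const_mul B
  refine hasFDerivAt_integral_of_dominated_of_fderiv_le (𝕜 := ℝ)
    (F' := fun y x => (fderiv ℝ ζ (y - (x + ξ x))).smulRight (f x))
    (bound := S.indicator fun x => B * ‖f x‖) (Metric.ball_mem_nhds y one_pos)
    ?_ ?_ ?_ ?_ hint ?_
  · exact Eventually.of_forall fun z =>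
      (integrable_kernel_smul hξ hζ.continuous hζs hf z).aestronglyMeasurable
  · exact integrable_kernel_smul hξ hζ.continuous hζs hf y
  · have h1 : Continuous fun x => fderiv ℝ ζ (y - (x + ξ x)) := by fun_prop
    exact (ContinuousLinearMap.smulRightL ℝ E3 E3).aestronglyMeasurable_comp₂
      h1.aestronglyMeasurable hf.1
  · refine Eventually.of_forall fun x z hz => ?_
    by_cases hx : x ∈ S
    · rw [indicator_of_mem hx, ContinuousLinearMap.norm_smulRight_apply]
      gcongr
      exact hB _
    · rw [indicator_of_notMem hx]
      have : fderiv ℝ ζ (z - (x + ξ x)) = 0 := by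
        by_contra h
        apply hx
        have h2 := hρ (support_fderiv_subset ℝ (f := ζ) h)
        rw [mem_closedBall_zero_iff] at h2
        rw [Metric.mem_ball, dist_eq_norm] at hz
        rw [mem_preimage, Metric.mem_closedBall, dist_eq_norm, norm_sub_rev]
        calc ‖y - (x + ξ x)‖ = ‖(z - (x + ξ x)) - (z - y)‖ := by congr 1; abel
          _ ≤ ρ + 1 := (norm_sub_le _ _).trans (by linarith)
      simp [this]
  · refine Eventually.of_forall fun x z hz => ?_
    have h1 : HasFDerivAt (fun z => ζ (z - (x + ξ x))) (fderiv ℝ ζ (z - (x + ξ x))) z := by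
      have h2 := ((hζ.differentiable one_ne_zero) (z - (x + ξ x))).hasFDerivAt
      exact h2.comp z ((hasFDerivAt_id z).sub_const (x + ξ x))
    exact h1.smul_const (f x)

theorem integrable_kernel_smulRight {Ω : Set E3} {ξ : E3 → E3} (hξ : LipschitzWith (1 / 2) ξ)
    {ζ : E3 → E3 →L[ℝ] ℝ} (hζ : Continuous ζ) (hζs : HasCompactSupport ζ) {f : E3 → E3}
    (hf : MemLp f 2 (volume.restrict Ω)) (y : E3) :
    Integrable (fun x => (ζ (y - (x + ξ x))).smulRight (f x)) (volume.restrict Ω) := by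
  have hc := hξ.continuous
  have h := integrable_kernel_smul hξ hζ.norm hζs.norm hf y
  have h1 : Continuous fun x => ζ (y - (x + ξ x)) := by fun_prop
  refine h.mono ((ContinuousLinearMap.smulRightL ℝ E3 E3).aestronglyMeasurable_comp₂
      h1.aestronglyMeasurable hf.1) (Eventually.of_forall fun x => ?_)
  simp [ContinuousLinearMap.norm_smulRight_apply, norm_smul]

theorem fderiv_kernelOp_apply {Ω : Set E3} {ξ : E3 → E3} (hξ : LipschitzWith (1 / 2) ξ)
    {ζ : E3 → ℝ} (hζ : ContDiff ℝ 1 ζ) (hζs : HasCompactSupport ζ) {f : E3 → E3}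
    (hf : MemLp f 2 (volume.restrict Ω)) (y v : E3) :
    fderiv ℝ (kernelOp Ω ξ ζ f) y v = kernelOp Ω ξ (fun z => fderiv ℝ ζ z v) f y := by
  rw [(hasFDerivAt_kernelOp hξ hζ hζs hf y).fderiv, ContinuousLinearMap.integral_apply
    (integrable_kernel_smulRight hξ (hζ.continuous_fderiv one_ne_zero) (hζs.fderiv (𝕜 := ℝ)) hf y)]
  rfl

theorem contDiff_kernelOp {Ω : Set E3} {ξ : E3 → E3} (hξ : LipschitzWith (1 / 2) ξ)
    {ζ : E3 → ℝ} (hζ : ContDiff ℝ ∞ ζ) (hζs : HasCompactSupport ζ) {f : E3 → E3}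
    (hf : MemLp f 2 (volume.restrict Ω)) : ContDiff ℝ ∞ (kernelOp Ω ξ ζ f) := by
  rw [contDiff_infty]
  intro n
  have hdiff : ∀ {ζ : E3 → ℝ}, ContDiff ℝ ∞ ζ → HasCompactSupport ζ →
      Differentiable ℝ (kernelOp Ω ξ ζ f) := fun hζ hζs y =>
    (hasFDerivAt_kernelOp hξ (hζ.of_le (by simp)) hζs hf y).differentiableAt
  induction n generalizing ζ with
  | zero => exact contDiff_zero.2 (hdiff hζ hζs).continuous
  | succ n ih =>
    rw [Nat.cast_succ, contDiff_succ_iff_fderiv_apply]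
    refine ⟨hdiff hζ hζs, by simp, fun v => ?_⟩
    simp only [fderiv_kernelOp_apply hξ (hζ.of_le (by simp)) hζs hf]
    refine ih ?_ ?_
    · exact (hζ.fderiv_right (by simp)).clm_apply contDiff_const
    · exact hζs.fderiv_apply (𝕜 := ℝ) v

theorem tsupport_kernelOp_subset {Ω : Set E3} {ξ : E3 → E3} {ζ : E3 → ℝ} {f : E3 → E3} {ρ σ : ℝ}
    (hζs : tsupport ζ ⊆ Metric.closedBall 0 ρ) (hρσ : ρ < σ) (hm : MeasurableSet Ω)
    (hΩ : ∀ x ∈ Ω, Metric.closedBall (x + ξ x) σ ⊆ Ω) :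
    tsupport (kernelOp Ω ξ ζ f) ⊆ Ω := by
  intro y hy
  obtain ⟨z, hz, hyz⟩ := Metric.mem_closure_iff.1 hy (σ - ρ) (sub_pos.2 hρσ)
  have : ∃ x ∈ Ω, ζ (z - (x + ξ x)) ≠ 0 := by
    by_contra! h
    apply hz
    rw [kernelOp, setIntegral_congr_fun (g := fun _ => 0) hm fun x hx => by simp [h x hx]]
    simp
  obtain ⟨x, hx, hne⟩ := this
  refine hΩ x hx ?_
  have h1 := hζs (subset_tsupport _ hne)
  rw [mem_closedBall_zero_iff, ← dist_eq_norm] at h1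
  rw [Metric.mem_closedBall]
  linarith [dist_triangle y z (x + ξ x)]

/-! ### Multiplication operators and solenoidal fields -/

theorem Lp_enorm_sq {α E : Type*} [MeasurableSpace α] {μ : Measure α} [NormedAddCommGroup E]
    (f : Lp E 2 μ) : ‖f‖ₑ ^ 2 = ∫⁻ x, ‖f x‖ₑ ^ 2 ∂μ := by
  rw [Lp.enorm_def, eLpNorm_eq_lintegral_rpow_enorm_toReal (by simp) (by simp),
    ← ENNReal.rpow_natCast, ← ENNReal.rpow_mul]
  simp

theorem norm_toLp_le_of_lintegral {α E : Type*} [MeasurableSpace α] {μ : Measure α}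
    [NormedAddCommGroup E] {f : α → E} (hf : MemLp f 2 μ) {B : ℝ} (hB : 0 ≤ B)
    (h : ∫⁻ x, ‖f x‖ₑ ^ 2 ∂μ ≤ ENNReal.ofReal B ^ 2) : ‖hf.toLp f‖ ≤ B := by
  have h1 : ‖hf.toLp f‖ₑ ^ 2 ≤ ENNReal.ofReal B ^ 2 := by
    rw [Lp_enorm_sq]
    refine le_trans (le_of_eq (lintegral_congr_ae ?_)) h
    filter_upwards [hf.coeFn_toLp] with x hx
    rw [hx]
  have h2 := (ENNReal.pow_le_pow_left_iff two_ne_zero).1 h1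
  rwa [← ofReal_norm, ENNReal.ofReal_le_ofReal_iff hB] at h2

theorem memLp_two_of_lintegral {α E : Type*} [MeasurableSpace α] {μ : Measure α}
    [NormedAddCommGroup E] {f : α → E} (hm : AEStronglyMeasurable f μ)
    (h : ∫⁻ x, ‖f x‖ₑ ^ 2 ∂μ < ⊤) : MemLp f 2 μ := by
  refine ⟨hm, ?_⟩
  rw [eLpNorm_lt_top_iff_lintegral_rpow_enorm_lt_top (by simp) (by simp)]
  simpa using h

theorem MeasureTheory.MemLp.lintegral_sq_lt_top {α E : Type*} [MeasurableSpace α] {μ : Measure α}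
    [NormedAddCommGroup E] {f : α → E} (h : MemLp f 2 μ) : ∫⁻ x, ‖f x‖ₑ ^ 2 ∂μ < ⊤ := by
  have := h.2
  rw [eLpNorm_lt_top_iff_lintegral_rpow_enorm_lt_top (by simp) (by simp)] at this
  simpa using this

theorem memLp_clm_apply {μ : Measure E3} {M : E3 → E3 →L[ℝ] E3} (hM : StronglyMeasurable M) {B : ℝ}
    (hB : ∀ x, ‖M x‖ ≤ B) {f : E3 → E3} (hf : MemLp f 2 μ) :
    MemLp (fun x => M x (f x)) 2 μ := by
  refine hf.of_le_mul (c := B) ?_ (Eventually.of_forall fun x => ?_)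
  · exact (ContinuousLinearMap.id ℝ (E3 →L[ℝ] E3)).aestronglyMeasurable_comp₂
      hM.aestronglyMeasurable hf.1
  · exact (M x).le_of_opNorm_le (hB x) _

/-- Multiplication of the fields in `L²(Ω; ℝ³)` by a bounded measurable matrix field. -/
def matMul (Ω : Set E3) (M : E3 → E3 →L[ℝ] E3) (hM : StronglyMeasurable M) (B : ℝ)
    (hB : ∀ x, ‖M x‖ ≤ B) : L2V Ω →L[ℝ] L2V Ω :=
  LinearMap.mkContinuous
    { toFun := fun f => (memLp_clm_apply hM hB (Lp.memLp f)).toLp _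
      map_add' := fun f g => by
        rw [← MemLp.toLp_add, MemLp.toLp_eq_toLp_iff]
        filter_upwards [Lp.coeFn_add f g] with x hx
        rw [hx, Pi.add_apply, map_add, Pi.add_apply]
      map_smul' := fun c f => by
        rw [RingHom.id_apply, ← MemLp.toLp_const_smul, MemLp.toLp_eq_toLp_iff]
        filter_upwards [Lp.coeFn_smul c f] with x hx
        rw [hx, Pi.smul_apply, map_smul, Pi.smul_apply] } B fun f => by
    refine norm_toLp_le_of_lintegral (memLp_clm_apply hM hB (Lp.memLp f)) (by have := (norm_nonneg _).trans (hB 0); positivity) ?_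
    rw [ENNReal.ofReal_mul ((norm_nonneg _).trans (hB 0)), mul_pow, ofReal_norm, Lp_enorm_sq,
      ← lintegral_const_mul' _ _ (by simp)]
    refine lintegral_mono fun x => ?_
    rw [← mul_pow]
    gcongr
    refine ((M x).le_opENorm _).trans ?_
    gcongr
    rw [← ofReal_norm]
    exact ENNReal.ofReal_le_ofReal (hB x)

theorem matMul_coeFn (Ω : Set E3) {M : E3 → E3 →L[ℝ] E3} (hM : StronglyMeasurable M) {B : ℝ}
    (hB : ∀ x, ‖M x‖ ≤ B) (f : L2V Ω) :
    matMul Ω M hM B hB f =ᵐ[volume.restrict Ω] fun x => M x (f x) :=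
  MemLp.coeFn_toLp (memLp_clm_apply hM hB (Lp.memLp f))

theorem norm_matMul_le (Ω : Set E3) {M : E3 → E3 →L[ℝ] E3} (hM : StronglyMeasurable M) {B : ℝ}
    (hB : ∀ x, ‖M x‖ ≤ B) (f : L2V Ω) : ‖matMul Ω M hM B hB f‖ ≤ B * ‖f‖ :=
  ContinuousLinearMap.le_of_opNorm_le _
    (LinearMap.mkContinuous_norm_le _ ((norm_nonneg _).trans (hB 0)) _) f

/-- The `L²` fields orthogonal to all gradients: the divergence-free fields tangent to `∂Ω`. -/
def solenoidal (Ω : Set E3) : Submodule ℝ (L2V Ω) :=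
  (Submodule.span ℝ (testGradients Ω))ᗮ

theorem lerayP_mem_solenoidal (Ω : Set E3) (z : L2V Ω) : lerayP Ω z ∈ solenoidal Ω := by
  have h := Submodule.sub_starProjection_mem_orthogonal
    (K := (Submodule.span ℝ (testGradients Ω)).topologicalClosure) z
  rw [Submodule.orthogonal_closure] at h
  exact h

theorem inner_lerayP_of_mem_solenoidal {Ω : Set E3} (z : L2V Ω) {K : L2V Ω}
    (hK : K ∈ solenoidal Ω) : inner ℝ (lerayP Ω z) K = inner ℝ z K := by
  have h1 : lerayQ Ω z ∈ (Submodule.span ℝ (testGradients Ω)).topologicalClosure :=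
    Submodule.starProjection_apply_mem _ z
  have h2 : K ∈ ((Submodule.span ℝ (testGradients Ω)).topologicalClosure)ᗮ := by
    rw [Submodule.orthogonal_closure]; exact hK
  have h3 : inner ℝ (lerayQ Ω z) K = 0 := h2 _ h1
  simp [lerayP, inner_sub_left, h3]

theorem norm_lerayP_le {Ω : Set E3} (z : L2V Ω) : ‖lerayP Ω z‖ ≤ ‖z‖ := by
  have h := inner_lerayP_of_mem_solenoidal z (lerayP_mem_solenoidal Ω z)
  rw [real_inner_self_eq_norm_sq] at h
  have h2 := real_inner_le_norm z (lerayP Ω z)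
  nlinarith [norm_nonneg z, norm_nonneg (lerayP Ω z)]

theorem memLp_gradient {φ : E3 → ℝ} (hφ : ContDiff ℝ ∞ φ) (hφs : HasCompactSupport φ)
    (Ω : Set E3) : MemLp (fun x => gradient φ x) 2 (volume.restrict Ω) := by
  have hc : Continuous fun x => gradient φ x :=
    (InnerProductSpace.toDual ℝ E3).symm.continuous.comp (hφ.continuous_fderiv (by simp))
  have hs : HasCompactSupport fun x => gradient φ x :=
    (hφs.fderiv (𝕜 := ℝ)).comp_left (g := (InnerProductSpace.toDual ℝ E3).symm) (map_zero _)
  exact (hc.memLp_of_hasCompactSupport hs).restrict Ω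

theorem integral_fderiv_eq_zero_of_mem_solenoidal {Ω : Set E3} {K : L2V Ω}
    (hK : K ∈ solenoidal Ω) {φ : E3 → ℝ} (hφ : ContDiff ℝ ∞ φ) (hφs : HasCompactSupport φ) :
    ∫ x in Ω, fderiv ℝ φ x (K x) = 0 := by
  have hm := memLp_gradient hφ hφs Ω
  have h1 : hm.toLp _ ∈ testGradients Ω := ⟨φ, hφ, hφs, hm.coeFn_toLp⟩
  have h2 : inner ℝ (hm.toLp _) K = 0 := hK _ (Submodule.subset_span h1)
  rw [real_inner_comm, L2.inner_def] at h2
  rw [← h2]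
  refine integral_congr_ae ?_
  filter_upwards [hm.coeFn_toLp] with x hx
  rw [hx, inner_gradient_right]
  simp

/-! ### Solenoidal regularization compactly inside the domain -/

/-- The regularization of `K` at the displacement `ξ` with the kernel `ζ`: the push-forward of
the vector field `K` under `x ↦ x + ξ(x)` (its differential acts on `K`), smoothed by `ζ`. -/
def carry (Ω : Set E3) (ξ : E3 → E3) (ζ : E3 → ℝ) (K : L2V Ω) : E3 → E3 :=
  kernelOp Ω ξ ζ fun x => K x + fderiv ℝ ξ x (K x)

/-- A displacement field: smooth with derivative at most `1/2`. -/
structure IsDisplacement (ξ : E3 → E3) : Prop where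
  contDiff : ContDiff ℝ ∞ ξ
  norm_fderiv_le : ∀ x, ‖fderiv ℝ ξ x‖ ≤ 1 / 2

theorem IsDisplacement.lipschitz {ξ : E3 → E3} (hξ : IsDisplacement ξ) :
    LipschitzWith (1 / 2) ξ :=
  lipschitzWith_of_nnnorm_fderiv_le (𝕜 := ℝ) (hξ.contDiff.differentiable (by simp))
    fun x => by
      rw [← NNReal.coe_le_coe]
      simpa using hξ.norm_fderiv_le x

theorem IsDisplacement.stronglyMeasurable {ξ : E3 → E3} (hξ : IsDisplacement ξ) :
    StronglyMeasurable (fderiv ℝ ξ) :=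
  (hξ.contDiff.continuous_fderiv (by simp)).stronglyMeasurable

theorem IsDisplacement.memLp {ξ : E3 → E3} (hξ : IsDisplacement ξ) {Ω : Set E3} (K : L2V Ω) :
    MemLp (fun x => K x + fderiv ℝ ξ x (K x)) 2 (volume.restrict Ω) :=
  (Lp.memLp K).add (memLp_clm_apply hξ.stronglyMeasurable hξ.norm_fderiv_le (Lp.memLp K))

theorem IsDisplacement.lintegral_le {ξ : E3 → E3} (hξ : IsDisplacement ξ) {Ω : Set E3}
    (K : L2V Ω) : ∫⁻ x in Ω, ‖K x + fderiv ℝ ξ x (K x)‖ₑ ^ 2 ≤ 4 * ‖K‖ₑ ^ 2 := by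
  rw [Lp_enorm_sq, ← lintegral_const_mul' _ _ (by simp)]
  refine lintegral_mono fun x => ?_
  have h : ‖K x + fderiv ℝ ξ x (K x)‖ ≤ 2 * ‖K x‖ := by
    refine (norm_add_le _ _).trans ?_
    have := (fderiv ℝ ξ x).le_of_opNorm_le (hξ.norm_fderiv_le x) (K x)
    linarith [norm_nonneg (K x)]
  have h2 : ‖K x + fderiv ℝ ξ x (K x)‖ₑ ≤ 2 * ‖K x‖ₑ := by
    rw [← ofReal_norm, ← ofReal_norm]
    refine (ENNReal.ofReal_le_ofReal h).trans_eq ?_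
    rw [ENNReal.ofReal_mul (by norm_num), ENNReal.ofReal_ofNat]
  calc _ ≤ (2 * ‖K x‖ₑ) ^ 2 := by gcongr
    _ = _ := by rw [mul_pow]; norm_num

/-- The regularization of a solenoidal field is divergence-free: its divergence at `y` is the
integral of `K` against the gradient of `x ↦ ζ(y - x - ξ(x))`. -/
theorem div_carry_eq_zero {Ω : Set E3} {ξ : E3 → E3} (hξ : IsDisplacement ξ) {ζ : E3 → ℝ}
    (hζ : ContDiff ℝ ∞ ζ) (hζs : HasCompactSupport ζ) {K : L2V Ω} (hK : K ∈ solenoidal Ω) (y : E3) :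
    ∑ i, fderiv ℝ (carry Ω ξ ζ K) y (e3 i) i = 0 := by
  have hL := hξ.lipschitz
  have hφ : ContDiff ℝ ∞ fun x => ζ (y - (x + ξ x)) :=
    hζ.comp (contDiff_const.sub (contDiff_id.add hξ.contDiff))
  have hφs : HasCompactSupport fun x => ζ (y - (x + ξ x)) := by
    have hemb : IsClosedEmbedding fun x => x + ξ x :=
      (antilipschitzWith_id_add hL).isClosedEmbedding
        ((LipschitzWith.id.add hL).uniformContinuous)
    exact hζs.comp_isClosedEmbedding ((Homeomorph.subLeft y).isClosedEmbedding.comp hemb)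
  have h0 := integral_fderiv_eq_zero_of_mem_solenoidal hK hφ hφs
  have hder : ∀ x v, fderiv ℝ (fun x => ζ (y - (x + ξ x))) x v =
      -(fderiv ℝ ζ (y - (x + ξ x)) (v + fderiv ℝ ξ x v)) := by
    intro x v
    have h1 : HasFDerivAt (fun x => y - (x + ξ x))
        (-(ContinuousLinearMap.id ℝ E3 + fderiv ℝ ξ x)) x :=
      ((hasFDerivAt_id x).add
        ((hξ.contDiff.differentiable (by simp)) x).hasFDerivAt).const_sub y
    have h2 := ((hζ.differentiable (by simp)) (y - (x + ξ x))).hasFDerivAt.comp x h1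
    rw [show (fun x => ζ (y - (x + ξ x))) = ζ ∘ fun x => y - (x + ξ x) from rfl, h2.fderiv]
    simp
  simp only [hder, integral_neg, neg_eq_zero] at h0
  have hint := integrable_kernel_smulRight hL (hζ.continuous_fderiv (by simp))
    (hζs.fderiv (𝕜 := ℝ)) (hξ.memLp K) y
  have hi : ∀ i : Fin 3, fderiv ℝ (carry Ω ξ ζ K) y (e3 i) i =
      ∫ x in Ω, fderiv ℝ ζ (y - (x + ξ x)) (e3 i) * (K x + fderiv ℝ ξ x (K x)) i := by
    intro i
    rw [carry, (hasFDerivAt_kernelOp hL (hζ.of_le (by simp)) hζs (hξ.memLp K) y).fderiv,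
      ContinuousLinearMap.integral_apply hint]
    have := (EuclideanSpace.proj i : E3 →L[ℝ] ℝ).integral_comp_comm
      (hint.apply_continuousLinearMap (e3 i))
    refine Eq.trans this.symm ?_
    simp [mul_add]
  have hii : ∀ i : Fin 3, Integrable (fun x => fderiv ℝ ζ (y - (x + ξ x)) (e3 i) *
      (K x + fderiv ℝ ξ x (K x)) i) (volume.restrict Ω) := by
    intro i
    have := (EuclideanSpace.proj i : E3 →L[ℝ] ℝ).integrable_comp
      (hint.apply_continuousLinearMap (e3 i))
    simpa [mul_add] using this
  simp only [hi]
  rw [← integral_finsetSum _ fun i _ => hii i, ← h0]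
  congr 1
  ext x
  set v := K x + fderiv ℝ ξ x (K x)
  have hv : v = ∑ i, v i • e3 i := by
    ext j; simp [Fin.sum_univ_three]; fin_cases j <;> simp
  conv_rhs => rw [hv]
  simp [map_sum, mul_comm]

/-! ### Smoothing kernels and the pairing with the regularization -/

/-- A smoothing kernel: a smooth probability density supported in the ball of radius `ρ`. -/
structure IsKernel (ζ : E3 → ℝ) (ρ : ℝ) : Prop where
  contDiff : ContDiff ℝ ∞ ζ
  nonneg : ∀ x, 0 ≤ ζ x
  integral_eq : ∫ x, ζ x = 1
  tsupport_subset : tsupport ζ ⊆ Metric.closedBall 0 ρ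

theorem IsKernel.compact {ζ : E3 → ℝ} {ρ : ℝ} (h : IsKernel ζ ρ) : HasCompactSupport ζ :=
  (isCompact_closedBall 0 ρ).of_isClosed_subset (isClosed_tsupport ζ) h.tsupport_subset

theorem IsKernel.integrable {ζ : E3 → ℝ} {ρ : ℝ} (h : IsKernel ζ ρ) : Integrable ζ :=
  h.contDiff.continuous.integrable_of_hasCompactSupport h.compact

theorem IsKernel.lintegral_eq {ζ : E3 → ℝ} {ρ : ℝ} (h : IsKernel ζ ρ) :
    ∫⁻ x, ‖ζ x‖ₑ = 1 := by
  rw [← ofReal_integral_norm_eq_lintegral_enorm h.integrable]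
  simp only [Real.norm_of_nonneg (h.nonneg _), h.integral_eq, ENNReal.ofReal_one]

theorem IsKernel.norm_le {ζ : E3 → ℝ} {ρ : ℝ} (h : IsKernel ζ ρ) {x : E3} (hx : ζ x ≠ 0) :
    ‖x‖ ≤ ρ := by
  simpa using h.tsupport_subset (subset_tsupport _ hx)

/-- The error made by carrying and smoothing a function is controlled by the displacement and the
radius of the kernel times the `L²` norm of the derivative. -/
theorem lintegral_smear_sub_le {φ : E3 → E3} (hφ : ContDiff ℝ 1 φ) {ξ : E3 → E3}
    (hξ : LipschitzWith (1 / 2) ξ) {δ₀ : ℝ} (hδ₀ : ∀ x, ‖ξ x‖ ≤ δ₀) {ζ : E3 → ℝ} {ρ : ℝ}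
    (hζ : IsKernel ζ ρ) :
    ∫⁻ x, ‖(∫ y, ζ y • φ (x + (ξ x + y))) - φ x‖ₑ ^ 2 ≤
      8 * ENNReal.ofReal (δ₀ + ρ) ^ 2 * ∫⁻ x, ‖fderiv ℝ φ x‖ₑ ^ 2 := by
  have hcξ := hξ.continuous
  have hcζ := hζ.contDiff.continuous
  have hcφ := hφ.continuous
  have hpt : ∀ x, ‖(∫ y, ζ y • φ (x + (ξ x + y))) - φ x‖ₑ ^ 2 ≤
      ∫⁻ y, ‖ζ y‖ₑ * ‖φ (x + (ξ x + y)) - φ x‖ₑ ^ 2 := by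
    intro x
    have h1 : (∫ y, ζ y • φ (x + (ξ x + y))) - φ x = ∫ y, ζ y • (φ (x + (ξ x + y)) - φ x) := by
      simp only [smul_sub]
      rw [integral_sub, integral_smul_const, hζ.integral_eq, one_smul]
      · exact Continuous.integrable_of_hasCompactSupport (by fun_prop) hζ.compact.smul_right
      · exact hζ.integrable.smul_const _
    rw [h1]
    have h2 : ‖∫ y, ζ y • (φ (x + (ξ x + y)) - φ x)‖ₑ ≤
        ∫⁻ y, ‖ζ y‖ₑ * ‖φ (x + (ξ x + y)) - φ x‖ₑ := by
      refine (enorm_integral_le_lintegral_enorm _).trans_eq ?_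
      simp only [enorm_smul]
    refine (pow_le_pow_left' h2 2).trans ((sq_lintegral_weight_mul_le
      (Continuous.measurable (by fun_prop)).aemeasurable
      (Continuous.measurable (by fun_prop)).aemeasurable).trans ?_)
    rw [hζ.lintegral_eq, one_mul]
  have hm : Measurable fun p : E3 × E3 => ‖ζ p.2‖ₑ * ‖φ (p.1 + (ξ p.1 + p.2)) - φ p.1‖ₑ ^ 2 := by
    have h1 : Continuous fun p : E3 × E3 => ζ p.2 := by fun_prop
    have h2 : Continuous fun p : E3 × E3 => φ (p.1 + (ξ p.1 + p.2)) - φ p.1 := by fun_prop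
    exact h1.enorm.measurable.mul (h2.enorm.measurable.pow_const 2)
  calc _ ≤ ∫⁻ x, ∫⁻ y, ‖ζ y‖ₑ * ‖φ (x + (ξ x + y)) - φ x‖ₑ ^ 2 := lintegral_mono hpt
    _ = ∫⁻ y, ‖ζ y‖ₑ * ∫⁻ x, ‖φ (x + (ξ x + y)) - φ x‖ₑ ^ 2 := by
        rw [lintegral_lintegral_swap hm.aemeasurable]
        refine lintegral_congr fun y => ?_
        rw [lintegral_const_mul _ (Continuous.measurable (by fun_prop))]
    _ ≤ ∫⁻ y, ‖ζ y‖ₑ * (8 * ENNReal.ofReal (δ₀ + ρ) ^ 2 * ∫⁻ x, ‖fderiv ℝ φ x‖ₑ ^ 2) := by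
        refine lintegral_mono fun y => ?_
        by_cases hy : ζ y = 0
        · simp [hy]
        gcongr
        have := lintegral_displacement_le hφ (ξ := fun x => ξ x + y) (S := univ) (U := univ)
          (δ := δ₀ + ρ) ?_ ?_ .univ .univ (by simp)
        · simpa using this
        · simpa using hξ.add (LipschitzWith.const y)
        · exact fun x => (norm_add_le _ _).trans (add_le_add (hδ₀ x) (hζ.norm_le hy))
    _ = _ := by
        rw [lintegral_mul_const _ (Continuous.measurable (by fun_prop)), hζ.lintegral_eq, one_mul]

theorem memLp_kernelOp {Ω : Set E3} {ξ : E3 → E3} (hξ : LipschitzWith (1 / 2) ξ) {ζ : E3 → ℝ}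
    (hζ : ContDiff ℝ ∞ ζ) (hζs : HasCompactSupport ζ) {f : E3 → E3}
    (hf : MemLp f 2 (volume.restrict Ω)) : MemLp (kernelOp Ω ξ ζ f) 2 volume := by
  refine memLp_two_of_lintegral (contDiff_kernelOp hξ hζ hζs hf).continuous.aestronglyMeasurable ?_
  refine (lintegral_kernelOp_sq_le hξ hζ.continuous hf.1).trans_lt ?_
  have h1 : ∫⁻ x, ‖ζ x‖ₑ < ⊤ := (hζ.continuous.integrable_of_hasCompactSupport hζs).2
  exact ENNReal.mul_lt_top (ENNReal.mul_lt_top (by simp) (ENNReal.pow_lt_top h1))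
    hf.lintegral_sq_lt_top

/-- The transpose of the kernel operator, on compactly supported fields. -/
theorem integral_inner_kernelOp {Ω : Set E3} {ξ : E3 → E3} (hξ : LipschitzWith (1 / 2) ξ)
    {ζ : E3 → ℝ} (hζ : ContDiff ℝ ∞ ζ) (hζs : HasCompactSupport ζ) {f : E3 → E3}
    (hf : MemLp f 2 (volume.restrict Ω)) {φ : E3 → E3} (hφ : Continuous φ)
    (hφs : HasCompactSupport φ) :
    ∫ y, inner ℝ (φ y) (kernelOp Ω ξ ζ f y) =
      ∫ x in Ω, inner ℝ (∫ y, ζ y • φ (x + (ξ x + y))) (f x) := by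
  have hcξ := hξ.continuous
  have hcζ := hζ.continuous
  have hζ1 : ∫⁻ x, ‖ζ x‖ₑ < ⊤ := (hζ.continuous.integrable_of_hasCompactSupport hζs).2
  have hφ2 := (hφ.memLp_of_hasCompactSupport hφs (p := 2) (μ := volume)).lintegral_sq_lt_top
  have hmk : Continuous fun p : E3 × E3 => ζ (p.1 - (p.2 + ξ p.2)) := by fun_prop
  have hme : Measurable fun p : E3 × E3 => ‖ζ (p.1 - (p.2 + ξ p.2))‖ₑ := hmk.enorm.measurable
  have hf2 : AEStronglyMeasurable (fun p : E3 × E3 => f p.2)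
    ((volume : Measure E3).prod (volume.restrict Ω)) := hf.1.comp_snd
  have hint : Integrable (fun p : E3 × E3 => ζ (p.1 - (p.2 + ξ p.2)) * inner ℝ (φ p.1) (f p.2))
      ((volume : Measure E3).prod (volume.restrict Ω)) := by
    refine ⟨hmk.aestronglyMeasurable.mul
      (AEStronglyMeasurable.inner (by fun_prop : Continuous fun p : E3 × E3 => φ p.1).aestronglyMeasurable hf2), ?_⟩
    -- `|⟨φ(y), f(x)⟩| ≤ |φ(y)|² + |f(x)|²`, and the kernel is integrable in each variable.
    have hle : ∀ p : E3 × E3, ‖ζ (p.1 - (p.2 + ξ p.2)) * inner ℝ (φ p.1) (f p.2)‖ₑ ≤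
        ‖ζ (p.1 - (p.2 + ξ p.2))‖ₑ * ‖φ p.1‖ₑ ^ 2 + ‖ζ (p.1 - (p.2 + ξ p.2))‖ₑ * ‖f p.2‖ₑ ^ 2 := by
      intro p
      rw [enorm_mul, ← mul_add]
      gcongr
      simp only [← ofReal_norm]
      rw [← ENNReal.ofReal_pow (norm_nonneg _), ← ENNReal.ofReal_pow (norm_nonneg _),
        ← ENNReal.ofReal_add (by positivity) (by positivity)]
      refine ENNReal.ofReal_le_ofReal ((norm_inner_le_norm (𝕜 := ℝ) _ _).trans ?_)
      nlinarith [sq_nonneg (‖φ p.1‖ - ‖f p.2‖), sq_nonneg (‖φ p.1‖ + ‖f p.2‖)]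
    have hm1 : AEMeasurable (fun p : E3 × E3 => ‖ζ (p.1 - (p.2 + ξ p.2))‖ₑ * ‖φ p.1‖ₑ ^ 2)
        ((volume : Measure E3).prod (volume.restrict Ω)) :=
      (hme.mul ((by fun_prop : Continuous fun p : E3 × E3 => φ p.1).enorm.measurable.pow_const 2)).aemeasurable
    have hm2 : AEMeasurable (fun p : E3 × E3 => ‖ζ (p.1 - (p.2 + ξ p.2))‖ₑ * ‖f p.2‖ₑ ^ 2)
        ((volume : Measure E3).prod (volume.restrict Ω)) :=
      hme.aemeasurable.mul (hf2.enorm.pow_const 2)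
    refine (lintegral_mono hle).trans_lt ?_
    rw [lintegral_add_left' hm1, ENNReal.add_lt_top]
    constructor
    · rw [lintegral_prod _ hm1]
      calc _ ≤ ∫⁻ y, (8 * ∫⁻ x, ‖ζ x‖ₑ) * ‖φ y‖ₑ ^ 2 := by
            refine lintegral_mono fun y => ?_
            dsimp only
            rw [lintegral_mul_const _ (Continuous.measurable (by fun_prop))]
            gcongr
            exact lintegral_kernel_le hξ (ζ := fun x => ‖ζ x‖ₑ) hcζ.enorm.measurable Ω y
        _ < ⊤ := by
            rw [lintegral_const_mul _ (hφ.enorm.measurable.pow_const 2)]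
            exact ENNReal.mul_lt_top (ENNReal.mul_lt_top (by simp) hζ1) hφ2
    · rw [lintegral_prod_symm _ hm2]
      calc _ = ∫⁻ x in Ω, (∫⁻ y, ‖ζ y‖ₑ) * ‖f x‖ₑ ^ 2 := by
            refine lintegral_congr fun x => ?_
            dsimp only
            rw [lintegral_mul_const _ (Continuous.measurable (by fun_prop)),
              lintegral_sub_right_eq_self (fun y => ‖ζ y‖ₑ) (x + ξ x)]
        _ < ⊤ := by
            rw [lintegral_const_mul'' _ (hf.1.enorm.pow_const 2)]
            exact ENNReal.mul_lt_top hζ1 hf.lintegral_sq_lt_top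
  calc ∫ y, inner ℝ (φ y) (kernelOp Ω ξ ζ f y)
      = ∫ y, ∫ x in Ω, ζ (y - (x + ξ x)) * inner ℝ (φ y) (f x) := by
        congr 1
        ext y
        rw [kernelOp, ← integral_inner (integrable_kernel_smul hξ hcζ hζs hf y)]
        simp only [inner_smul_right]
    _ = ∫ x in Ω, ∫ y, ζ (y - (x + ξ x)) * inner ℝ (φ y) (f x) := integral_integral_swap hint
    _ = _ := by
        congr 1
        ext x
        have h1 : Integrable fun y => ζ y • φ (x + (ξ x + y)) :=
          Continuous.integrable_of_hasCompactSupport (by fun_prop) hζs.smul_right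
        rw [real_inner_comm, ← integral_inner h1,
          ← integral_add_right_eq_self (fun y => ζ (y - (x + ξ x)) * inner ℝ (φ y) (f x)) (x + ξ x)]
        congr 1
        ext y
        rw [inner_smul_right, real_inner_comm, add_sub_cancel_right]
        congr 3
        abel

theorem memLp_carry {Ω : Set E3} {ξ : E3 → E3} (hξ : IsDisplacement ξ) {ζ : E3 → ℝ}
    (hζ : ContDiff ℝ ∞ ζ) (hζs : HasCompactSupport ζ) (K : L2V Ω) :
    MemLp (carry Ω ξ ζ K) 2 volume :=
  memLp_kernelOp hξ.lipschitz hζ hζs (hξ.memLp K)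

theorem norm_fderiv_sq_le (D : E3 →L[ℝ] E3) : ‖D‖ₑ ^ 2 ≤ ∑ i, ‖D (e3 i)‖ₑ ^ 2 := by
  have h : ‖D‖ ≤ √(∑ i, ‖D (e3 i)‖ ^ 2) := by
    refine D.opNorm_le_bound (Real.sqrt_nonneg _) fun v => ?_
    have hv : v = ∑ i, v i • e3 i := by
      ext j; fin_cases j <;> simp [Fin.sum_univ_three]
    calc ‖D v‖ = ‖∑ i, v i • D (e3 i)‖ := by conv_lhs => rw [hv, map_sum]; simp only [map_smul]
      _ ≤ ∑ i, ‖D (e3 i)‖ * ‖v i‖ := by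
        refine (norm_sum_le _ _).trans (Finset.sum_le_sum fun i _ => ?_)
        rw [norm_smul, mul_comm]
      _ ≤ √(∑ i, ‖D (e3 i)‖ ^ 2) * √(∑ i, ‖v i‖ ^ 2) := Real.sum_mul_le_sqrt_mul_sqrt _ _ _
      _ = _ := by rw [EuclideanSpace.norm_eq]
  have h2 : ‖D‖ ^ 2 ≤ ∑ i, ‖D (e3 i)‖ ^ 2 := by
    refine (pow_le_pow_left₀ (norm_nonneg _) h 2).trans_eq (Real.sq_sqrt ?_)
    exact Finset.sum_nonneg fun i _ => by positivity
  simp only [← ofReal_norm, ← ENNReal.ofReal_pow (norm_nonneg _)]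
  rw [← ENNReal.ofReal_sum_of_nonneg fun i _ => by positivity]
  exact ENNReal.ofReal_le_ofReal h2

theorem sum_enorm_sq_le {E ι : Type*} [SeminormedAddCommGroup E] [Fintype ι] (g : ι → E) :
    ∑ i, ‖g i‖ₑ ^ 2 ≤ ENNReal.ofReal (∑ i, ‖g i‖) ^ 2 := by
  simp only [← ofReal_norm, ← ENNReal.ofReal_pow (norm_nonneg _)]
  rw [← ENNReal.ofReal_sum_of_nonneg fun i _ => by positivity,
    ← ENNReal.ofReal_pow (Finset.sum_nonneg fun i _ => norm_nonneg _)]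
  exact ENNReal.ofReal_le_ofReal (Finset.sum_sq_le_sq_sum_of_nonneg fun i _ => norm_nonneg _)

theorem lintegral_fderiv_sq_le {Ω : Set E3} {φ : E3 → E3} {g : Fin 3 → L2V Ω}
    (hφ : ContDiff ℝ ∞ φ)
    (hg : ∀ i, (g i : E3 → E3) =ᵐ[volume.restrict Ω] fun x => fderiv ℝ φ x (e3 i)) :
    ∫⁻ x in Ω, ‖fderiv ℝ φ x‖ₑ ^ 2 ≤ ENNReal.ofReal (∑ i, ‖g i‖) ^ 2 := by
  refine le_trans ?_ (sum_enorm_sq_le g)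
  have hc : Continuous (fderiv ℝ φ) := hφ.continuous_fderiv (by simp)
  simp only [Lp_enorm_sq]
  rw [← lintegral_finsetSum' _ fun i _ => ((Lp.aestronglyMeasurable (g i)).enorm.pow_const 2)]
  refine lintegral_mono_ae ?_
  filter_upwards [ae_all_iff.2 hg] with x hx
  simp only [hx]
  exact norm_fderiv_sq_le _

theorem lintegral_fderiv_eq_setLIntegral {Ω : Set E3} (hΩ : MeasurableSet Ω) {φ : E3 → E3}
    (hs : tsupport φ ⊆ Ω) : ∫⁻ x, ‖fderiv ℝ φ x‖ₑ ^ 2 = ∫⁻ x in Ω, ‖fderiv ℝ φ x‖ₑ ^ 2 := by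
  rw [← lintegral_indicator hΩ]
  congr 1
  ext x
  by_cases hx : x ∈ Ω
  · rw [indicator_of_mem hx]
  · rw [indicator_of_notMem hx]
    have : fderiv ℝ φ x = 0 := by
      by_contra h
      exact hx (hs (support_fderiv_subset ℝ h))
    have h0 : ‖fderiv ℝ φ x‖ = 0 := by rw [this]; exact norm_zero
    rw [← ofReal_norm, h0, ENNReal.ofReal_zero, zero_pow two_ne_zero]

/-- Pairing an `H¹₀` field with `K` or with the regularization of `K` makes little difference:
the regularity of the former compensates for the lack of regularity of the latter. -/
theorem HasH10Grad.abs_inner_sub_inner_carry_le {Ω : Set E3} (hΩ : IsOpen Ω) {z : L2V Ω}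
    {g : Fin 3 → L2V Ω} (hz : HasH10Grad Ω z g) {ξ : E3 → E3} (hξ : IsDisplacement ξ) {δ₀ l : ℝ}
    (hδ₀ : ∀ x, ‖ξ x‖ ≤ δ₀) (hl : ∀ x, ‖fderiv ℝ ξ x‖ ≤ l) {ζ : E3 → ℝ} {ρ : ℝ}
    (hζ : IsKernel ζ ρ) (hρ : 0 ≤ ρ) (K : L2V Ω) :
    |inner ℝ z K - inner ℝ z (((memLp_carry hξ hζ.contDiff hζ.compact K).restrict Ω).toLp _)| ≤
      (6 * (δ₀ + ρ) * ∑ i, ‖g i‖ + l * ‖z‖) * ‖K‖ := by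
  set W := ((memLp_carry hξ hζ.contDiff hζ.compact K).restrict Ω).toLp _
  have hcl : IsClosed {q : L2V Ω × (Fin 3 → L2V Ω) | |inner ℝ q.1 K - inner ℝ q.1 W| ≤
      (6 * (δ₀ + ρ) * ∑ i, ‖q.2 i‖ + l * ‖q.1‖) * ‖K‖} := by
    refine isClosed_le ?_ ?_ <;> fun_prop
  refine closure_minimal ?_ hcl hz
  rintro ⟨z, g⟩ ⟨φ, hφ, hφs, hsupp, hzφ, hgφ⟩
  simp only [mem_ofPred_eq] at hzφ hgφ ⊢
  have hδ : 0 ≤ δ₀ + ρ := add_nonneg ((norm_nonneg _).trans (hδ₀ 0)) hρ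
  have hcξ := hξ.contDiff.continuous
  have hcφ := hφ.continuous
  have hcζ := hζ.contDiff.continuous
  have hg0 : 0 ≤ ∑ i, ‖g i‖ := Finset.sum_nonneg fun i _ => norm_nonneg _
  let D : E3 → E3 := fun x => (∫ y, ζ y • φ (x + (ξ x + y))) - φ x
  have hDm : AEStronglyMeasurable D volume := by
    refine AEStronglyMeasurable.sub ?_ hcφ.aestronglyMeasurable
    have : StronglyMeasurable fun p : E3 × E3 => ζ p.2 • φ (p.1 + (ξ p.1 + p.2)) :=
      Continuous.stronglyMeasurable (by fun_prop)
    exact this.integral_prod_right.aestronglyMeasurable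
  have hDl : ∫⁻ x in Ω, ‖D x‖ₑ ^ 2 ≤ ENNReal.ofReal (3 * (δ₀ + ρ) * ∑ i, ‖g i‖) ^ 2 := by
    calc _ ≤ ∫⁻ x, ‖D x‖ₑ ^ 2 := lintegral_mono' Measure.restrict_le_self le_rfl
      _ ≤ 8 * ENNReal.ofReal (δ₀ + ρ) ^ 2 * ∫⁻ x, ‖fderiv ℝ φ x‖ₑ ^ 2 :=
        lintegral_smear_sub_le (hφ.of_le (by simp)) hξ.lipschitz hδ₀ hζ
      _ ≤ 9 * ENNReal.ofReal (δ₀ + ρ) ^ 2 * ENNReal.ofReal (∑ i, ‖g i‖) ^ 2 := by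
        rw [lintegral_fderiv_eq_setLIntegral hΩ.measurableSet hsupp]
        gcongr
        · norm_num
        · exact lintegral_fderiv_sq_le hφ hgφ
      _ = _ := by
        rw [ENNReal.ofReal_mul (by positivity), ENNReal.ofReal_mul (by positivity), mul_pow, mul_pow]
        norm_num
  have hD : MemLp D 2 (volume.restrict Ω) :=
    memLp_two_of_lintegral hDm.restrict (hDl.trans_lt (by simp))
  have hDn : ‖hD.toLp D‖ ≤ 3 * (δ₀ + ρ) * ∑ i, ‖g i‖ :=
    norm_toLp_le_of_lintegral hD (by positivity) hDl
  set d := hD.toLp D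
  set R := matMul Ω (fderiv ℝ ξ) hξ.stronglyMeasurable l hl K
  have hR : ‖R‖ ≤ l * ‖K‖ := norm_matMul_le Ω _ hl K
  have hR2 : ‖R‖ ≤ 1 / 2 * ‖K‖ := by
    have h : R = matMul Ω (fderiv ℝ ξ) hξ.stronglyMeasurable (1 / 2) hξ.norm_fderiv_le K := by
      refine Lp.ext ?_
      filter_upwards [matMul_coeFn Ω hξ.stronglyMeasurable hl K,
        matMul_coeFn Ω hξ.stronglyMeasurable hξ.norm_fderiv_le K] with x h1 h2
      rw [h1, h2]
    rw [h]
    exact norm_matMul_le Ω _ hξ.norm_fderiv_le K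
  have hW : inner ℝ z W = inner ℝ (z + d) (K + R) := by
    have h1 := integral_inner_kernelOp hξ.lipschitz hζ.contDiff hζ.compact (hξ.memLp K) hcφ hφs
    rw [L2.inner_def, L2.inner_def]
    calc _ = ∫ y in Ω, inner ℝ (φ y) (carry Ω ξ ζ K y) := by
          refine integral_congr_ae ?_
          filter_upwards [hzφ, ((memLp_carry hξ hζ.contDiff hζ.compact K).restrict Ω).coeFn_toLp]
            with x h1 h2
          rw [h1, h2]
      _ = ∫ y, inner ℝ (φ y) (carry Ω ξ ζ K y) := by
          refine setIntegral_eq_integral_of_forall_compl_eq_zero fun x hx => ?_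
          rw [image_eq_zero_of_notMem_tsupport fun h => hx (hsupp h), inner_zero_left]
      _ = _ := h1
      _ = _ := by
          refine integral_congr_ae ?_
          filter_upwards [hzφ, hD.coeFn_toLp, Lp.coeFn_add z d, Lp.coeFn_add K R,
            matMul_coeFn Ω hξ.stronglyMeasurable hl K] with x h1 h2 h3 h4 h5
          rw [h3, h4, Pi.add_apply, Pi.add_apply, h1, h2, h5]
          simp only [D]
          rw [add_sub_cancel]
  have hexp : inner ℝ z K - inner ℝ z W = -(inner ℝ d (K + R) + inner ℝ z R) := by
    rw [hW]
    simp only [inner_add_left, inner_add_right]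
    ring
  rw [hexp, abs_neg]
  refine (abs_add_le _ _).trans ?_
  have h1 := abs_real_inner_le_norm d (K + R)
  have h2 := abs_real_inner_le_norm z R
  have h3 : ‖K + R‖ ≤ 2 * ‖K‖ := (norm_add_le _ _).trans (by linarith [norm_nonneg K])
  have h4 : ‖d‖ * ‖K + R‖ ≤ (3 * (δ₀ + ρ) * ∑ i, ‖g i‖) * (2 * ‖K‖) := by gcongr
  have h5 : ‖z‖ * ‖R‖ ≤ ‖z‖ * (l * ‖K‖) := by gcongr
  linarith

/-! ### Regularization at a given length -/

theorem exists_isKernel {ρ : ℝ} (hρ : 0 < ρ) : ∃ η : E3 → ℝ, IsKernel η ρ := by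
  let f : ContDiffBump (0 : E3) := ⟨ρ / 2, ρ, by positivity, by linarith⟩
  exact ⟨f.normed volume, f.contDiff_normed, f.nonneg_normed, f.integral_normed,
    (f.tsupport_normed_eq (μ := volume)).subset⟩

theorem lintegral_comp_inv_smul (f : E3 → ℝ≥0∞) (hf : Measurable f) {α : ℝ} (hα : 0 < α) :
    ∫⁻ x, f (α⁻¹ • x) = ENNReal.ofReal (α ^ 3) * ∫⁻ x, f x := by
  have hm : Measurable fun x : E3 => α⁻¹ • x := by fun_prop
  rw [← lintegral_map hf hm, Measure.map_addHaar_smul _ (inv_ne_zero hα.ne'),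
    lintegral_smul_measure, smul_eq_mul]
  congr 2
  simp [abs_of_pos hα]

/-- The `L¹`-normalized rescaling of a kernel to the length `α`. -/
def rescale (η : E3 → ℝ) (α : ℝ) (x : E3) : ℝ := (α ^ 3)⁻¹ * η (α⁻¹ • x)

theorem IsKernel.rescale {η : E3 → ℝ} {ρ α : ℝ} (h : IsKernel η ρ) (hα : 0 < α) :
    IsKernel (rescale η α) (α * ρ) where
  contDiff := contDiff_const.mul (h.contDiff.comp (contDiff_const_smul _))
  nonneg x := mul_nonneg (by positivity) (h.nonneg _)
  integral_eq := by
    simp only [_root_.rescale]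
    rw [integral_const_mul, Measure.integral_comp_inv_smul, h.integral_eq]
    simp [abs_of_pos hα, hα.ne']
  tsupport_subset := by
    refine closure_minimal (fun x hx => ?_) Metric.isClosed_closedBall
    have h1 : η (α⁻¹ • x) ≠ 0 := fun h0 => hx (by simp [_root_.rescale, h0])
    have h2 := h.norm_le h1
    rw [norm_smul, norm_inv, Real.norm_of_nonneg hα.le, inv_mul_le_iff₀ hα] at h2
    simpa using h2

theorem fderiv_rescale {η : E3 → ℝ} (hη : ContDiff ℝ 1 η) (α : ℝ) (x v : E3) :
    fderiv ℝ (rescale η α) x v = (α ^ 3)⁻¹ * (α⁻¹ * fderiv ℝ η (α⁻¹ • x) v) := by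
  have h1 : HasFDerivAt (fun x : E3 => α⁻¹ • x) (α⁻¹ • ContinuousLinearMap.id ℝ E3) x :=
    (hasFDerivAt_id x).const_smul α⁻¹
  have h2 := (((hη.differentiable one_ne_zero) (α⁻¹ • x)).hasFDerivAt.comp x h1).const_mul (α ^ 3)⁻¹
  have h3 : HasFDerivAt (rescale η α) _ x := h2
  rw [h3.fderiv]
  simp

/-- `W` regularizes the solenoidal fields of `L²(Ω)` at the length `α`, with constant `C`: it
yields smooth divergence-free fields that vanish near the obstacle, with the bounds of a
mollification, and it is close to the identity when tested against `H¹₀` fields. -/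
structure IsRegularization (Ω : Set E3) (C α : ℝ) (W : L2V Ω → E3 → E3) : Prop where
  contDiff : ∀ K, ContDiff ℝ ∞ (W K)
  tsupport_subset : ∀ K, tsupport (W K) ⊆ Ω
  div_eq_zero : ∀ K ∈ solenoidal Ω, ∀ y, ∑ i, fderiv ℝ (W K) y (e3 i) i = 0
  map_sub : ∀ K K', W (K - K') = W K - W K'
  lintegral_le : ∀ K, ∫⁻ y in Ω, ‖W K y‖ₑ ^ 2 ≤ ENNReal.ofReal (C * ‖K‖) ^ 2
  lintegral_fderiv_le : ∀ K i, ∫⁻ y in Ω, ‖fderiv ℝ (W K) y (e3 i)‖ₑ ^ 2 ≤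
    ENNReal.ofReal (C * α⁻¹ * ‖K‖) ^ 2
  norm_le : ∀ K y, ‖W K y‖ ≤ C * α ^ (-(3 / 2) : ℝ) * ‖K‖
  abs_inner_sub_le : ∀ z g K, HasH10Grad Ω z g →
    |inner ℝ z K - ∫ x in Ω, inner ℝ (z x) (W K x)| ≤ C * α * (‖z‖ + ∑ i, ‖g i‖) * ‖K‖

theorem IsDisplacement.lintegral_kernelOp_le {ξ : E3 → E3} (hξ : IsDisplacement ξ) {Ω : Set E3}
    (K : L2V Ω) {ζ : E3 → ℝ} (hζ : Continuous ζ) {B : ℝ} (hB : 0 ≤ B)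
    (h : ∫⁻ x, ‖ζ x‖ₑ ≤ ENNReal.ofReal B) :
    ∫⁻ y in Ω, ‖kernelOp Ω ξ ζ (fun x => K x + fderiv ℝ ξ x (K x)) y‖ₑ ^ 2 ≤
      ENNReal.ofReal (6 * B * ‖K‖) ^ 2 := by
  calc _ ≤ ∫⁻ y, ‖kernelOp Ω ξ ζ (fun x => K x + fderiv ℝ ξ x (K x)) y‖ₑ ^ 2 :=
        lintegral_mono' Measure.restrict_le_self le_rfl
    _ ≤ 8 * (∫⁻ x, ‖ζ x‖ₑ) ^ 2 * ∫⁻ x in Ω, ‖K x + fderiv ℝ ξ x (K x)‖ₑ ^ 2 :=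
        lintegral_kernelOp_sq_le hξ.lipschitz hζ (hξ.memLp K).1
    _ ≤ 8 * ENNReal.ofReal B ^ 2 * (4 * ‖K‖ₑ ^ 2) := by
        gcongr
        exact hξ.lintegral_le K
    _ = 32 * (ENNReal.ofReal B ^ 2 * ‖K‖ₑ ^ 2) := by ring
    _ ≤ 36 * (ENNReal.ofReal B ^ 2 * ‖K‖ₑ ^ 2) := by gcongr; norm_num
    _ = _ := by
        rw [ENNReal.ofReal_mul (by positivity), ENNReal.ofReal_mul (by positivity), mul_pow, mul_pow,
          ofReal_norm]
        norm_num
        ring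

theorem IsDisplacement.norm_kernelOp_le {ξ : E3 → E3} (hξ : IsDisplacement ξ) {Ω : Set E3}
    (K : L2V Ω) {ζ : E3 → ℝ} (hζ : Continuous ζ) {B : ℝ} (hB : 0 ≤ B)
    (h : ∫⁻ x, ‖ζ x‖ₑ ^ 2 ≤ ENNReal.ofReal B ^ 2) (y : E3) :
    ‖kernelOp Ω ξ ζ (fun x => K x + fderiv ℝ ξ x (K x)) y‖ ≤ 6 * B * ‖K‖ := by
  have h1 : ‖kernelOp Ω ξ ζ (fun x => K x + fderiv ℝ ξ x (K x)) y‖ₑ ^ 2 ≤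
      ENNReal.ofReal (6 * B * ‖K‖) ^ 2 := by
    calc _ ≤ 8 * (∫⁻ x, ‖ζ x‖ₑ ^ 2) * ∫⁻ x in Ω, ‖K x + fderiv ℝ ξ x (K x)‖ₑ ^ 2 :=
          enorm_kernelOp_sq_le hξ.lipschitz hζ (hξ.memLp K).1 y
      _ ≤ 8 * ENNReal.ofReal B ^ 2 * (4 * ‖K‖ₑ ^ 2) := by
          gcongr
          exact hξ.lintegral_le K
      _ = 32 * (ENNReal.ofReal B ^ 2 * ‖K‖ₑ ^ 2) := by ring
      _ ≤ 36 * (ENNReal.ofReal B ^ 2 * ‖K‖ₑ ^ 2) := by gcongr; norm_num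
      _ = _ := by
          rw [ENNReal.ofReal_mul (by positivity), ENNReal.ofReal_mul (by positivity), mul_pow,
            mul_pow, ofReal_norm]
          norm_num
          ring
  have h2 := (ENNReal.pow_le_pow_left_iff two_ne_zero).1 h1
  rwa [← ofReal_norm, ENNReal.ofReal_le_ofReal_iff (by positivity)] at h2

theorem carry_sub {Ω : Set E3} {ξ : E3 → E3} (hξ : IsDisplacement ξ) {ζ : E3 → ℝ}
    (hζ : Continuous ζ) (hζs : HasCompactSupport ζ) (K K' : L2V Ω) :
    carry Ω ξ ζ (K - K') = carry Ω ξ ζ K - carry Ω ξ ζ K' := by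
  ext1 y
  rw [Pi.sub_apply, carry, carry, carry, kernelOp, kernelOp, kernelOp, ← integral_sub
    (integrable_kernel_smul hξ.lipschitz hζ hζs (hξ.memLp K) y)
    (integrable_kernel_smul hξ.lipschitz hζ hζs (hξ.memLp K') y)]
  refine integral_congr_ae ?_
  filter_upwards [Lp.coeFn_sub K K'] with x hx
  simp only [hx, Pi.sub_apply, map_sub]
  rw [← smul_sub]
  congr 1
  abel

theorem lintegral_rescale_fderiv {η : E3 → ℝ} (hη : ContDiff ℝ 1 η) {α : ℝ} (hα : 0 < α) (v : E3) :
    ∫⁻ x, ‖fderiv ℝ (rescale η α) x v‖ₑ = ENNReal.ofReal α⁻¹ * ∫⁻ x, ‖fderiv ℝ η x v‖ₑ := by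
  have hc : Continuous fun x => fderiv ℝ η x v :=
    (hη.continuous_fderiv one_ne_zero).clm_apply continuous_const
  simp only [fderiv_rescale hη, enorm_mul]
  rw [lintegral_const_mul' _ _ (by simp), lintegral_const_mul' _ _ (by simp),
    lintegral_comp_inv_smul (fun x => ‖fderiv ℝ η x v‖ₑ) hc.enorm.measurable hα, ← mul_assoc,
    ← mul_assoc, ← ofReal_norm, ← ofReal_norm, ← ENNReal.ofReal_mul (norm_nonneg _),
    ← ENNReal.ofReal_mul (by positivity)]
  congr 2
  rw [Real.norm_of_nonneg (by positivity), Real.norm_of_nonneg (by positivity)]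
  field_simp

theorem lintegral_rescale_sq {η : E3 → ℝ} (hη : Continuous η) {α : ℝ} (hα : 0 < α) :
    ∫⁻ x, ‖rescale η α x‖ₑ ^ 2 = ENNReal.ofReal (α ^ (-(3 / 2) : ℝ)) ^ 2 * ∫⁻ x, ‖η x‖ₑ ^ 2 := by
  simp only [rescale, enorm_mul, mul_pow]
  rw [lintegral_const_mul' _ _ (by simp), lintegral_comp_inv_smul (fun x => ‖η x‖ₑ ^ 2)
      (hη.enorm.measurable.pow_const 2) hα, ← mul_assoc, ← ofReal_norm,
    ← ENNReal.ofReal_pow (norm_nonneg _), ← ENNReal.ofReal_mul (by positivity),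
    ← ENNReal.ofReal_pow (by positivity)]
  congr 2
  rw [Real.norm_of_nonneg (by positivity), ← Real.rpow_natCast (α ^ (-(3 / 2) : ℝ)),
    ← Real.rpow_mul hα.le]
  norm_num
  field_simp

theorem IsExteriorDomain.exists_isRegularization {Ω : Set E3} (hΩ : IsExteriorDomain Ω) :
    ∃ C : ℝ, 0 ≤ C ∧ ∀ α : ℝ, 0 < α → α ≤ 1 → ∃ W, IsRegularization Ω C α W := by
  obtain ⟨θ, hθ, hθs, c, hc, hθΩ⟩ := hΩ.exists_outward_field
  have hθd : Continuous (fderiv ℝ θ) := hθ.continuous_fderiv (by simp)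
  obtain ⟨M, hM⟩ := hθs.exists_bound_of_continuous hθ.continuous
  obtain ⟨L, hL⟩ := (hθs.fderiv (𝕜 := ℝ)).exists_bound_of_continuous hθd
  have hM0 : 0 ≤ M := (norm_nonneg _).trans (hM 0)
  have hL0 : 0 ≤ L := (norm_nonneg _).trans (hL 0)
  obtain ⟨η, hη⟩ := exists_isKernel (half_pos hc)
  have hη1 : ContDiff ℝ 1 η := hη.contDiff.of_le (by simp)
  -- the length at which the displacement `α θ` has derivative at most `1/2`
  set α₀ : ℝ := (2 * (L + 1))⁻¹ with hα₀
  have hα₀pos : 0 < α₀ := by positivity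
  have hα₀1 : α₀ ≤ 1 := inv_le_one_of_one_le₀ (by linarith)
  have hα₀L : α₀ * L ≤ 1 / 2 := by
    rw [hα₀, inv_mul_le_iff₀ (by positivity)]; linarith
  set I : ℝ := ∑ i, (∫⁻ x, ‖fderiv ℝ η x (e3 i)‖ₑ).toReal with hI
  have hI0 : 0 ≤ I := Finset.sum_nonneg fun i _ => ENNReal.toReal_nonneg
  have hIi : ∀ i, ∫⁻ x, ‖fderiv ℝ η x (e3 i)‖ₑ ≤ ENNReal.ofReal I := by
    intro i
    have hfin : ∫⁻ x, ‖fderiv ℝ η x (e3 i)‖ₑ ≠ ⊤ :=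
      (((hη1.continuous_fderiv one_ne_zero).clm_apply
        continuous_const).integrable_of_hasCompactSupport
        (hη.compact.fderiv_apply (𝕜 := ℝ) (e3 i))).2.ne
    rw [← ENNReal.ofReal_toReal hfin]
    exact ENNReal.ofReal_le_ofReal (Finset.single_le_sum
      (f := fun i => (∫⁻ x, ‖fderiv ℝ η x (e3 i)‖ₑ).toReal)
      (fun i _ => ENNReal.toReal_nonneg) (Finset.mem_univ i))
  set J : ℝ := √(∫⁻ x, ‖η x‖ₑ ^ 2).toReal with hJ
  have hJi : ∫⁻ x, ‖η x‖ₑ ^ 2 = ENNReal.ofReal J ^ 2 := by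
    rw [← ENNReal.ofReal_pow (Real.sqrt_nonneg _), Real.sq_sqrt ENNReal.toReal_nonneg,
      ENNReal.ofReal_toReal]
    exact (hη.contDiff.continuous.memLp_of_hasCompactSupport hη.compact
      (p := 2) (μ := volume)).lintegral_sq_lt_top.ne
  have hJ0 : 0 ≤ J := Real.sqrt_nonneg _
  have ht0 : 0 ≤ α₀ ^ (-(3 / 2) : ℝ) := by positivity
  refine ⟨6 + 6 * (α₀⁻¹ * I) + 6 * (α₀ ^ (-(3 / 2) : ℝ) * J) + 6 * (M + c / 2) + L, by positivity,
    fun α hα hα1 => ?_⟩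
  set β : ℝ := α₀ * α with hβ
  have hβpos : 0 < β := by positivity
  have hβ1 : β ≤ 1 := mul_le_one₀ hα₀1 hα.le hα1
  have hβα : β ≤ α := mul_le_of_le_one_left hα.le hα₀1
  have hβd : ∀ x, fderiv ℝ (fun x => β • θ x) x = β • fderiv ℝ θ x := fun x =>
    fderiv_const_smul ((hθ.differentiable (by simp)) x) β
  have hnd : ∀ x, ‖fderiv ℝ (fun x => β • θ x) x‖ ≤ β * L := by
    intro x
    rw [hβd, norm_smul, Real.norm_of_nonneg hβpos.le]
    gcongr
    exact hL x
  have hξ : IsDisplacement fun x => β • θ x := by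
    refine ⟨hθ.const_smul β, fun x => (hnd x).trans ?_⟩
    calc β * L = (α₀ * L) * α := by rw [hβ]; ring
      _ ≤ 1 / 2 * 1 := by gcongr
      _ = 1 / 2 := by norm_num
  have hζ := hη.rescale hβpos
  have hζd : ∀ i, Continuous fun z => fderiv ℝ (rescale η β) z (e3 i) := fun i =>
    (hζ.contDiff.continuous_fderiv (by simp)).clm_apply continuous_const
  refine ⟨carry Ω (fun x => β • θ x) (rescale η β), ?_⟩
  constructor
  · exact fun K => contDiff_kernelOp hξ.lipschitz hζ.contDiff hζ.compact (hξ.memLp K)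
  · intro K
    refine tsupport_kernelOp_subset (σ := c * β) hζ.tsupport_subset ?_ hΩ.isOpen.measurableSet
      fun x hx => hθΩ β hβpos hβ1 x hx
    nlinarith
  · exact fun K hK y => div_carry_eq_zero hξ hζ.contDiff hζ.compact hK y
  · exact fun K K' => carry_sub hξ hζ.contDiff.continuous hζ.compact K K'
  · intro K
    refine (hξ.lintegral_kernelOp_le K hζ.contDiff.continuous zero_le_one
      (by rw [hζ.lintegral_eq, ENNReal.ofReal_one])).trans ?_
    gcongr
    have : 0 ≤ 6 * (α₀⁻¹ * I) + 6 * (α₀ ^ (-(3 / 2) : ℝ) * J) + 6 * (M + c / 2) + L := by positivity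
    linarith
  · intro K i
    have h1 : ∀ y, fderiv ℝ (carry Ω (fun x => β • θ x) (rescale η β) K) y (e3 i) = _ := fun y =>
      fderiv_kernelOp_apply hξ.lipschitz (hζ.contDiff.of_le (by simp)) hζ.compact (hξ.memLp K) y _
    simp only [h1]
    refine (hξ.lintegral_kernelOp_le K (hζd i) (B := β⁻¹ * I) (by positivity) ?_).trans ?_
    · rw [lintegral_rescale_fderiv hη1 hβpos, ENNReal.ofReal_mul (by positivity)]
      gcongr
      exact hIi i
    · refine pow_le_pow_left' (ENNReal.ofReal_le_ofReal
        (mul_le_mul_of_nonneg_right ?_ (norm_nonneg _))) 2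
      rw [hβ, mul_inv, show 6 * (α₀⁻¹ * α⁻¹ * I) = 6 * (α₀⁻¹ * I) * α⁻¹ by ring]
      refine mul_le_mul_of_nonneg_right ?_ (by positivity)
      have : 0 ≤ 6 + 6 * (α₀ ^ (-(3 / 2) : ℝ) * J) + 6 * (M + c / 2) + L := by positivity
      linarith
  · intro K y
    refine (hξ.norm_kernelOp_le K hζ.contDiff.continuous (B := β ^ (-(3 / 2) : ℝ) * J)
      (by positivity) ?_ y).trans ?_
    · rw [lintegral_rescale_sq hη.contDiff.continuous hβpos, hJi,
        ENNReal.ofReal_mul (by positivity), mul_pow]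
    · refine mul_le_mul_of_nonneg_right ?_ (norm_nonneg _)
      rw [hβ, Real.mul_rpow hα₀pos.le hα.le,
        show 6 * (α₀ ^ (-(3 / 2) : ℝ) * α ^ (-(3 / 2) : ℝ) * J) =
          6 * (α₀ ^ (-(3 / 2) : ℝ) * J) * α ^ (-(3 / 2) : ℝ) by ring]
      refine mul_le_mul_of_nonneg_right ?_ (by positivity)
      have : 0 ≤ 6 + 6 * (α₀⁻¹ * I) + 6 * (M + c / 2) + L := by positivity
      linarith
  · intro z g K hz
    have h1 := hz.abs_inner_sub_inner_carry_le hΩ.isOpen hξ (δ₀ := β * M) (l := β * L)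
      (fun x => by
        rw [norm_smul, Real.norm_of_nonneg hβpos.le]
        gcongr
        exact hM x) hnd hζ (by positivity) K
    have h2 : inner ℝ z (((memLp_carry hξ hζ.contDiff hζ.compact K).restrict Ω).toLp _) =
        ∫ x in Ω, inner ℝ (z x) (carry Ω (fun x => β • θ x) (rescale η β) K x) := by
      rw [L2.inner_def]
      refine integral_congr_ae ?_
      filter_upwards [((memLp_carry hξ hζ.contDiff hζ.compact K).restrict Ω).coeFn_toLp] with x hx
      rw [hx]
    rw [h2] at h1
    refine h1.trans ?_
    have hg0 : 0 ≤ ∑ i, ‖g i‖ := Finset.sum_nonneg fun i _ => norm_nonneg _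
    set S := ∑ i, ‖g i‖
    gcongr
    calc _ = β * (6 * (M + c / 2) * S + L * ‖z‖) := by ring
      _ ≤ α * ((6 * (M + c / 2) + L) * (‖z‖ + S)) := by
        gcongr
        have h3 : 0 ≤ 6 * (M + c / 2) * ‖z‖ := by positivity
        have h4 : 0 ≤ L * S := by positivity
        linarith
      _ ≤ α * ((6 + 6 * (α₀⁻¹ * I) + 6 * (α₀ ^ (-(3 / 2) : ℝ) * J) + 6 * (M + c / 2) + L) *
          (‖z‖ + S)) := by
        gcongr
        have : 0 ≤ 6 + 6 * (α₀⁻¹ * I) + 6 * (α₀ ^ (-(3 / 2) : ℝ) * J) := by positivity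
        linarith
      _ = _ := by ring

/-! ### Test fields and the weak momentum equation -/

/-- A smooth field of `Ω`, bounded by `B`, square integrable with its derivatives, and vanishing
near the boundary; it need not have compact support. -/
structure IsTestField (Ω : Set E3) (B : ℝ) (w : E3 → E3) : Prop where
  contDiff : ContDiff ℝ ∞ w
  tsupport_subset : tsupport w ⊆ Ω
  norm_le : ∀ x, ‖w x‖ ≤ B
  memLp : MemLp w 2 (volume.restrict Ω)
  memLp_fderiv : ∀ i, MemLp (fun x => fderiv ℝ w x (e3 i)) 2 (volume.restrict Ω)

/-- The viscous and convective terms of the equation, tested with `w`. -/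
def force (Ω : Set E3) (w : E3 → E3) (a : L2V Ω) (g : Fin 3 → L2V Ω) : ℝ :=
  ∫ x in Ω, (∑ i, inner ℝ (g i x) (fderiv ℝ w x (e3 i))
    + inner ℝ ((∑ i, a x i • g i x) + (1 / 2 : ℝ) • (∑ i, g i x i) • a x) (w x))

/-- The matrix field by which the convective term tested with `w` becomes a sum of pairings
`⟨a, Mᵢ gᵢ⟩`. -/
def convMat (w : E3 → E3) (i : Fin 3) (x : E3) : E3 →L[ℝ] E3 :=
  (innerSL ℝ (w x)).smulRight (e3 i) +
    (1 / 2 : ℝ) • (EuclideanSpace.proj i : E3 →L[ℝ] ℝ).smulRight (w x)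

theorem convMat_apply (w : E3 → E3) (i : Fin 3) (x v : E3) :
    convMat w i x v = inner ℝ (w x) v • e3 i + (1 / 2 : ℝ) • v i • w x := by
  simp [convMat]

theorem norm_convMat_le {w : E3 → E3} {B : ℝ} (hB : ∀ x, ‖w x‖ ≤ B) (i : Fin 3) (x : E3) :
    ‖convMat w i x‖ ≤ 2 * B := by
  have hB0 : 0 ≤ B := (norm_nonneg _).trans (hB x)
  refine ContinuousLinearMap.opNorm_le_bound _ (by positivity) fun v => ?_
  rw [convMat_apply]
  have h1 : ‖inner ℝ (w x) v • e3 i‖ ≤ B * ‖v‖ := by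
    rw [norm_smul, show ‖e3 i‖ = 1 by simp, mul_one]
    exact (norm_inner_le_norm _ _).trans (by gcongr; exact hB x)
  have h2 : ‖(1 / 2 : ℝ) • v i • w x‖ ≤ B * ‖v‖ := by
    rw [norm_smul, norm_smul]
    have h3 : ‖v i‖ * ‖w x‖ ≤ ‖v‖ * B := by
      gcongr
      · exact PiLp.norm_apply_le v i
      · exact hB x
    have h4 : 0 ≤ ‖v i‖ * ‖w x‖ := by positivity
    rw [Real.norm_of_nonneg (by norm_num : (0 : ℝ) ≤ 1 / 2)]
    linarith
  calc _ ≤ _ := norm_add_le _ _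
    _ ≤ _ := by linarith

theorem stronglyMeasurable_convMat {w : E3 → E3} (hw : Continuous w) (i : Fin 3) :
    StronglyMeasurable (convMat w i) := by
  refine Continuous.stronglyMeasurable (Continuous.add (f := fun x => (innerSL ℝ (w x)).smulRight
    (e3 i)) (g := fun x => (1 / 2 : ℝ) • (EuclideanSpace.proj i : E3 →L[ℝ] ℝ).smulRight (w x)) ?_
    (Continuous.fun_const_smul ?_ _))
  · exact ((ContinuousLinearMap.smulRightL ℝ E3 E3).flip (e3 i)).continuous.comp
      ((innerSL ℝ (E := E3)).continuous.comp hw)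
  · exact ((ContinuousLinearMap.smulRightL ℝ E3 E3)
      (EuclideanSpace.proj i : E3 →L[ℝ] ℝ)).continuous.comp hw

theorem inner_convection_eq (w : E3 → E3) (x a : E3) (g : Fin 3 → E3) :
    inner ℝ ((∑ i, a i • g i) + (1 / 2 : ℝ) • (∑ i, g i i) • a) (w x) =
      ∑ i, inner ℝ a (convMat w i x (g i)) := by
  simp only [convMat_apply, inner_add_left, inner_add_right, sum_inner, inner_smul_left,
    inner_smul_right, Finset.sum_add_distrib]
  congr 1
  · refine Finset.sum_congr rfl fun i _ => ?_
    rw [real_inner_comm (w x), EuclideanSpace.inner_single_right]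
    simp [mul_comm]
  · simp [Finset.mul_sum, Finset.sum_mul]

theorem IsTestField.integrable_force {Ω : Set E3} {B : ℝ} {w : E3 → E3} (hw : IsTestField Ω B w)
    (a : L2V Ω) (g : Fin 3 → L2V Ω) :
    Integrable (fun x => ∑ i, inner ℝ (g i x) (fderiv ℝ w x (e3 i))
      + inner ℝ ((∑ i, a x i • g i x) + (1 / 2 : ℝ) • (∑ i, g i x i) • a x) (w x))
      (volume.restrict Ω) ∧
    force Ω w a g = ∑ i, (inner ℝ (g i) ((hw.memLp_fderiv i).toLp _) +
      inner ℝ a (matMul Ω (convMat w i) (stronglyMeasurable_convMat hw.contDiff.continuous i) (2 * B)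
        (norm_convMat_le hw.norm_le i) (g i))) := by
  set D := fun i => (hw.memLp_fderiv i).toLp _ with hD
  set M := fun i => matMul Ω (convMat w i) (stronglyMeasurable_convMat hw.contDiff.continuous i)
    (2 * B) (norm_convMat_le hw.norm_le i) (g i) with hM
  have hae : (fun x => ∑ i, inner ℝ (g i x) (fderiv ℝ w x (e3 i))
      + inner ℝ ((∑ i, a x i • g i x) + (1 / 2 : ℝ) • (∑ i, g i x i) • a x) (w x))
      =ᵐ[volume.restrict Ω] fun x => ∑ i, (inner ℝ (g i x) (D i x) + inner ℝ (a x) (M i x)) := by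
    filter_upwards [ae_all_iff.2 fun i => (hw.memLp_fderiv i).coeFn_toLp,
      ae_all_iff.2 fun i => matMul_coeFn Ω
        (stronglyMeasurable_convMat hw.contDiff.continuous i) (norm_convMat_le hw.norm_le i) (g i)]
      with x h1 h2
    rw [inner_convection_eq w x (a x) fun i => g i x, Finset.sum_add_distrib]
    simp only [hD, hM, h1, h2]
  have hint : ∀ i, Integrable (fun x => inner ℝ (g i x) (D i x) + inner ℝ (a x) (M i x))
      (volume.restrict Ω) := fun i =>
    (L2.integrable_inner (𝕜 := ℝ) (g i) (D i)).add (L2.integrable_inner (𝕜 := ℝ) a (M i))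
  refine ⟨(integrable_finsetSum _ fun i _ => hint i).congr hae.symm, ?_⟩
  rw [force, integral_congr_ae hae, integral_finsetSum _ fun i _ => hint i]
  refine Finset.sum_congr rfl fun i _ => ?_
  rw [integral_add (L2.integrable_inner _ _) (L2.integrable_inner _ _)]
  rfl

theorem IsTestField.abs_force_le {Ω : Set E3} {B : ℝ} {w : E3 → E3} (hw : IsTestField Ω B w)
    {B' : ℝ} (hB' : ∀ i, ‖(hw.memLp_fderiv i).toLp _‖ ≤ B') (a : L2V Ω) (g : Fin 3 → L2V Ω) :
    |force Ω w a g| ≤ (B' + 2 * B * ‖a‖) * ∑ i, ‖g i‖ := by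
  rw [(hw.integrable_force a g).2, Finset.mul_sum]
  refine (Finset.abs_sum_le_sum_abs _ _).trans (Finset.sum_le_sum fun i _ => ?_)
  refine (abs_add_le _ _).trans ?_
  have h1 := abs_real_inner_le_norm (g i) ((hw.memLp_fderiv i).toLp _)
  have h2 := abs_real_inner_le_norm a (matMul Ω (convMat w i)
    (stronglyMeasurable_convMat hw.contDiff.continuous i) (2 * B)
        (norm_convMat_le hw.norm_le i) (g i))
  have h3 := norm_matMul_le Ω (stronglyMeasurable_convMat hw.contDiff.continuous i)
    (norm_convMat_le hw.norm_le i) (g i)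
  have h4 : ‖g i‖ * ‖(hw.memLp_fderiv i).toLp _‖ ≤ ‖g i‖ * B' := by gcongr; exact hB' i
  have h5 := mul_le_mul_of_nonneg_left h3 (norm_nonneg a)
  calc _ ≤ _ := add_le_add (h1.trans h4) (h2.trans h5)
    _ = _ := by ring

theorem IsTestField.aestronglyMeasurable_force {Ω : Set E3} {B : ℝ} {w : E3 → E3}
    (hw : IsTestField Ω B w) {μ : Measure ℝ} {a : ℝ → L2V Ω} {g : ℝ → Fin 3 → L2V Ω}
    (ha : AEStronglyMeasurable a μ) (hg : ∀ i, AEStronglyMeasurable (fun t => g t i) μ) :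
    AEStronglyMeasurable (fun t => force Ω w (a t) (g t)) μ := by
  simp only [(hw.integrable_force _ _).2]
  refine Finset.aestronglyMeasurable_fun_sum _ fun i _ => ?_
  refine ((hg i).inner aestronglyMeasurable_const).add (ha.inner ?_)
  exact (matMul Ω _ _ _ _).continuous.comp_aestronglyMeasurable (hg i)

/-- A cutoff at the distance `n + 1` from the origin. -/
def cutoff (n : ℕ) (x : E3) : ℝ :=
  (⟨1, 2, one_pos, one_lt_two⟩ : ContDiffBump (0 : E3)) (((n : ℝ) + 1)⁻¹ • x)

theorem contDiff_cutoff (n : ℕ) : ContDiff ℝ ∞ (cutoff n) :=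
  (ContDiffBump.contDiff _).comp (contDiff_const_smul _)

theorem hasCompactSupport_cutoff (n : ℕ) : HasCompactSupport (cutoff n) :=
  (ContDiffBump.hasCompactSupport _).comp_smul (by positivity)

theorem abs_cutoff_le (n : ℕ) (x : E3) : |cutoff n x| ≤ 1 := by
  rw [cutoff, abs_of_nonneg (ContDiffBump.nonneg _)]
  exact ContDiffBump.le_one _

theorem cutoff_eventuallyEq (x : E3) : ∀ᶠ n in atTop, cutoff n =ᶠ[𝓝 x] fun _ => 1 := by
  obtain ⟨N, hN⟩ := exists_nat_gt ‖x‖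
  filter_upwards [eventually_ge_atTop N] with n hn
  have h1 : ∀ᶠ y in 𝓝 x, ‖y‖ < N := continuous_norm.continuousAt.eventually_lt continuousAt_const hN
  filter_upwards [h1] with y hy
  refine ContDiffBump.one_of_mem_closedBall _ ?_
  have h2 : (N : ℝ) ≤ n := by exact_mod_cast hn
  rw [mem_closedBall_zero_iff, norm_smul, norm_inv, Real.norm_of_nonneg (by positivity),
    inv_mul_le_iff₀ (by positivity)]
  linarith

theorem exists_norm_fderiv_cutoff_le : ∃ L : ℝ, ∀ n x, ‖fderiv ℝ (cutoff n) x‖ ≤ L := by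
  set χ : ContDiffBump (0 : E3) := ⟨1, 2, one_pos, one_lt_two⟩
  have hχ : ContDiff ℝ ∞ χ := χ.contDiff
  obtain ⟨L, hL⟩ := (χ.hasCompactSupport.fderiv (𝕜 := ℝ)).exists_bound_of_continuous
    (hχ.continuous_fderiv (by simp))
  refine ⟨L, fun n x => ?_⟩
  have hL0 : 0 ≤ L := (norm_nonneg _).trans (hL 0)
  have h1 : HasFDerivAt (fun x : E3 => ((n : ℝ) + 1)⁻¹ • x)
      (((n : ℝ) + 1)⁻¹ • ContinuousLinearMap.id ℝ E3) x := (hasFDerivAt_id x).const_smul ((n : ℝ) + 1)⁻¹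
  have h2 : HasFDerivAt (cutoff n) _ x :=
    ((hχ.differentiable (by simp)) (((n : ℝ) + 1)⁻¹ • x)).hasFDerivAt.comp x h1
  rw [h2.fderiv]
  refine (ContinuousLinearMap.opNorm_comp_le _ _).trans ?_
  have h3 : ‖((n : ℝ) + 1)⁻¹ • ContinuousLinearMap.id ℝ E3‖ ≤ 1 := by
    rw [norm_smul, norm_inv, Real.norm_of_nonneg (by positivity)]
    calc _ ≤ (1 : ℝ) * 1 := by
          gcongr
          · exact inv_le_one_of_one_le₀ (by linarith [n.cast_nonneg (α := ℝ)])
          · exact ContinuousLinearMap.norm_id_le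
      _ = 1 := one_mul 1
  calc _ ≤ L * 1 := by gcongr; exact hL _
    _ = L := mul_one L

theorem fderiv_cutoff_smul {w : E3 → E3} (hw : ContDiff ℝ ∞ w) (n : ℕ) (x v : E3) :
    fderiv ℝ (fun x => cutoff n x • w x) x v =
      cutoff n x • fderiv ℝ w x v + fderiv ℝ (cutoff n) x v • w x := by
  have := (((contDiff_cutoff n).differentiable (by simp)) x).hasFDerivAt.smul
    ((hw.differentiable (by simp)) x).hasFDerivAt
  have h2 : HasFDerivAt (fun x => cutoff n x • w x) _ x := this
  rw [h2.fderiv]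
  simp

theorem IsTestField.norm_fderiv_cutoff_smul_le {Ω : Set E3} {B : ℝ} {w : E3 → E3}
    (hw : IsTestField Ω B w) {L : ℝ} (hL : ∀ n x, ‖fderiv ℝ (cutoff n) x‖ ≤ L) (n : ℕ)
    (i : Fin 3) (x : E3) :
    ‖fderiv ℝ (fun x => cutoff n x • w x) x (e3 i)‖ ≤ ‖fderiv ℝ w x (e3 i)‖ + L * ‖w x‖ := by
  rw [fderiv_cutoff_smul hw.contDiff]
  refine (norm_add_le _ _).trans (add_le_add ?_ ?_)
  · rw [norm_smul]
    exact mul_le_of_le_one_left (norm_nonneg _) (abs_cutoff_le n x)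
  · rw [norm_smul]
    gcongr
    refine ((fderiv ℝ (cutoff n) x).le_of_opNorm_le (hL n x) _).trans ?_
    simp

theorem IsTestField.cutoff_smul {Ω : Set E3} {B : ℝ} {w : E3 → E3} (hw : IsTestField Ω B w)
    (n : ℕ) : IsTestField Ω B fun x => cutoff n x • w x where
  contDiff := (contDiff_cutoff n).smul hw.contDiff
  tsupport_subset := (tsupport_smul_subset_right _ _).trans hw.tsupport_subset
  norm_le x := by
    rw [norm_smul]
    exact (mul_le_of_le_one_left (norm_nonneg _) (abs_cutoff_le n x)).trans (hw.norm_le x)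
  memLp := by
    refine hw.memLp.of_le ((contDiff_cutoff n).smul hw.contDiff).continuous.aestronglyMeasurable
      (Eventually.of_forall fun x => ?_)
    rw [norm_smul]
    exact mul_le_of_le_one_left (norm_nonneg _) (abs_cutoff_le n x)
  memLp_fderiv i := by
    obtain ⟨L, hL⟩ := exists_norm_fderiv_cutoff_le
    have h1 : MemLp (fun x => ‖fderiv ℝ w x (e3 i)‖ + L * ‖w x‖) 2 (volume.restrict Ω) :=
      (hw.memLp_fderiv i).norm.add (hw.memLp.norm.const_mul L)
    refine h1.of_le ?_ (Eventually.of_forall fun x => ?_)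
    · exact ((((contDiff_cutoff n).smul hw.contDiff).continuous_fderiv
        (by simp)).clm_apply continuous_const).aestronglyMeasurable
    · exact (hw.norm_fderiv_cutoff_smul_le hL n i x).trans (Real.le_norm_self _)

theorem integrable_inner_of_memLp {α E : Type*} [MeasurableSpace α] {μ : Measure α}
    [NormedAddCommGroup E] [InnerProductSpace ℝ E] {f g : α → E} (hf : MemLp f 2 μ)
    (hg : MemLp g 2 μ) : Integrable (fun x => inner ℝ (f x) (g x)) μ := by
  refine (L2.integrable_inner (𝕜 := ℝ) (hf.toLp f) (hg.toLp g)).congr ?_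
  filter_upwards [hf.coeFn_toLp, hg.coeFn_toLp] with x h1 h2
  rw [h1, h2]

theorem inner_toLp_eq {α E : Type*} [MeasurableSpace α] {μ : Measure α}
    [NormedAddCommGroup E] [InnerProductSpace ℝ E] (f : Lp E 2 μ) {g : α → E}
    (hg : MemLp g 2 μ) : inner ℝ f (hg.toLp g) = ∫ x, inner ℝ (f x) (g x) ∂μ := by
  rw [L2.inner_def]
  refine integral_congr_ae ?_
  filter_upwards [hg.coeFn_toLp] with x h1
  rw [h1]

/-- The divergence of a field, as the trace of its derivative. -/
def divField (v : E3 → E3) (x : E3) : ℝ := ∑ i, fderiv ℝ v x (e3 i) i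

theorem memLp_divField {μ : Measure E3} {v : E3 → E3}
    (hv : ∀ i, MemLp (fun x => fderiv ℝ v x (e3 i)) 2 μ) : MemLp (divField v) 2 μ := by
  refine memLp_finsetSum _ fun i _ => ?_
  exact (EuclideanSpace.proj i : E3 →L[ℝ] ℝ).comp_memLp' (hv i)

theorem fderiv_smul_prod {η : ℝ → ℝ} {v : E3 → E3} (hη : Differentiable ℝ η)
    (hv : Differentiable ℝ v) (t s : ℝ) (x h : E3) :
    fderiv ℝ (fun q : ℝ × E3 => η q.1 • v q.2) (t, x) (s, h) =
      (s * deriv η t) • v x + η t • fderiv ℝ v x h := by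
  have h1 : HasFDerivAt (fun q : ℝ × E3 => η q.1)
      ((fderiv ℝ η t).comp (ContinuousLinearMap.fst ℝ ℝ E3)) (t, x) :=
    HasFDerivAt.comp (g := η) (t, x) (hη t).hasFDerivAt hasFDerivAt_fst
  have h2 : HasFDerivAt (fun q : ℝ × E3 => v q.2)
      ((fderiv ℝ v x).comp (ContinuousLinearMap.snd ℝ ℝ E3)) (t, x) :=
    HasFDerivAt.comp (g := v) (t, x) (hv x).hasFDerivAt hasFDerivAt_snd
  have h3 : HasFDerivAt (fun q : ℝ × E3 => η q.1 • v q.2) _ (t, x) := h1.smul h2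
  rw [h3.fderiv]
  simp [fderiv_eq_smul_deriv, add_comm]

theorem IsWeakSolution.momentum_of_hasCompactSupport {Ω : Set E3} {T ε : ℝ} {u₀ : L2V Ω}
    {p₀ : L2S Ω} {u : ℝ → L2V Ω} {G : ℝ → Fin 3 → L2V Ω} {p : ℝ → L2S Ω}
    (h : IsWeakSolution Ω T ε u₀ p₀ u G p) {B : ℝ} {v : E3 → E3} (hv : IsTestField Ω B v)
    (hvs : HasCompactSupport v) {η : ℝ → ℝ} (hη : ContDiff ℝ ∞ η) (hηs : HasCompactSupport η)
    (hηT : tsupport η ⊆ Iio T) :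
    ∫ t in Ioo 0 T, (-(deriv η t * ∫ x in Ω, inner ℝ (u t x) (v x)) + η t * force Ω v (u t) (G t)
      - η t * ∫ x in Ω, p t x * divField v x) = η 0 * ∫ x in Ω, inner ℝ (u₀ x) (v x) := by
  have hsub : tsupport (fun q : ℝ × E3 => η q.1 • v q.2) ⊆ tsupport η ×ˢ tsupport v := by
    refine closure_minimal (fun q hq => ?_)
      ((isClosed_tsupport η).prod (isClosed_tsupport v))
    have hq' : η q.1 • v q.2 ≠ 0 := hq
    exact ⟨subset_tsupport _ fun h0 => hq' (by simp [h0]),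
      subset_tsupport _ fun h0 => hq' (by simp [h0])⟩
  have hm := h.momentum (fun q => η q.1 • v q.2)
    ((hη.comp contDiff_fst).smul (hv.contDiff.comp contDiff_snd))
    ((hηs.isCompact.prod hvs.isCompact).of_isClosed_subset (isClosed_tsupport _) hsub)
    (hsub.trans (prod_mono hηT hv.tsupport_subset))
  have hr : ∫ x in Ω, inner ℝ (u₀ x) (η 0 • v x) = η 0 * ∫ x in Ω, inner ℝ (u₀ x) (v x) := by
    simp only [inner_smul_right]
    rw [integral_const_mul]
  rw [← hr, ← hm]
  congr 1
  ext t
  have hd1 := hη.differentiable (by simp)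
  have hd2 := hv.contDiff.differentiable (by simp)
  have e : ∀ x, (-(inner ℝ (u t x) (fderiv ℝ (fun q : ℝ × E3 => η q.1 • v q.2) (t, x) (1, 0)))
        + ∑ i, inner ℝ (G t i x) (fderiv ℝ (fun q : ℝ × E3 => η q.1 • v q.2) (t, x) (0, e3 i))
        + inner ℝ ((∑ i, u t x i • G t i x) + (1 / 2 : ℝ) • (∑ i, G t i x i) • u t x) (η t • v x)
        - p t x * ∑ i, fderiv ℝ (fun q : ℝ × E3 => η q.1 • v q.2) (t, x) (0, e3 i) i) =
      (-(deriv η t * inner ℝ (u t x) (v x)) + η t * (∑ i, inner ℝ (G t i x) (fderiv ℝ v x (e3 i))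
        + inner ℝ ((∑ i, u t x i • G t i x) + (1 / 2 : ℝ) • (∑ i, G t i x i) • u t x) (v x)))
        - η t * (p t x * divField v x) := by
    intro x
    simp only [fderiv_smul_prod hd1 hd2, divField]
    simp only [one_mul, map_zero, smul_zero, add_zero, zero_mul, zero_smul, zero_add,
      inner_smul_right, PiLp.smul_apply, smul_eq_mul, ← Finset.mul_sum]
    ring
  simp only [e]
  have i1 := (integrable_inner_of_memLp (Lp.memLp (u t)) hv.memLp).const_mul (deriv η t)
  have i2 := (hv.integrable_force (u t) (G t)).1.const_mul (η t)
  have i3 : Integrable (fun x => p t x * divField v x) (volume.restrict Ω) := by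
    refine (integrable_inner_of_memLp (Lp.memLp (p t)) (memLp_divField hv.memLp_fderiv)).congr
      (Eventually.of_forall fun x => ?_)
    simp [mul_comm]
  exact Eq.symm ((integral_sub (i1.neg.add i2) (i3.const_mul (η t))).trans
    (congrArg₂ (· - ·) ((integral_add i1.neg i2).trans (congrArg₂ (· + ·)
      ((integral_neg _).trans (congrArg Neg.neg (integral_const_mul _ _))) (integral_const_mul _ _)))
      (integral_const_mul _ _)))

/-- The momentum equation tested with a solenoidal field that need not have compact support. In the
limit of the cutoffs at infinity the pressure drops out, being square integrable like the field. -/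
theorem IsWeakSolution.momentum_of_div_eq_zero {Ω : Set E3} {T ε : ℝ} {u₀ : L2V Ω}
    {p₀ : L2S Ω} {u : ℝ → L2V Ω} {G : ℝ → Fin 3 → L2V Ω} {p : ℝ → L2S Ω}
    (h : IsWeakSolution Ω T ε u₀ p₀ u G p) {B : ℝ} {w : E3 → E3} (hw : IsTestField Ω B w)
    (hdiv : ∀ x, divField w x = 0) {η : ℝ → ℝ} (hη : ContDiff ℝ ∞ η) (hηs : HasCompactSupport η)
    (hηT : tsupport η ⊆ Iio T) :
    ∫ t in Ioo 0 T, (-(deriv η t * ∫ x in Ω, inner ℝ (u t x) (w x)) + η t * force Ω w (u t) (G t))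
      = η 0 * ∫ x in Ω, inner ℝ (u₀ x) (w x) := by
  obtain ⟨L, hL⟩ := exists_norm_fderiv_cutoff_le
  have hL0 : 0 ≤ L := (norm_nonneg _).trans (hL 0 0)
  have hB0 : 0 ≤ B := (norm_nonneg _).trans (hw.norm_le 0)
  obtain ⟨wn, hwn_def⟩ : ∃ wn : ℕ → E3 → E3, wn = fun n x => cutoff n x • w x := ⟨_, rfl⟩
  have hwn : ∀ n, IsTestField Ω B (wn n) := fun n => by
    rw [hwn_def]
    exact hw.cutoff_smul n
  have hwns : ∀ n, HasCompactSupport (wn n) := fun n => by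
    rw [hwn_def]
    exact (hasCompactSupport_cutoff n).smul_right
  have heq := fun n => h.momentum_of_hasCompactSupport (hwn n) (hwns n) hη hηs hηT
  -- near every point the truncated fields eventually coincide with `w`
  have hev : ∀ x, ∀ᶠ n in atTop, wn n x = w x ∧ fderiv ℝ (wn n) x = fderiv ℝ w x := by
    intro x
    filter_upwards [cutoff_eventuallyEq x] with n hn
    have : wn n =ᶠ[𝓝 x] w := by
      filter_upwards [hn] with y hy
      simp [hwn_def, hy]
    exact ⟨this.eq_of_nhds, this.fderiv_eq⟩
  have hD : MemLp (fun x => ∑ i, ‖fderiv ℝ w x (e3 i)‖ + L * ‖w x‖) 2 (volume.restrict Ω) :=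
    (memLp_finsetSum _ fun i _ => (hw.memLp_fderiv i).norm).add (hw.memLp.norm.const_mul L)
  have hDn : ∀ n i x, ‖fderiv ℝ (wn n) x (e3 i)‖ ≤
      ∑ i, ‖fderiv ℝ w x (e3 i)‖ + L * ‖w x‖ := fun n i x => by
    rw [hwn_def]
    exact (hw.norm_fderiv_cutoff_smul_le hL n i x).trans (add_le_add_left
      (Finset.single_le_sum (f := fun i => ‖fderiv ℝ w x (e3 i)‖) (fun i _ => norm_nonneg _)
        (Finset.mem_univ i)) _)
  have hwle : ∀ n x, ‖wn n x‖ ≤ ‖w x‖ := fun n x => by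
    rw [hwn_def, norm_smul]
    exact mul_le_of_le_one_left (norm_nonneg _) (abs_cutoff_le n x)
  have lim1 : ∀ a : L2V Ω, Tendsto (fun n => ∫ x in Ω, inner ℝ (a x) (wn n x)) atTop
      (𝓝 (∫ x in Ω, inner ℝ (a x) (w x))) := by
    intro a
    refine tendsto_integral_of_dominated_convergence (fun x => ‖a x‖ * ‖w x‖)
      (fun n => (integrable_inner_of_memLp (Lp.memLp a) (hwn n).memLp).aestronglyMeasurable)
      (MemLp.integrable_mul (Lp.memLp a).norm hw.memLp.norm)
      (fun n => Eventually.of_forall fun x => ?_) (Eventually.of_forall fun x => ?_)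
    · exact (norm_inner_le_norm _ _).trans (by gcongr; exact hwle n x)
    · refine tendsto_const_nhds.congr' ?_
      filter_upwards [hev x] with n hn
      rw [hn.1]
  have lim2 : ∀ (a : L2V Ω) (g : Fin 3 → L2V Ω), Tendsto (fun n => force Ω (wn n) a g) atTop
      (𝓝 (force Ω w a g)) := by
    intro a g
    refine tendsto_integral_of_dominated_convergence
      (fun x => ∑ i, (‖g i x‖ * (∑ i, ‖fderiv ℝ w x (e3 i)‖ + L * ‖w x‖) +
        ‖a x‖ * (2 * B * ‖g i x‖)))
      (fun n => ((hwn n).integrable_force a g).1.aestronglyMeasurable) ?_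
      (fun n => Eventually.of_forall fun x => ?_) (Eventually.of_forall fun x => ?_)
    · refine integrable_finsetSum _ fun i _ => Integrable.add ?_ ?_
      · exact MemLp.integrable_mul (Lp.memLp (g i)).norm hD
      · exact MemLp.integrable_mul (Lp.memLp a).norm ((Lp.memLp (g i)).norm.const_mul _)
    · rw [inner_convection_eq (wn n) x (a x) fun i => g i x, ← Finset.sum_add_distrib]
      refine (norm_sum_le _ _).trans (Finset.sum_le_sum fun i _ => (norm_add_le _ _).trans
        (add_le_add ?_ ?_))
      · exact (norm_inner_le_norm _ _).trans (by gcongr; exact hDn n i x)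
      · refine (norm_inner_le_norm _ _).trans ?_
        gcongr
        exact (convMat (wn n) i x).le_of_opNorm_le (norm_convMat_le (hwn n).norm_le i x) _
    · refine tendsto_const_nhds.congr' ?_
      filter_upwards [hev x] with n hn
      rw [hn.1, hn.2]
  have hdn : ∀ n x, |divField (wn n) x| ≤ 3 * (∑ i, ‖fderiv ℝ w x (e3 i)‖ + L * ‖w x‖) := by
    intro n x
    refine (Finset.abs_sum_le_sum_abs _ _).trans ?_
    refine (Finset.sum_le_card_nsmul _ _ (∑ i, ‖fderiv ℝ w x (e3 i)‖ + L * ‖w x‖)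
      fun i _ => ?_).trans_eq (by simp [mul_add])
    exact (PiLp.norm_apply_le (fderiv ℝ (wn n) x (e3 i)) i).trans (hDn n i x)
  have lim3 : ∀ q : L2S Ω, Tendsto (fun n => ∫ x in Ω, q x * divField (wn n) x) atTop (𝓝 0) := by
    intro q
    have h0 : ∫ x in Ω, q x * divField w x = 0 := by simp [hdiv]
    rw [← h0]
    refine tendsto_integral_of_dominated_convergence
      (fun x => ‖q x‖ * (3 * (∑ i, ‖fderiv ℝ w x (e3 i)‖ + L * ‖w x‖)))
      (fun n => (Lp.aestronglyMeasurable q).mul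
        (memLp_divField (hwn n).memLp_fderiv).aestronglyMeasurable)
      (MemLp.integrable_mul (Lp.memLp q).norm (hD.const_mul 3))
      (fun n => Eventually.of_forall fun x => ?_) (Eventually.of_forall fun x => ?_)
    · rw [norm_mul]
      gcongr
      exact hdn n x
    · refine tendsto_const_nhds.congr' ?_
      filter_upwards [hev x] with n hn
      simp only [divField, hn.2]
  -- bounds that are uniform in the truncation
  set Wn := ‖hw.memLp.toLp w‖
  set B' := ‖hD.toLp _‖
  have b1 : ∀ n (a : L2V Ω), |∫ x in Ω, inner ℝ (a x) (wn n x)| ≤ ‖a‖ * Wn := by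
    intro n a
    rw [← inner_toLp_eq a (hwn n).memLp]
    refine (abs_real_inner_le_norm _ _).trans ?_
    gcongr
    refine Lp.norm_le_norm_of_ae_le ?_
    filter_upwards [(hwn n).memLp.coeFn_toLp, hw.memLp.coeFn_toLp] with x h1 h2
    rw [h1, h2]
    exact hwle n x
  have b2 : ∀ n a g, |force Ω (wn n) a g| ≤ (B' + 2 * B * ‖a‖) * ∑ i, ‖g i‖ := by
    intro n a g
    refine (hwn n).abs_force_le (fun i => ?_) a g
    refine Lp.norm_le_norm_of_ae_le ?_
    filter_upwards [((hwn n).memLp_fderiv i).coeFn_toLp, hD.coeFn_toLp] with x h1 h2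
    rw [h1, h2]
    exact (hDn n i x).trans (Real.le_norm_self _)
  have b3 : ∀ n (q : L2S Ω), |∫ x in Ω, q x * divField (wn n) x| ≤ ‖q‖ * (3 * B') := by
    intro n q
    have h1 := inner_toLp_eq q (memLp_divField (hwn n).memLp_fderiv)
    have h2 : ∫ x in Ω, q x * divField (wn n) x =
        ∫ x in Ω, inner ℝ (q x) (divField (wn n) x) := by simp [mul_comm]
    rw [h2, ← h1]
    refine (abs_real_inner_le_norm _ _).trans ?_
    gcongr
    have h3 : ‖(3 : ℝ) • hD.toLp _‖ = 3 * B' := by rw [norm_smul]; norm_num [B']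
    rw [← h3]
    refine Lp.norm_le_norm_of_ae_le ?_
    filter_upwards [(memLp_divField (hwn n).memLp_fderiv).coeFn_toLp, hD.coeFn_toLp,
      Lp.coeFn_smul (3 : ℝ) (hD.toLp _)] with x h1 h2 h3
    rw [h1, h3, Pi.smul_apply, h2, norm_smul]
    refine (hdn n x).trans ?_
    norm_num
    exact Real.le_norm_self _
  obtain ⟨c0, hc0⟩ := hηs.exists_bound_of_continuous hη.continuous
  obtain ⟨c1, hc1⟩ := hηs.deriv.exists_bound_of_continuous (hη.continuous_deriv (by simp))
  have hc00 : 0 ≤ c0 := (norm_nonneg _).trans (hc0 0)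
  have hc10 : 0 ≤ c1 := (norm_nonneg _).trans (hc1 0)
  have mu := h.velocity.memLp.aestronglyMeasurable
  have mG := fun i => (h.velocity.grad_memLp i).aestronglyMeasurable
  have mp := h.pressure.aestronglyMeasurable
  have iu : Integrable (fun t => ‖u t‖) (volume.restrict (Ioo 0 T)) :=
    (h.velocity.memLp.integrable (by simp)).norm
  have iG : ∀ i, Integrable (fun t => ‖G t i‖) (volume.restrict (Ioo 0 T)) := fun i =>
    ((h.velocity.grad_memLp i).integrable (by norm_num)).norm
  have ip : Integrable (fun t => ‖p t‖) (volume.restrict (Ioo 0 T)) :=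
    (h.pressure.integrable (by simp)).norm
  have iuG : Integrable (fun t => ‖u t‖ * ∑ i, ‖G t i‖) (volume.restrict (Ioo 0 T)) := by
    refine MemLp.integrable_mul (p := 2) (q := 2) ?_ ?_
    · exact (h.velocity.memLp.mono_exponent (by simp)).norm
    · exact memLp_finsetSum _ fun i _ => (h.velocity.grad_memLp i).norm
  have hlim : Tendsto (fun n => ∫ t in Ioo 0 T,
      (-(deriv η t * ∫ x in Ω, inner ℝ (u t x) (wn n x)) + η t * force Ω (wn n) (u t) (G t)
      - η t * ∫ x in Ω, p t x * divField (wn n) x)) atTop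
      (𝓝 (∫ t in Ioo 0 T, (-(deriv η t * ∫ x in Ω, inner ℝ (u t x) (w x)) +
        η t * force Ω w (u t) (G t)))) := by
    refine tendsto_integral_of_dominated_convergence
      (fun t => c1 * (‖u t‖ * Wn) + c0 * (B' * ∑ i, ‖G t i‖ + 2 * B * (‖u t‖ * ∑ i, ‖G t i‖)) +
        c0 * (‖p t‖ * (3 * B'))) (fun n => ?_) ?_ (fun n => Eventually.of_forall fun t => ?_)
        (Eventually.of_forall fun t => ?_)
    · refine ((AEStronglyMeasurable.mul ?_ ?_).neg.add (AEStronglyMeasurable.mul ?_ ?_)).sub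
        (AEStronglyMeasurable.mul ?_ ?_)
      · exact (hη.continuous_deriv (by simp)).aestronglyMeasurable
      · simp only [← inner_toLp_eq _ (hwn n).memLp]
        exact mu.inner aestronglyMeasurable_const
      · exact hη.continuous.aestronglyMeasurable
      · exact (hwn n).aestronglyMeasurable_force mu mG
      · exact hη.continuous.aestronglyMeasurable
      · have : ∀ t, ∫ x in Ω, p t x * divField (wn n) x =
            inner ℝ (p t) ((memLp_divField (hwn n).memLp_fderiv).toLp _) := fun t => by
          rw [inner_toLp_eq]; simp [mul_comm]
        simp only [this]
        exact mp.inner aestronglyMeasurable_const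
    · exact (((iu.mul_const _).const_mul _).add ((((integrable_finsetSum _ fun i _ =>
        iG i).const_mul _).add (iuG.const_mul _)).const_mul _)).add ((ip.mul_const _).const_mul _)
    · refine (norm_sub_le _ _).trans (add_le_add ((norm_add_le _ _).trans (add_le_add ?_ ?_)) ?_)
      · rw [norm_neg, norm_mul]
        gcongr
        · exact hc1 t
        · exact b1 n (u t)
      · rw [norm_mul]
        gcongr
        · exact hc0 t
        · exact (b2 n (u t) (G t)).trans_eq (by ring)
      · rw [norm_mul]
        gcongr
        · exact hc0 t
        · exact b3 n (p t)
    · have := (((lim1 (u t)).const_mul (deriv η t)).neg.add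
        ((lim2 (u t) (G t)).const_mul (η t))).sub ((lim3 (p t)).const_mul (η t))
      simpa using this
  refine tendsto_nhds_unique hlim ?_
  simp only [heq]
  exact (lim1 u₀).const_mul (η 0)

/-! ### Integration of the equation in time -/

/-- A function of time with a weak derivative `-F` and initial value `c` is a primitive. -/
theorem ae_eq_sub_integral_of_weak {T : ℝ} (hT : 0 < T) {g F : ℝ → ℝ}
    (hg : IntegrableOn g (Ioo 0 T)) (hF : IntegrableOn F (Ioo 0 T)) {c : ℝ}
    (H : ∀ η : ℝ → ℝ, ContDiff ℝ ∞ η → HasCompactSupport η → tsupport η ⊆ Iio T →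
      ∫ t in Ioo 0 T, (-(deriv η t * g t) + η t * F t) = η 0 * c) :
    ∀ᵐ t ∂(volume.restrict (Ioo 0 T)), g t = c - ∫ s in Ioo 0 t, F s := by
  set F' : ℝ → ℝ := (Ioo 0 T).indicator F with hF'
  have hF'i : Integrable F' := (integrable_indicator_iff measurableSet_Ioo).2 hF
  set Φ : ℝ → ℝ := fun s => ∫ t in (0 : ℝ)..s, F' t with hΦ
  have hΦc : Continuous Φ :=
    intervalIntegral.continuous_primitive (fun a b => hF'i.intervalIntegrable) 0
  have hΦeq : ∀ s ∈ Ioo 0 T, Φ s = ∫ t in Ioo 0 s, F t := by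
    intro s hs
    simp only [hΦ]
    rw [intervalIntegral.integral_of_le hs.1.le, integral_Ioc_eq_integral_Ioo]
    refine setIntegral_congr_fun measurableSet_Ioo fun t ht => ?_
    exact indicator_of_mem (s := Ioo 0 T) ⟨ht.1, ht.2.trans hs.2⟩ F
  have hΦi : IntegrableOn Φ (Ioo 0 T) :=
    (hΦc.integrableOn_Icc (a := 0) (b := T)).mono_set Ioo_subset_Icc_self
  have hci : IntegrableOn (fun _ => c) (Ioo 0 T) := integrableOn_const (by simp)
  have hfi : IntegrableOn (fun t => g t + Φ t - c) (Ioo 0 T) := (hg.add hΦi).sub hci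
  have key := isOpen_Ioo.ae_eq_zero_of_integral_contDiff_smul_eq_zero (μ := volume)
    (f := fun t => g t + Φ t - c) (U := Ioo 0 T) hfi.locallyIntegrableOn ?_
  · rw [ae_restrict_iff' measurableSet_Ioo]
    filter_upwards [key] with t ht htT
    rw [← hΦeq t htT]
    linarith [ht htT]
  intro ζ hζ hζs hζT
  have hζc := hζ.continuous
  have hζi : ∀ a b, IntervalIntegrable ζ volume a b := fun a b => hζc.intervalIntegrable a b
  -- the test function is the primitive of `ζ` that vanishes at `T`, cut off at negative times
  set η₀ : ℝ → ℝ := fun t => ∫ s in T..t, ζ s with hη₀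
  have hη₀d : ∀ t, HasDerivAt η₀ (ζ t) t := fun t =>
    intervalIntegral.integral_hasDerivAt_right (hζi T t)
      (hζc.stronglyMeasurableAtFilter _ _) hζc.continuousAt
  have hη₀c : ContDiff ℝ ∞ η₀ := by
    rw [contDiff_infty_iff_deriv]
    refine ⟨fun t => (hη₀d t).differentiableAt, ?_⟩
    rwa [show deriv η₀ = ζ from funext fun t => (hη₀d t).deriv]
  let κ : ContDiffBump (0 : ℝ) := ⟨T + 1, T + 2, by linarith, by linarith⟩
  have hκ1 : ∀ t ∈ Ioo (-1) T, κ =ᶠ[𝓝 t] fun _ => 1 := by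
    intro t ht
    filter_upwards [isOpen_Ioo.mem_nhds ht] with s hs
    refine κ.one_of_mem_closedBall ?_
    rw [mem_closedBall_zero_iff, Real.norm_eq_abs, abs_le]
    constructor <;> linarith [hs.1, hs.2]
  obtain ⟨b, hbT, hb⟩ : ∃ b < T, tsupport ζ ⊆ Iic b := by
    rcases (tsupport ζ).eq_empty_or_nonempty with h | h
    · exact ⟨T - 1, by linarith, by simp [h]⟩
    · obtain ⟨b, hb1, hb2⟩ := hζs.isCompact.exists_isGreatest h
      exact ⟨b, (hζT hb1).2, hb2⟩
  have hη₀z : ∀ t, b < t → η₀ t = 0 := by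
    intro t ht
    refine intervalIntegral.integral_zero_ae (Eventually.of_forall fun s hs => ?_)
    refine image_eq_zero_of_notMem_tsupport fun h => ?_
    have h1 : s ≤ b := hb h
    have h2 : min T t < s := hs.1
    exact absurd (lt_min hbT ht) (not_lt.2 (h2.le.trans h1))
  have hsub : tsupport (fun t => κ t * η₀ t) ⊆ Iio T := by
    refine (closure_minimal (fun t ht => ?_) isClosed_Iic).trans (Iic_subset_Iio.2 hbT)
    by_contra h
    exact ht (by simp [hη₀z t (not_le.1 h)])
  have h1 := H (fun t => κ t * η₀ t) (κ.contDiff.mul hη₀c) (κ.hasCompactSupport.mul_right) hsub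
  have hκ0 : κ 0 = 1 := (hκ1 0 ⟨by norm_num, hT⟩).eq_of_nhds
  have hη₀0 : η₀ 0 = -∫ s in Ioo 0 T, ζ s := by
    simp only [hη₀]
    rw [intervalIntegral.integral_symm, intervalIntegral.integral_of_le hT.le,
      integral_Ioc_eq_integral_Ioo]
  have h2 : ∫ t in Ioo 0 T, (-(deriv (fun t => κ t * η₀ t) t * g t) + κ t * η₀ t * F t) =
      ∫ t in Ioo 0 T, (-(ζ t * g t) + η₀ t * F t) := by
    refine setIntegral_congr_fun measurableSet_Ioo fun t ht => ?_
    have hk := hκ1 t ⟨by linarith [ht.1], ht.2⟩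
    have hd : deriv (fun t => κ t * η₀ t) t = ζ t := by
      have : (fun t => κ t * η₀ t) =ᶠ[𝓝 t] η₀ := by
        filter_upwards [hk] with s hs
        rw [hs, one_mul]
      rw [this.deriv_eq, (hη₀d t).deriv]
    simp only [hd, hk.eq_of_nhds, one_mul]
  simp only [hκ0, one_mul, hη₀0, h2] at h1
  obtain ⟨Z, hZ⟩ := hζs.exists_bound_of_continuous hζc
  obtain ⟨Z', hZ'⟩ : ∃ Z', ∀ t ∈ Icc 0 T, ‖η₀ t‖ ≤ Z' :=
    isCompact_Icc.exists_bound_of_continuousOn hη₀c.continuous.continuousOn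
  have i1 : IntegrableOn (fun t => ζ t * g t) (Ioo 0 T) :=
    hg.bdd_mul hζc.aestronglyMeasurable (Eventually.of_forall hZ)
  have i2 : IntegrableOn (fun t => η₀ t * F t) (Ioo 0 T) := by
    refine hF.bdd_mul (c := Z') hη₀c.continuous.aestronglyMeasurable ?_
    filter_upwards [ae_restrict_mem measurableSet_Ioo] with t ht
    exact hZ' t (Ioo_subset_Icc_self ht)
  have i3 : IntegrableOn (fun t => ζ t * Φ t) (Ioo 0 T) :=
    hΦi.bdd_mul hζc.aestronglyMeasurable (Eventually.of_forall hZ)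
  have i4 : IntegrableOn ζ (Ioo 0 T) :=
    (hζc.integrableOn_Icc (a := 0) (b := T)).mono_set Ioo_subset_Icc_self
  have h3 : ∫ t in Ioo 0 T, η₀ t * F t = -∫ s in Ioo 0 T, ζ s * Φ s := by
    have e1 : ∀ t ∈ Ioo 0 T, η₀ t * F t =
        -∫ s in Ioo 0 T, {q : ℝ × ℝ | q.1 < q.2}.indicator (fun q => F q.1 * ζ q.2) (t, s) := by
      intro t ht
      have : ∀ s, {q : ℝ × ℝ | q.1 < q.2}.indicator (fun q => F q.1 * ζ q.2) (t, s) =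
          (Ioi t).indicator (fun s => F t * ζ s) s := fun s => by
        by_cases hts : t < s
        · rw [indicator_of_mem (by exact hts), indicator_of_mem (by exact hts)]
        · rw [indicator_of_notMem (by exact hts), indicator_of_notMem (by exact hts)]
      simp only [this]
      rw [setIntegral_indicator measurableSet_Ioi, integral_const_mul,
        show Ioo 0 T ∩ Ioi t = Ioo t T by
          ext s; simp only [mem_inter_iff, mem_Ioo, mem_Ioi]
          exact ⟨fun h => ⟨h.2, h.1.2⟩, fun h => ⟨⟨ht.1.trans h.1, h.2⟩, h.1⟩⟩]
      simp only [hη₀]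
      rw [intervalIntegral.integral_symm, intervalIntegral.integral_of_le ht.2.le,
        integral_Ioc_eq_integral_Ioo]
      ring
    have e2 : ∀ s ∈ Ioo 0 T, ζ s * Φ s =
        ∫ t in Ioo 0 T, {q : ℝ × ℝ | q.1 < q.2}.indicator (fun q => F q.1 * ζ q.2) (t, s) := by
      intro s hs
      have : ∀ t, {q : ℝ × ℝ | q.1 < q.2}.indicator (fun q => F q.1 * ζ q.2) (t, s) =
          (Iio s).indicator (fun t => F t * ζ s) t := fun t => by
        by_cases hts : t < s
        · rw [indicator_of_mem (by exact hts), indicator_of_mem (by exact hts)]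
        · rw [indicator_of_notMem (by exact hts), indicator_of_notMem (by exact hts)]
      simp only [this]
      rw [setIntegral_indicator measurableSet_Iio, integral_mul_const,
        show Ioo 0 T ∩ Iio s = Ioo 0 s by
          ext t; simp only [mem_inter_iff, mem_Ioo, mem_Iio]
          exact ⟨fun h => ⟨h.1.1, h.2⟩, fun h => ⟨⟨h.1, h.2.trans hs.2⟩, h.2⟩⟩, hΦeq s hs, mul_comm]
    rw [setIntegral_congr_fun measurableSet_Ioo e1, integral_neg,
      setIntegral_congr_fun measurableSet_Ioo e2, integral_integral_swap]
    exact (Integrable.mul_prod hF i4).indicator (measurableSet_lt measurable_fst measurable_snd)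
  have h4 : ∫ t in Ioo 0 T, (-(ζ t * g t) + η₀ t * F t) =
      -(∫ t in Ioo 0 T, ζ t * g t) + ∫ t in Ioo 0 T, η₀ t * F t :=
    (integral_add i1.neg i2).trans (congrArg (· + _) (integral_neg _))
  rw [h4, h3] at h1
  have hz : ∀ t, t ∉ Ioo 0 T → ζ t • (g t + Φ t - c) = 0 := fun t ht => by
    rw [image_eq_zero_of_notMem_tsupport fun h => ht (hζT h), zero_smul]
  rw [← setIntegral_eq_integral_of_forall_compl_eq_zero hz]
  have e : ∀ t, ζ t • (g t + Φ t - c) = ζ t * g t + ζ t * Φ t - ζ t * c := fun t => by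
    rw [smul_eq_mul]; ring
  simp only [e]
  have i5 : IntegrableOn (fun t => ζ t * g t + ζ t * Φ t) (Ioo 0 T) := i1.add i3
  rw [integral_sub i5 (i4.mul_const c), integral_add i1 i3, integral_mul_const]
  linarith

theorem IsRegularization.isTestField {Ω : Set E3} {C α : ℝ} {W : L2V Ω → E3 → E3}
    (hW : IsRegularization Ω C α W) (K : L2V Ω) :
    IsTestField Ω (C * α ^ (-(3 / 2) : ℝ) * ‖K‖) (W K) where
  contDiff := hW.contDiff K
  tsupport_subset := hW.tsupport_subset K
  norm_le := hW.norm_le K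
  memLp := memLp_two_of_lintegral (hW.contDiff K).continuous.aestronglyMeasurable
    ((hW.lintegral_le K).trans_lt (by simp))
  memLp_fderiv i := memLp_two_of_lintegral
    (((hW.contDiff K).continuous_fderiv (by simp)).clm_apply
      continuous_const).aestronglyMeasurable ((hW.lintegral_fderiv_le K i).trans_lt (by simp))

theorem IsRegularization.abs_integral_inner_le {Ω : Set E3} {C α : ℝ} {W : L2V Ω → E3 → E3}
    (hW : IsRegularization Ω C α W) (hC : 0 ≤ C) (a K : L2V Ω) :
    |∫ x in Ω, inner ℝ (a x) (W K x)| ≤ ‖a‖ * (C * ‖K‖) := by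
  rw [← inner_toLp_eq a (hW.isTestField K).memLp]
  refine (abs_real_inner_le_norm _ _).trans ?_
  gcongr
  exact norm_toLp_le_of_lintegral _ (by positivity) (hW.lintegral_le K)

theorem IsRegularization.abs_force_le {Ω : Set E3} {C α : ℝ} {W : L2V Ω → E3 → E3}
    (hW : IsRegularization Ω C α W) (hC : 0 ≤ C) (hα : 0 < α) (hα1 : α ≤ 1) (K a : L2V Ω)
    (g : Fin 3 → L2V Ω) :
    |force Ω (W K) a g| ≤ C * α ^ (-(3 / 2) : ℝ) * ‖K‖ * (1 + 2 * ‖a‖) * ∑ i, ‖g i‖ := by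
  have h1 : α⁻¹ ≤ α ^ (-(3 / 2) : ℝ) := by
    rw [← Real.rpow_neg_one]
    exact Real.rpow_le_rpow_of_exponent_ge hα hα1 (by norm_num)
  refine ((hW.isTestField K).abs_force_le (B' := C * α ^ (-(3 / 2) : ℝ) * ‖K‖) (fun i => ?_)
    a g).trans_eq (by ring)
  refine (norm_toLp_le_of_lintegral _ (by positivity) (hW.lintegral_fderiv_le K i)).trans ?_
  gcongr

theorem IsRegularization.integral_inner_sub {Ω : Set E3} {C α : ℝ} {W : L2V Ω → E3 → E3}
    (hW : IsRegularization Ω C α W) (a K K' : L2V Ω) :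
    ∫ x in Ω, inner ℝ (a x) (W (K - K') x) =
      (∫ x in Ω, inner ℝ (a x) (W K x)) - ∫ x in Ω, inner ℝ (a x) (W K' x) := by
  rw [← integral_sub (integrable_inner_of_memLp (Lp.memLp a) (hW.isTestField K).memLp)
    (integrable_inner_of_memLp (Lp.memLp a) (hW.isTestField K').memLp)]
  simp only [hW.map_sub, Pi.sub_apply, inner_sub_right]

theorem IsRegularization.force_sub {Ω : Set E3} {C α : ℝ} {W : L2V Ω → E3 → E3}
    (hW : IsRegularization Ω C α W) (a : L2V Ω) (g : Fin 3 → L2V Ω) (K K' : L2V Ω) :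
    force Ω (W (K - K')) a g = force Ω (W K) a g - force Ω (W K') a g := by
  rw [force, force, force, ← integral_sub ((hW.isTestField K).integrable_force a g).1
    ((hW.isTestField K').integrable_force a g).1]
  congr 1
  ext x
  have hd : fderiv ℝ (W K - W K') x = fderiv ℝ (W K) x - fderiv ℝ (W K') x :=
    fderiv_sub (((hW.contDiff K).differentiable (by simp)) x)
      (((hW.contDiff K').differentiable (by simp)) x)
  rw [hW.map_sub, hd]
  simp only [Pi.sub_apply, inner_sub_right, sub_apply, Finset.sum_sub_distrib]
  ring

/-- The equation in integrated form, tested with the regularizations of all solenoidal fields at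
once: by separability, the exceptional set of times does not depend on the field. -/
theorem IsWeakSolution.ae_integral_inner_eq {Ω : Set E3} {T ε : ℝ} (hT : 0 < T) {u₀ : L2V Ω}
    {p₀ : L2S Ω} {u : ℝ → L2V Ω} {G : ℝ → Fin 3 → L2V Ω} {p : ℝ → L2S Ω}
    (h : IsWeakSolution Ω T ε u₀ p₀ u G p) {M : ℝ}
    (hM : ∀ᵐ t ∂(volume.restrict (Ioo 0 T)), ‖u t‖ ≤ M) {C α : ℝ} (hC : 0 ≤ C) (hα : 0 < α)
    (hα1 : α ≤ 1) {W : L2V Ω → E3 → E3} (hW : IsRegularization Ω C α W) :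
    ∀ᵐ t ∂(volume.restrict (Ioo 0 T)), ∀ K ∈ solenoidal Ω,
      ∫ x in Ω, inner ℝ (u t x) (W K x) = (∫ x in Ω, inner ℝ (u₀ x) (W K x)) -
        ∫ s in Ioo 0 t, force Ω (W K) (u s) (G s) := by
  have iG : Integrable (fun t => ∑ i, ‖G t i‖) (volume.restrict (Ioo 0 T)) :=
    integrable_finsetSum _ fun i _ => ((h.velocity.grad_memLp i).integrable (by norm_num)).norm
  have hb : ∀ K, ∀ᵐ t ∂(volume.restrict (Ioo 0 T)), ‖force Ω (W K) (u t) (G t)‖ ≤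
      C * α ^ (-(3 / 2) : ℝ) * ‖K‖ * (1 + 2 * M) * ∑ i, ‖G t i‖ := by
    intro K
    filter_upwards [hM] with t ht
    refine (hW.abs_force_le hC hα hα1 K (u t) (G t)).trans ?_
    gcongr
  have hFi : ∀ K, IntegrableOn (fun s => force Ω (W K) (u s) (G s)) (Ioo 0 T) := fun K =>
    (iG.const_mul _).mono' ((hW.isTestField K).aestronglyMeasurable_force
      h.velocity.memLp.aestronglyMeasurable fun i =>
        (h.velocity.grad_memLp i).aestronglyMeasurable) (hb K)
  have hone : ∀ K ∈ solenoidal Ω, ∀ᵐ t ∂(volume.restrict (Ioo 0 T)),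
      ∫ x in Ω, inner ℝ (u t x) (W K x) = (∫ x in Ω, inner ℝ (u₀ x) (W K x)) -
        ∫ s in Ioo 0 t, force Ω (W K) (u s) (G s) := by
    intro K hK
    refine ae_eq_sub_integral_of_weak hT ?_ (hFi K) fun η hη hηs hηT =>
      h.momentum_of_div_eq_zero (hW.isTestField K) (hW.div_eq_zero K hK) hη hηs hηT
    simp only [← inner_toLp_eq _ (hW.isTestField K).memLp]
    exact (h.velocity.memLp.integrable (by simp)).inner_const _
  have hfact : Fact ((2 : ℝ≥0∞) ≠ ⊤) := ⟨by simp⟩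
  have hcount : ∀ᵐ t ∂(volume.restrict (Ioo 0 T)), ∀ n : ℕ,
      ∫ x in Ω, inner ℝ (u t x) (W (TopologicalSpace.denseSeq (solenoidal Ω) n) x) =
        (∫ x in Ω, inner ℝ (u₀ x) (W (TopologicalSpace.denseSeq (solenoidal Ω) n) x)) -
        ∫ s in Ioo 0 t, force Ω (W (TopologicalSpace.denseSeq (solenoidal Ω) n)) (u s) (G s) :=
    ae_all_iff.2 fun n => hone _ (TopologicalSpace.denseSeq (solenoidal Ω) n).2
  filter_upwards [hcount, ae_restrict_mem measurableSet_Ioo] with t ht htT K hK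
  have hsub : Ioo 0 t ⊆ Ioo 0 T := Ioo_subset_Ioo_right htT.2.le
  set Ξ : solenoidal Ω → ℝ := fun K => (∫ x in Ω, inner ℝ (u t x) (W K x)) -
    ((∫ x in Ω, inner ℝ (u₀ x) (W K x)) - ∫ s in Ioo 0 t, force Ω (W K) (u s) (G s)) with hΞ
  set c := C * α ^ (-(3 / 2) : ℝ) * (1 + 2 * M) * ∫ s in Ioo 0 t, ∑ i, ‖G s i‖ with hc
  have hlip : ∀ K K' : solenoidal Ω, |Ξ K - Ξ K'| ≤
      (‖u t‖ * C + ‖u₀‖ * C + c) * ‖(K : L2V Ω) - K'‖ := by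
    intro K K'
    have e : Ξ K - Ξ K' = (∫ x in Ω, inner ℝ (u t x) (W ((K : L2V Ω) - K') x)) -
        (∫ x in Ω, inner ℝ (u₀ x) (W ((K : L2V Ω) - K') x)) +
        ∫ s in Ioo 0 t, force Ω (W ((K : L2V Ω) - K')) (u s) (G s) := by
      simp only [hW.integral_inner_sub, hW.force_sub]
      rw [integral_sub ((hFi K).mono_set hsub) ((hFi K').mono_set hsub)]
      simp only [hΞ]
      ring
    rw [e]
    have b1 := hW.abs_integral_inner_le hC (u t) ((K : L2V Ω) - K')
    have b2 := hW.abs_integral_inner_le hC u₀ ((K : L2V Ω) - K')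
    have b3 : |∫ s in Ioo 0 t, force Ω (W ((K : L2V Ω) - K')) (u s) (G s)| ≤
        c * ‖(K : L2V Ω) - K'‖ := by
      refine (norm_integral_le_of_norm_le ((iG.mono_measure (Measure.restrict_mono hsub
        le_rfl)).const_mul _) (ae_restrict_of_ae_restrict_of_subset hsub (hb _))).trans_eq ?_
      rw [integral_const_mul, hc]
      ring
    refine (abs_add_le _ _).trans ((add_le_add (abs_sub _ _) b3).trans ?_)
    linarith
  have hcont : Continuous Ξ := by
    refine continuous_iff_continuousAt.2 fun K' => tendsto_iff_norm_sub_tendsto_zero.2 ?_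
    have h0 : Tendsto (fun K : solenoidal Ω => (‖u t‖ * C + ‖u₀‖ * C + c) * ‖(K : L2V Ω) - K'‖)
        (𝓝 K') (𝓝 0) := by
      have : Continuous fun K : solenoidal Ω =>
          (‖u t‖ * C + ‖u₀‖ * C + c) * ‖(K : L2V Ω) - K'‖ := by fun_prop
      simpa using this.tendsto K'
    exact squeeze_zero (fun _ => norm_nonneg _) (fun K => hlip K K') h0
  have hzero : Ξ = fun _ => 0 :=
    (TopologicalSpace.denseRange_denseSeq (solenoidal Ω)).equalizer hcont continuous_const
      (funext fun n => by simp only [hΞ, Function.comp_apply, ht n, sub_self])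
  have := congrFun hzero ⟨K, hK⟩
  simp only [hΞ] at this
  linarith

/-! ### Time translates of the solenoidal part -/

theorem Ioo_subset_preimage_add {T h : ℝ} (hh : 0 < h) :
    Ioo 0 (T - h) ⊆ (fun t => t + h) ⁻¹' Ioo 0 T := by
  intro t ht
  exact ⟨by linarith [ht.1], by linarith [ht.2]⟩

theorem ae_shift {T h : ℝ} (hh : 0 < h) {Q : ℝ → Prop}
    (hQ : ∀ᵐ t ∂(volume.restrict (Ioo 0 T)), Q t) :
    ∀ᵐ t ∂(volume.restrict (Ioo 0 (T - h))), Q (t + h) := by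
  have hmp := (measurePreserving_add_right volume h).restrict_preimage
    (measurableSet_Ioo (a := (0 : ℝ)) (b := T))
  exact ae_restrict_of_ae_restrict_of_subset (Ioo_subset_preimage_add hh)
    (hmp.quasiMeasurePreserving.ae hQ)

theorem ae_restrict_sub {T h : ℝ} (hh : 0 < h) {Q : ℝ → Prop}
    (hQ : ∀ᵐ t ∂(volume.restrict (Ioo 0 T)), Q t) :
    ∀ᵐ t ∂(volume.restrict (Ioo 0 (T - h))), Q t :=
  ae_restrict_of_ae_restrict_of_subset (Ioo_subset_Ioo_right (by linarith)) hQ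

theorem lintegral_shift_le {T h : ℝ} (hh : 0 < h) (f : ℝ → ℝ≥0∞) :
    ∫⁻ t in Ioo 0 (T - h), f (t + h) ≤ ∫⁻ t in Ioo 0 T, f t := by
  have hmp := measurePreserving_add_right volume h
  calc _ ≤ ∫⁻ t in (fun t => t + h) ⁻¹' Ioo 0 T, f (t + h) :=
        lintegral_mono_set (Ioo_subset_preimage_add hh)
    _ = _ := hmp.setLIntegral_comp_preimage_emb (measurableEmbedding_addRight h) f _

/-- The integral over `(0, T - h)` of a bound in terms of `γ(t)`, `γ(t + h)` and of the integral of
`γ` over `(t, t + h)`. -/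
theorem lintegral_le_of_window {T h : ℝ} (hh : 0 < h) {γ f : ℝ → ℝ≥0∞}
    (hγ : AEMeasurable γ (volume.restrict (Ioo 0 T))) {a b c : ℝ≥0∞}
    (hf : ∀ᵐ t ∂(volume.restrict (Ioo 0 (T - h))),
      f t ≤ a + b * (γ (t + h) + γ t) + c * ∫⁻ s in Ioo t (t + h), γ s) :
    ∫⁻ t in Ioo 0 (T - h), f t ≤
      a * ENNReal.ofReal T + (2 * b + c * ENNReal.ofReal h) * ∫⁻ t in Ioo 0 T, γ t := by
  set γ' := hγ.mk γ with hγ'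
  have hm : Measurable γ' := hγ.measurable_mk
  have heq : γ =ᵐ[volume.restrict (Ioo 0 T)] γ' := hγ.ae_eq_mk
  have hwin : ∀ t ∈ Ioo 0 (T - h), ∫⁻ s in Ioo t (t + h), γ s = ∫⁻ r in Ioo 0 h, γ' (t + r) := by
    intro t ht
    have h1 : ∫⁻ s in Ioo t (t + h), γ s = ∫⁻ s in Ioo t (t + h), γ' s := by
      refine lintegral_congr_ae (ae_restrict_of_ae_restrict_of_subset ?_ heq)
      exact Ioo_subset_Ioo ht.1.le (by linarith [ht.2])
    rw [h1]
    have h2 := (measurePreserving_add_left volume t).setLIntegral_comp_preimage_emb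
      (measurableEmbedding_addLeft t) γ' (Ioo t (t + h))
    rw [← h2]
    congr 2
    ext r
    simp [mem_Ioo]
  have hf' : ∀ᵐ t ∂(volume.restrict (Ioo 0 (T - h))),
      f t ≤ a + b * (γ' (t + h) + γ' t) + c * ∫⁻ r in Ioo 0 h, γ' (t + r) := by
    filter_upwards [hf, ae_shift hh heq, ae_restrict_sub hh heq,
      ae_restrict_mem measurableSet_Ioo] with t h1 h2 h3 h4
    rwa [h2, h3, hwin t h4] at h1
  have hm2 : Measurable fun q : ℝ × ℝ => γ' (q.1 + q.2) := hm.comp (by fun_prop)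
  have hmw : Measurable fun t => ∫⁻ r in Ioo 0 h, γ' (t + r) := hm2.lintegral_prod_right'
  have hms : Measurable fun t => γ' (t + h) := hm.comp (by fun_prop)
  have hsum : Measurable fun t => γ' (t + h) + γ' t := hms.add hm
  have hle : ∀ r ∈ Ioo 0 h, ∫⁻ t in Ioo 0 (T - h), γ' (t + r) ≤ ∫⁻ t in Ioo 0 T, γ' t := by
    intro r hr
    exact (lintegral_mono_set (Ioo_subset_Ioo_right (by linarith [hr.2]))).trans
      (lintegral_shift_le hr.1 γ')
  refine (lintegral_mono_ae hf').trans ?_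
  rw [lintegral_add_right _ (hmw.const_mul c), lintegral_const_mul _ hmw,
    lintegral_add_right _ (hsum.const_mul b), lintegral_const_mul _ hsum,
    lintegral_add_right _ hm, lintegral_const, lintegral_lintegral_swap hm2.aemeasurable,
    lintegral_congr_ae heq]
  have e1 : a * (volume.restrict (Ioo 0 (T - h))) univ ≤ a * ENNReal.ofReal T := by
    gcongr
    rw [Measure.restrict_apply_univ, Real.volume_Ioo]
    exact ENNReal.ofReal_le_ofReal (by linarith)
  have e2 := lintegral_shift_le (T := T) hh γ'
  have e3 : ∫⁻ t in Ioo 0 (T - h), γ' t ≤ ∫⁻ t in Ioo 0 T, γ' t :=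
    lintegral_mono_set (Ioo_subset_Ioo_right (by linarith))
  have e4 : ∫⁻ r in Ioo 0 h, ∫⁻ t in Ioo 0 (T - h), γ' (t + r) ≤
      ENNReal.ofReal h * ∫⁻ t in Ioo 0 T, γ' t := by
    refine (setLIntegral_mono' measurableSet_Ioo hle).trans_eq ?_
    rw [lintegral_const, Measure.restrict_apply_univ, Real.volume_Ioo, sub_zero, mul_comm]
  calc _ ≤ a * ENNReal.ofReal T + b * ((∫⁻ t in Ioo 0 T, γ' t) + ∫⁻ t in Ioo 0 T, γ' t) +
        c * (ENNReal.ofReal h * ∫⁻ t in Ioo 0 T, γ' t) := by gcongr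
    _ = _ := by ring

theorem IsWeakSolution.energy_bounds {Ω : Set E3} {T ε : ℝ} (hT : 0 < T) (hε : 0 < ε) {u₀ : L2V Ω}
    {p₀ : L2S Ω} {u : ℝ → L2V Ω} {G : ℝ → Fin 3 → L2V Ω} {p : ℝ → L2S Ω}
    (h : IsWeakSolution Ω T ε u₀ p₀ u G p) {E : ℝ}
    (hE : 1 / 2 * ‖u₀‖ ^ 2 + ε / 2 * ‖p₀‖ ^ 2 ≤ E) :
    (∀ᵐ t ∂(volume.restrict (Ioo 0 T)), ‖u t‖ ≤ √(2 * E)) ∧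
      ∫ t in Ioo 0 T, ∑ i, ‖G t i‖ ^ 2 ≤ E := by
  have hen := h.energy
  constructor
  · filter_upwards [hen] with t ht
    refine Real.le_sqrt_of_sq_le ?_
    have h1 : 0 ≤ ε / 2 * ‖p t‖ ^ 2 := by positivity
    have h2 : 0 ≤ ∫ s in Ioo 0 t, ∑ i, ‖G s i‖ ^ 2 := integral_nonneg fun s => by positivity
    linarith
  · have iG : IntegrableOn (fun t => ∑ i, ‖G t i‖ ^ 2) (Ioo 0 T) :=
      integrable_finsetSum _ fun i _ => (h.velocity.grad_memLp i).integrable_norm_pow two_ne_zero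
    have hmono : ∀ t < T, ∫ s in Ioo 0 t, ∑ i, ‖G s i‖ ^ 2 ≤ E := by
      intro t ht
      have hmeas : volume (Ioo (max t 0) T) ≠ 0 := by
        rw [Real.volume_Ioo, ne_eq, ENNReal.ofReal_eq_zero, not_le, sub_pos]
        exact max_lt ht hT
      have hsub : Ioo (max t 0) T ⊆ Ioo 0 T := Ioo_subset_Ioo_left (le_max_right _ _)
      have hen' := ae_restrict_of_ae_restrict_of_subset hsub hen
      have : (ae (volume.restrict (Ioo (max t 0) T))).NeBot := by
        rw [ae_neBot, ne_eq, Measure.restrict_eq_zero]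
        exact hmeas
      obtain ⟨t', h1, h2⟩ := (hen'.and (ae_restrict_mem measurableSet_Ioo)).exists
      have h3 : 0 ≤ ε / 2 * ‖p t'‖ ^ 2 := by positivity
      have h4 : 0 ≤ 1 / 2 * ‖u t'‖ ^ 2 := by positivity
      have h5 : ∫ s in Ioo 0 t, ∑ i, ‖G s i‖ ^ 2 ≤ ∫ s in Ioo 0 t', ∑ i, ‖G s i‖ ^ 2 :=
        setIntegral_mono_set (iG.mono_set (Ioo_subset_Ioo_right h2.2.le))
          (Eventually.of_forall fun s => by positivity)
          (Ioo_subset_Ioo_right ((le_max_left _ _).trans h2.1.le)).eventuallyLE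
      linarith
    have hU : Ioo 0 T = ⋃ n : ℕ, Ioo 0 (T - 1 / ((n : ℝ) + 1)) := by
      ext t
      simp only [mem_iUnion, mem_Ioo]
      constructor
      · rintro ⟨h0, h1⟩
        obtain ⟨n, hn⟩ := exists_nat_one_div_lt (sub_pos.2 h1)
        exact ⟨n, h0, by linarith⟩
      · rintro ⟨n, h0, h1⟩
        exact ⟨h0, h1.trans (by have : 0 < 1 / ((n : ℝ) + 1) := by positivity
                                linarith)⟩
    have hlim := tendsto_setIntegral_of_monotone (μ := volume)
      (f := fun t => ∑ i, ‖G t i‖ ^ 2) (s := fun n : ℕ => Ioo 0 (T - 1 / ((n : ℝ) + 1)))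
      (fun n => measurableSet_Ioo) (fun m n hmn => Ioo_subset_Ioo_right (by
        have : 1 / ((n : ℝ) + 1) ≤ 1 / ((m : ℝ) + 1) := by
          gcongr
        linarith)) (by rw [← hU]; exact iG)
    rw [← hU] at hlim
    refine le_of_tendsto hlim (Eventually.of_forall fun n => hmono _ ?_)
    have : 0 < 1 / ((n : ℝ) + 1) := by positivity
    linarith

theorem IsWeakSolution.lintegral_sum_le {Ω : Set E3} {T ε : ℝ} (hT : 0 < T) (hε : 0 < ε)
    {u₀ : L2V Ω} {p₀ : L2S Ω} {u : ℝ → L2V Ω} {G : ℝ → Fin 3 → L2V Ω} {p : ℝ → L2S Ω}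
    (h : IsWeakSolution Ω T ε u₀ p₀ u G p) {E : ℝ}
    (hE : 1 / 2 * ‖u₀‖ ^ 2 + ε / 2 * ‖p₀‖ ^ 2 ≤ E) :
    ∫⁻ t in Ioo 0 T, ENNReal.ofReal (∑ i, ‖G t i‖) ≤ ENNReal.ofReal (3 * T + E) := by
  have iG : Integrable (fun t => ∑ i, ‖G t i‖) (volume.restrict (Ioo 0 T)) :=
    integrable_finsetSum _ fun i _ => ((h.velocity.grad_memLp i).integrable (by norm_num)).norm
  have iG2 : Integrable (fun t => ∑ i, ‖G t i‖ ^ 2) (volume.restrict (Ioo 0 T)) :=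
    integrable_finsetSum _ fun i _ => (h.velocity.grad_memLp i).integrable_norm_pow two_ne_zero
  rw [← ofReal_integral_eq_lintegral_ofReal iG
    (Eventually.of_forall fun t => Finset.sum_nonneg fun i _ => norm_nonneg _)]
  refine ENNReal.ofReal_le_ofReal ?_
  calc ∫ t in Ioo 0 T, ∑ i, ‖G t i‖ ≤ ∫ t in Ioo 0 T, (3 + ∑ i, ‖G t i‖ ^ 2) := by
        refine integral_mono iG ((integrable_const _).add iG2) fun t => ?_
        simp only [Fin.sum_univ_three]
        nlinarith [sq_nonneg (‖G t 0‖ - 1), sq_nonneg (‖G t 1‖ - 1), sq_nonneg (‖G t 2‖ - 1),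
          sq_nonneg ‖G t 0‖, sq_nonneg ‖G t 1‖, sq_nonneg ‖G t 2‖]
    _ = 3 * T + ∫ t in Ioo 0 T, ∑ i, ‖G t i‖ ^ 2 := by
        rw [integral_add (integrable_const _) iG2, setIntegral_const]
        simp [hT.le, mul_comm]
    _ ≤ _ := by linarith [(h.energy_bounds hT hε hE).2]

/-- The pointwise form of the time modulus, at the regularization length `α`. -/
theorem IsWeakSolution.ae_norm_lerayP_shift_le {Ω : Set E3} {T ε : ℝ} (hT : 0 < T) {u₀ : L2V Ω}
    {p₀ : L2S Ω} {u : ℝ → L2V Ω} {G : ℝ → Fin 3 → L2V Ω} {p : ℝ → L2S Ω}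
    (h : IsWeakSolution Ω T ε u₀ p₀ u G p) {M : ℝ}
    (hM : ∀ᵐ t ∂(volume.restrict (Ioo 0 T)), ‖u t‖ ≤ M) {C α : ℝ} (hC : 0 ≤ C) (hα : 0 < α)
    (hα1 : α ≤ 1) {W : L2V Ω → E3 → E3} (hW : IsRegularization Ω C α W) {δ : ℝ} (hδ : 0 < δ) :
    ∀ᵐ t ∂(volume.restrict (Ioo 0 (T - δ))), ‖lerayP Ω (u (t + δ) - u t)‖ ≤
      C * α * (2 * M + (∑ i, ‖G (t + δ) i‖ + ∑ i, ‖G t i‖)) +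
      C * α ^ (-(3 / 2) : ℝ) * (1 + 2 * M) * ∫ s in Ioo t (t + δ), ∑ i, ‖G s i‖ := by
  have hweak := h.ae_integral_inner_eq hT hM hC hα hα1 hW
  have iG : IntegrableOn (fun t => ∑ i, ‖G t i‖) (Ioo 0 T) :=
    integrable_finsetSum _ fun i _ => ((h.velocity.grad_memLp i).integrable (by norm_num)).norm
  filter_upwards [ae_restrict_sub hδ hM, ae_shift hδ hM, ae_restrict_sub hδ hweak,
    ae_shift hδ hweak, ae_restrict_sub hδ h.velocity.grad, ae_shift hδ h.velocity.grad,
    ae_restrict_mem measurableSet_Ioo] with t m1 m2 w1 w2 g1 g2 htT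
  set K := lerayP Ω (u (t + δ) - u t) with hK
  have hKs : K ∈ solenoidal Ω := lerayP_mem_solenoidal Ω _
  have hM0 : 0 ≤ M := (norm_nonneg _).trans m1
  have hsub : Ioo t (t + δ) ⊆ Ioo 0 T := Ioo_subset_Ioo htT.1.le (by linarith [htT.2])
  have hb : ∀ᵐ s ∂(volume.restrict (Ioo 0 T)), ‖force Ω (W K) (u s) (G s)‖ ≤
      C * α ^ (-(3 / 2) : ℝ) * ‖K‖ * (1 + 2 * M) * ∑ i, ‖G s i‖ := by
    filter_upwards [hM] with s hs
    refine (hW.abs_force_le hC hα hα1 K (u s) (G s)).trans ?_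
    gcongr
  have hFi : IntegrableOn (fun s => force Ω (W K) (u s) (G s)) (Ioo 0 T) :=
    (iG.const_mul _).mono' ((hW.isTestField K).aestronglyMeasurable_force
      h.velocity.memLp.aestronglyMeasurable fun i =>
        (h.velocity.grad_memLp i).aestronglyMeasurable) hb
  have hsplit : ∫ s in Ioo 0 (t + δ), force Ω (W K) (u s) (G s) =
      (∫ s in Ioo 0 t, force Ω (W K) (u s) (G s)) +
        ∫ s in Ioo t (t + δ), force Ω (W K) (u s) (G s) := by
    simp only [← integral_Ioc_eq_integral_Ioo]
    rw [← Ioc_union_Ioc_eq_Ioc htT.1.le (by linarith : t ≤ t + δ),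
      setIntegral_union (Ioc_disjoint_Ioc_of_le le_rfl) measurableSet_Ioc]
    · rw [integrableOn_Ioc_iff_integrableOn_Ioo]
      exact hFi.mono_set (Ioo_subset_Ioo_right (by linarith [htT.2]))
    · rw [integrableOn_Ioc_iff_integrableOn_Ioo]
      exact hFi.mono_set hsub
  have hforce : |∫ s in Ioo t (t + δ), force Ω (W K) (u s) (G s)| ≤
      C * α ^ (-(3 / 2) : ℝ) * (1 + 2 * M) * (∫ s in Ioo t (t + δ), ∑ i, ‖G s i‖) * ‖K‖ := by
    refine (norm_integral_le_of_norm_le ((iG.mono_set hsub).const_mul _)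
      (ae_restrict_of_ae_restrict_of_subset hsub hb)).trans_eq ?_
    rw [integral_const_mul]
    ring
  have e1 := hW.abs_inner_sub_le _ _ K g1
  have e2 := hW.abs_inner_sub_le _ _ K g2
  have e3 : (∫ x in Ω, inner ℝ (u (t + δ) x) (W K x)) - (∫ x in Ω, inner ℝ (u t x) (W K x)) =
      -∫ s in Ioo t (t + δ), force Ω (W K) (u s) (G s) := by
    rw [w1 K hKs, w2 K hKs, hsplit]
    ring
  have e4 : ‖K‖ ^ 2 = inner ℝ (u (t + δ)) K - inner ℝ (u t) K := by
    rw [← inner_sub_left, ← real_inner_self_eq_norm_sq]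
    exact inner_lerayP_of_mem_solenoidal _ hKs
  set I₁ := ∫ x in Ω, inner ℝ (u (t + δ) x) (W K x)
  set I₂ := ∫ x in Ω, inner ℝ (u t x) (W K x)
  set J := ∫ s in Ioo t (t + δ), force Ω (W K) (u s) (G s)
  have g0 : 0 ≤ ∑ i, ‖G t i‖ := Finset.sum_nonneg fun i _ => norm_nonneg _
  have g0' : 0 ≤ ∑ i, ‖G (t + δ) i‖ := Finset.sum_nonneg fun i _ => norm_nonneg _
  have hN0 : 0 ≤ ∫ s in Ioo t (t + δ), ∑ i, ‖G s i‖ :=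
    integral_nonneg fun s => Finset.sum_nonneg fun i _ => norm_nonneg _
  have hρ0 : 0 ≤ α ^ (-(3 / 2) : ℝ) := by positivity
  have b2 : C * α * (‖u t‖ + ∑ i, ‖G t i‖) * ‖K‖ ≤ C * α * (M + ∑ i, ‖G t i‖) * ‖K‖ := by gcongr
  have b1 : C * α * (‖u (t + δ)‖ + ∑ i, ‖G (t + δ) i‖) * ‖K‖ ≤
      C * α * (M + ∑ i, ‖G (t + δ) i‖) * ‖K‖ := by gcongr
  generalize (∫ s in Ioo t (t + δ), ∑ i, ‖G s i‖) = N at *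
  generalize (∑ i, ‖G (t + δ) i‖) = S₁ at *
  generalize (∑ i, ‖G t i‖) = S₂ at *
  generalize α ^ (-(3 / 2) : ℝ) = r at *
  generalize ‖K‖ = k at *
  have hk : k ^ 2 ≤ (C * α * (2 * M + (S₁ + S₂)) + C * r * (1 + 2 * M) * N) * k := by
    have hexp : (C * α * (2 * M + (S₁ + S₂)) + C * r * (1 + 2 * M) * N) * k =
      C * α * (M + S₁) * k + C * α * (M + S₂) * k + C * r * (1 + 2 * M) * N * k := by ring
    rw [hexp]
    have a1 := abs_le.1 e1
    have a2 := abs_le.1 e2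
    have a3 := abs_le.1 hforce
    linarith [a1.1, a1.2, a2.1, a2.2, a3.1, a3.2]
  have hR0 : 0 ≤ C * α * (2 * M + (S₁ + S₂)) + C * r * (1 + 2 * M) * N := by positivity
  by_contra! hlt
  have hlt' := mul_lt_mul_of_pos_right hlt (hR0.trans_lt hlt)
  rw [sq] at hk
  linarith

/-- The time modulus of the solenoidal part, uniform over the solutions with energy at most `E`:
with the regularization length `α = h^{2/5}`, the two errors `α` and `h α^{-3/2}` agree. -/
theorem IsExteriorDomain.exists_time_modulus {Ω : Set E3} (hΩ : IsExteriorDomain Ω) {T : ℝ}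
    (hT : 0 < T) (E : ℝ) (hE0 : 0 ≤ E) :
    ∃ C : ℝ, 0 ≤ C ∧ ∀ (ε : ℝ) (u₀ : L2V Ω) (p₀ : L2S Ω) (u : ℝ → L2V Ω)
      (G : ℝ → Fin 3 → L2V Ω) (p : ℝ → L2S Ω), 0 < ε → IsWeakSolution Ω T ε u₀ p₀ u G p →
      1 / 2 * ‖u₀‖ ^ 2 + ε / 2 * ‖p₀‖ ^ 2 ≤ E → ∀ δ, 0 < δ → δ < 1 →
      ∫⁻ t in Ioo 0 (T - δ), ‖lerayP Ω (u (t + δ)) - lerayP Ω (u t)‖ₑ ^ 2 ≤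
        ENNReal.ofReal (C * δ ^ (2 / 5 : ℝ)) := by
  obtain ⟨C, hC, hreg⟩ := hΩ.exists_isRegularization
  set M := √(2 * E) with hMdef
  have hM0 : 0 ≤ M := Real.sqrt_nonneg _
  refine ⟨2 * M * (C * (2 * M)) * T + (2 * (2 * M * C) + 2 * M * (C * (1 + 2 * M))) * (3 * T + E),
    by positivity, ?_⟩
  intro ε u₀ p₀ u G p hε h hE δ hδ hδ1
  have hM := (h.energy_bounds hT hε hE).1
  set α := δ ^ (2 / 5 : ℝ) with hα
  have hαpos : 0 < α := Real.rpow_pos_of_pos hδ _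
  have hα1 : α ≤ 1 := Real.rpow_le_one hδ.le hδ1.le (by norm_num)
  have hαδ : α ^ (-(3 / 2) : ℝ) * δ = α := by
    rw [hα, ← Real.rpow_mul hδ.le]
    nth_rewrite 2 [← Real.rpow_one δ]
    rw [← Real.rpow_add hδ]
    norm_num
  obtain ⟨W, hW⟩ := hreg α hαpos hα1
  have hpt := h.ae_norm_lerayP_shift_le hT hM hC hαpos hα1 hW hδ
  have iG : IntegrableOn (fun t => ∑ i, ‖G t i‖) (Ioo 0 T) :=
    integrable_finsetSum _ fun i _ => ((h.velocity.grad_memLp i).integrable (by norm_num)).norm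
  have hg0 : ∀ t, 0 ≤ ∑ i, ‖G t i‖ := fun t => Finset.sum_nonneg fun i _ => norm_nonneg _
  have hbound := lintegral_le_of_window (T := T) hδ
    (γ := fun t => ENNReal.ofReal (∑ i, ‖G t i‖))
    (f := fun t => ‖lerayP Ω (u (t + δ)) - lerayP Ω (u t)‖ₑ ^ 2)
    (a := ENNReal.ofReal (2 * M * (C * α * (2 * M)))) (b := ENNReal.ofReal (2 * M * (C * α)))
    (c := ENNReal.ofReal (2 * M * (C * α ^ (-(3 / 2) : ℝ) * (1 + 2 * M))))
    iG.aemeasurable.ennreal_ofReal ?_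
  · refine hbound.trans ?_
    calc _ ≤ ENNReal.ofReal (2 * M * (C * α * (2 * M))) * ENNReal.ofReal T +
          (2 * ENNReal.ofReal (2 * M * (C * α)) +
            ENNReal.ofReal (2 * M * (C * α ^ (-(3 / 2) : ℝ) * (1 + 2 * M))) * ENNReal.ofReal δ) *
            ENNReal.ofReal (3 * T + E) := by
          gcongr
          exact h.lintegral_sum_le hT hε hE
      _ = ENNReal.ofReal (2 * M * (C * α * (2 * M)) * T + (2 * (2 * M * (C * α)) +
            2 * M * (C * α ^ (-(3 / 2) : ℝ) * (1 + 2 * M)) * δ) * (3 * T + E)) := by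
          rw [← ENNReal.ofReal_mul (by positivity), ← ENNReal.ofReal_mul (by positivity),
            show (2 : ℝ≥0∞) = ENNReal.ofReal 2 by simp, ← ENNReal.ofReal_mul (by norm_num),
            ← ENNReal.ofReal_add (by positivity) (by positivity),
            ← ENNReal.ofReal_mul (by positivity),
            ← ENNReal.ofReal_add (by positivity) (by positivity)]
      _ ≤ _ := by
          refine ENNReal.ofReal_le_ofReal (le_of_eq ?_)
          rw [show 2 * M * (C * α ^ (-(3 / 2) : ℝ) * (1 + 2 * M)) * δ =
            2 * M * (C * (1 + 2 * M)) * (α ^ (-(3 / 2) : ℝ) * δ) by ring, hαδ]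
          ring
  · filter_upwards [hpt, ae_restrict_sub hδ hM, ae_shift hδ hM, ae_restrict_mem measurableSet_Ioo]
      with t ht m1 m2 htT
    have hsub : Ioo t (t + δ) ⊆ Ioo 0 T := Ioo_subset_Ioo htT.1.le (by linarith [htT.2])
    rw [← ofReal_integral_eq_lintegral_ofReal (iG.mono_set hsub) (Eventually.of_forall hg0),
      ← ENNReal.ofReal_add (hg0 _) (hg0 _), ← ENNReal.ofReal_mul (by positivity),
      ← ENNReal.ofReal_mul (by positivity),
      ← ENNReal.ofReal_add (by positivity)
        (mul_nonneg (by positivity) (add_nonneg (hg0 _) (hg0 _))),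
      ← ENNReal.ofReal_add (add_nonneg (by positivity)
        (mul_nonneg (by positivity) (add_nonneg (hg0 _) (hg0 _))))
        (mul_nonneg (by positivity) (integral_nonneg hg0)),
      ← ofReal_norm, ← ENNReal.ofReal_pow (norm_nonneg _), ← map_sub]
    refine ENNReal.ofReal_le_ofReal ?_
    have hz : ‖lerayP Ω (u (t + δ) - u t)‖ ≤ 2 * M :=
      (norm_lerayP_le _).trans ((norm_sub_le _ _).trans (by linarith))
    rw [sq]
    calc _ ≤ 2 * M * (C * α * (2 * M + (∑ i, ‖G (t + δ) i‖ + ∑ i, ‖G t i‖)) +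
      C * α ^ (-(3 / 2) : ℝ) * (1 + 2 * M) * ∫ s in Ioo t (t + δ), ∑ i, ‖G s i‖) := by gcongr
      _ = _ := by ring

/-! ### Spatial increments of the solenoidal part -/

theorem memLp_indicator_coe {Ω : Set E3} (hΩ : MeasurableSet Ω) (f : L2V Ω) :
    MemLp (fun x => Ω.indicator f x) 2 (volume : Measure E3) :=
  (memLp_indicator_iff_restrict hΩ).2 (Lp.memLp f)

theorem lintegral_indicator_coe {Ω : Set E3} (hΩ : MeasurableSet Ω) (f : L2V Ω) :
    ∫⁻ x, ‖Ω.indicator f x‖ₑ ^ 2 = ‖f‖ₑ ^ 2 := by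
  rw [Lp_enorm_sq, ← lintegral_indicator hΩ]
  refine lintegral_congr fun x => ?_
  by_cases hx : x ∈ Ω <;> simp [hx]

theorem norm_toLp_indicator_le {Ω : Set E3} (hΩ : MeasurableSet Ω) (f : L2V Ω) :
    ‖(memLp_indicator_coe hΩ f).toLp _‖ ≤ 1 * ‖f‖ := by
  refine norm_toLp_le_of_lintegral _ (by positivity) ?_
  rw [one_mul, ofReal_norm, lintegral_indicator_coe hΩ]

/-- The extension by zero of the fields in `L²(Ω; ℝ³)` to the whole space. -/
def extendZero {Ω : Set E3} (hΩ : MeasurableSet Ω) : L2V Ω →L[ℝ] Lp E3 2 (volume : Measure E3) :=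
  LinearMap.mkContinuous
    { toFun := fun f => (memLp_indicator_coe hΩ f).toLp _
      map_add' := fun f g => by
        rw [← MemLp.toLp_add, MemLp.toLp_eq_toLp_iff]
        filter_upwards [(ae_eq_restrict_iff_indicator_ae_eq hΩ).1 (Lp.coeFn_add f g)] with x hx
        rw [hx, Pi.add_apply, indicator_add']
        rfl
      map_smul' := fun c f => by
        rw [RingHom.id_apply, ← MemLp.toLp_const_smul, MemLp.toLp_eq_toLp_iff]
        filter_upwards [(ae_eq_restrict_iff_indicator_ae_eq hΩ).1 (Lp.coeFn_smul c f)] with x hx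
        rw [hx, Pi.smul_apply]
        exact indicator_const_smul_apply Ω c f x } 1 (norm_toLp_indicator_le hΩ)

theorem extendZero_coeFn {Ω : Set E3} (hΩ : MeasurableSet Ω) (f : L2V Ω) :
    extendZero hΩ f =ᵐ[volume] fun x => Ω.indicator f x :=
  MemLp.coeFn_toLp (memLp_indicator_coe hΩ f)

theorem norm_extendZero_le {Ω : Set E3} (hΩ : MeasurableSet Ω) (f : L2V Ω) :
    ‖extendZero hΩ f‖ ≤ ‖f‖ := by
  simpa using (extendZero hΩ).le_of_opNorm_le (LinearMap.mkContinuous_norm_le _ zero_le_one _) f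

/-- The translate `x ↦ f(x + y)` of a field on the whole space. -/
def shiftLp (y : E3) : Lp E3 2 (volume : Measure E3) →ₗᵢ[ℝ] Lp E3 2 (volume : Measure E3) :=
  Lp.compMeasurePreservingₗᵢ ℝ (fun x => x + y) (measurePreserving_add_right volume y)

theorem shiftLp_coeFn (y : E3) (f : Lp E3 2 (volume : Measure E3)) :
    shiftLp y f =ᵐ[volume] fun x => f (x + y) :=
  Lp.coeFn_compMeasurePreserving f (measurePreserving_add_right volume y)

/-- The increment `x ↦ f(x + y) - f(x)` of a field extended by zero. -/
def increment {Ω : Set E3} (hΩ : MeasurableSet Ω) (y : E3) :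
    L2V Ω →L[ℝ] Lp E3 2 (volume : Measure E3) :=
  (shiftLp y).toContinuousLinearMap.comp (extendZero hΩ) - extendZero hΩ

theorem increment_apply {Ω : Set E3} (hΩ : MeasurableSet Ω) (y : E3) (f : L2V Ω) :
    increment hΩ y f = shiftLp y (extendZero hΩ f) - extendZero hΩ f := rfl

theorem increment_coeFn {Ω : Set E3} (hΩ : MeasurableSet Ω) (y : E3) (f : L2V Ω) :
    increment hΩ y f =ᵐ[volume] fun x => extendZero hΩ f (x + y) - extendZero hΩ f x := by
  rw [increment_apply]
  filter_upwards [Lp.coeFn_sub (shiftLp y (extendZero hΩ f)) (extendZero hΩ f),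
    shiftLp_coeFn y (extendZero hΩ f)] with x h1 h2
  rw [h1, Pi.sub_apply, h2]

theorem ae_shift_eq {E : Type*} {f g : E3 → E} (h : f =ᵐ[volume] g) (y : E3) :
    (fun x => f (x + y)) =ᵐ[volume] fun x => g (x + y) :=
  (measurePreserving_add_right volume y).quasiMeasurePreserving.ae_eq h

theorem norm_increment_le {Ω : Set E3} (hΩ : MeasurableSet Ω) (y : E3) (f : L2V Ω) :
    ‖increment hΩ y f‖ ≤ 2 * ‖f‖ := by
  rw [increment_apply]
  refine (norm_sub_le _ _).trans ?_
  rw [LinearIsometry.norm_map]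
  linarith [norm_extendZero_le hΩ f]

theorem HasH10Grad.closure_induction {Ω : Set E3} {P : L2V Ω → (Fin 3 → L2V Ω) → Prop}
    (hcl : IsClosed {q : L2V Ω × (Fin 3 → L2V Ω) | P q.1 q.2})
    (h : ∀ (z : L2V Ω) (g : Fin 3 → L2V Ω) (φ : E3 → E3), ContDiff ℝ ∞ φ → HasCompactSupport φ →
      tsupport φ ⊆ Ω → (z : E3 → E3) =ᵐ[volume.restrict Ω] φ →
      (∀ i, (g i : E3 → E3) =ᵐ[volume.restrict Ω] fun x => fderiv ℝ φ x (e3 i)) → P z g)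
    {z : L2V Ω} {g : Fin 3 → L2V Ω} (hz : HasH10Grad Ω z g) : P z g := by
  have hsub : {q : L2V Ω × (Fin 3 → L2V Ω) |
      ∃ φ : E3 → E3, ContDiff ℝ ∞ φ ∧ HasCompactSupport φ ∧ tsupport φ ⊆ Ω ∧
      (q.1 : E3 → E3) =ᵐ[volume.restrict Ω] φ ∧
      ∀ i, (q.2 i : E3 → E3) =ᵐ[volume.restrict Ω] fun x => fderiv ℝ φ x (e3 i)} ⊆
      {q : L2V Ω × (Fin 3 → L2V Ω) | P q.1 q.2} := by
    rintro ⟨z, g⟩ ⟨φ, h1, h2, h3, h4, h5⟩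
    exact h z g φ h1 h2 h3 h4 h5
  exact closure_minimal hsub hcl hz

theorem HasH10Grad.norm_increment_le {Ω : Set E3} (hΩ : MeasurableSet Ω) {z : L2V Ω}
    {g : Fin 3 → L2V Ω} (hz : HasH10Grad Ω z g) (y : E3) :
    ‖increment hΩ y z‖ ≤ 3 * ‖y‖ * ∑ i, ‖g i‖ := by
  have hcl : IsClosed {q : L2V Ω × (Fin 3 → L2V Ω) |
      ‖increment hΩ y q.1‖ ≤ 3 * ‖y‖ * ∑ i, ‖q.2 i‖} := by
    have h1 : Continuous fun q : L2V Ω × (Fin 3 → L2V Ω) => increment hΩ y q.1 :=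
      (increment hΩ y).continuous.comp continuous_fst
    exact isClosed_le h1.norm (by fun_prop)
  refine HasH10Grad.closure_induction (P := fun z g => ‖increment hΩ y z‖ ≤ 3 * ‖y‖ * ∑ i, ‖g i‖) hcl ?_ hz
  clear hz hcl z g
  intro z g φ hφ hφs hsupp hzφ hgφ
  have hS0 : 0 ≤ ∑ i, ‖g i‖ := Finset.sum_nonneg fun i _ => norm_nonneg _
  have hzE : extendZero hΩ z =ᵐ[volume] φ := by
    refine (extendZero_coeFn hΩ z).trans ?_
    refine ((ae_eq_restrict_iff_indicator_ae_eq hΩ).1 hzφ).trans ?_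
    rw [indicator_eq_self.2 ((subset_tsupport φ).trans hsupp)]
  have hD : increment hΩ y z =ᵐ[volume] fun x => φ (x + y) - φ x := by
    filter_upwards [increment_coeFn hΩ y z, hzE, ae_shift_eq hzE y] with x h1 h2 h3
    rw [h1, h2, h3]
  have h1 : ‖increment hΩ y z‖ₑ ^ 2 ≤ ENNReal.ofReal (3 * ‖y‖ * ∑ i, ‖g i‖) ^ 2 := by
    rw [Lp_enorm_sq]
    calc _ = ∫⁻ x in univ, ‖φ (x + y) - φ x‖ₑ ^ 2 := by
          rw [Measure.restrict_univ]
          exact lintegral_congr_ae (hD.mono fun x hx => by simp only [hx])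
      _ ≤ 8 * ENNReal.ofReal ‖y‖ ^ 2 * ∫⁻ x in univ, ‖fderiv ℝ φ x‖ₑ ^ 2 :=
          lintegral_displacement_le (hφ.of_le (by simp)) (ξ := fun _ => y)
            (LipschitzWith.const' y) (fun _ => le_rfl) .univ .univ (by simp)
      _ ≤ 9 * ENNReal.ofReal ‖y‖ ^ 2 * ENNReal.ofReal (∑ i, ‖g i‖) ^ 2 := by
          rw [Measure.restrict_univ, lintegral_fderiv_eq_setLIntegral hΩ hsupp]
          gcongr
          · norm_num
          · exact lintegral_fderiv_sq_le hφ hgφ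
      _ = _ := by
          rw [ENNReal.ofReal_mul (by positivity), ENNReal.ofReal_mul (by norm_num), mul_pow,
            mul_pow, ENNReal.ofReal_ofNat]
          norm_num
  have h2 := (ENNReal.pow_le_pow_left_iff two_ne_zero).1 h1
  rwa [← ofReal_norm, ENNReal.ofReal_le_ofReal_iff (by positivity)] at h2

/-- A field in `H¹₀(Ω)` with zero gradient vanishes: its extension by zero is invariant under
translations and vanishes in a ball. -/
theorem HasH10Grad.eq_zero {Ω : Set E3} (hΩ : IsExteriorDomain Ω) {w : L2V Ω}
    (hw : HasH10Grad Ω w 0) : w = 0 := by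
  have hm := hΩ.isOpen.measurableSet
  obtain ⟨a, r, hr, hb⟩ := hΩ.exists_ball_subset
  set f := extendZero hm w with hf
  have hball : ∀ᵐ x, x ∈ Metric.ball a r → f x = 0 := by
    filter_upwards [extendZero_coeFn hm w] with x hx hxb
    rw [hf, hx, indicator_of_notMem (hb hxb)]
  have hzero : ∀ᵐ x, f x = 0 := by
    rw [ae_iff]
    refine measure_null_of_locally_null _ fun b _ => ?_
    refine ⟨{x | ¬f x = 0} ∩ Metric.ball b r, inter_mem_nhdsWithin _ (Metric.ball_mem_nhds b hr), ?_⟩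
    have h1 : ‖increment hm (b - a) w‖ ≤ 0 := by
      refine (hw.norm_increment_le hm _).trans_eq ?_
      simp
    have h2 := norm_le_zero_iff.1 h1
    have h3 := increment_coeFn hm (b - a) w
    rw [h2] at h3
    have h4 : ∀ᵐ x, f (x + (b - a)) = f x := by
      filter_upwards [h3, Lp.coeFn_zero E3 2 (volume : Measure E3)] with x h5 h6
      rw [h6] at h5
      exact (sub_eq_zero.1 h5.symm)
    have h5 : ∀ᵐ x, x + (b - a) ∈ Metric.ball b r → f (x + (b - a)) = 0 := by
      filter_upwards [h4, hball] with x h6 h7 h8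
      rw [h6]
      refine h7 ?_
      rw [mem_ball_iff_norm] at h8 ⊢
      convert h8 using 2
      abel
    have h6 := (measurePreserving_add_right volume (-(b - a))).quasiMeasurePreserving.ae h5
    have h7 : ∀ᵐ x, x ∈ Metric.ball b r → f x = 0 := by
      filter_upwards [h6] with x hx
      rwa [neg_add_cancel_right] at hx
    have h8 := ae_iff.1 h7
    convert h8 using 2
    ext x
    simp [and_comm]
  have h9 : ‖w‖ₑ ^ 2 = 0 := by
    rw [Lp_enorm_sq]
    rw [lintegral_eq_zero_iff' ((Lp.aestronglyMeasurable w).enorm.pow_const 2)]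
    filter_upwards [ae_restrict_of_ae hzero, ae_restrict_of_ae (extendZero_coeFn hm w),
      ae_restrict_mem hm] with x h1 h2 h3
    rw [← hf, h1, indicator_of_mem h3] at h2
    simp [← h2]
  simpa using h9

theorem mem_testGradients_of_mem_span {Ω : Set E3} {q : L2V Ω}
    (hq : q ∈ Submodule.span ℝ (testGradients Ω)) : q ∈ testGradients Ω := by
  induction hq using Submodule.span_induction with
  | mem x h => exact h
  | zero =>
    refine ⟨fun _ => 0, contDiff_const, HasCompactSupport.zero, ?_⟩
    filter_upwards [Lp.coeFn_zero E3 2 (volume.restrict Ω)] with x hx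
    rw [hx]
    simp [gradient]
  | add a b _ _ ha hb =>
    obtain ⟨φ, h1, h2, h3⟩ := ha
    obtain ⟨ψ, k1, k2, k3⟩ := hb
    refine ⟨fun x => φ x + ψ x, h1.add k1, h2.add k2, ?_⟩
    filter_upwards [Lp.coeFn_add a b, h3, k3] with x e1 e2 e3
    rw [e1, Pi.add_apply, e2, e3, gradient, gradient, gradient,
      fderiv_fun_add (h1.differentiable (by simp) x) (k1.differentiable (by simp) x), map_add]
  | smul c a _ ha =>
    obtain ⟨φ, h1, h2, h3⟩ := ha
    refine ⟨fun x => c * φ x, contDiff_const.mul h1, h2.mul_left, ?_⟩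
    filter_upwards [Lp.coeFn_smul c a, h3] with x e1 e2
    rw [e1, Pi.smul_apply, e2, gradient, gradient,
      fderiv_const_mul (h1.differentiable (by simp) x), map_smul]

/-- A smooth cutoff with values in `[0, 1]` and slope at most `L`, whose support is at distance
more than `δ` from the complement of `Ω`. -/
structure IsCutoff (Ω : Set E3) (χ : E3 → ℝ) (L δ : ℝ) : Prop where
  contDiff : ContDiff ℝ ∞ χ
  compact : HasCompactSupport χ
  mem_Icc : ∀ x, χ x ∈ Icc (0 : ℝ) 1
  norm_fderiv_le : ∀ x, ‖fderiv ℝ χ x‖ ≤ L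
  closedBall_subset : ∀ x ∈ tsupport χ, Metric.closedBall x δ ⊆ Ω

theorem exists_isCutoff {Ω K : Set E3} (hΩ : IsOpen Ω) (hK : IsCompact K) (hKΩ : K ⊆ Ω) :
    ∃ (χ : E3 → ℝ) (L δ : ℝ), 0 ≤ L ∧ 0 < δ ∧ IsCutoff Ω χ L δ ∧ ∀ x ∈ K, χ x = 1 := by
  obtain ⟨r, hr, hsub⟩ := hK.exists_cthickening_subset_open hΩ hKΩ
  have hr2 : 0 < r / 2 := half_pos hr
  obtain ⟨f, hf1, hf0, hf⟩ := exists_contMDiffMap_one_nhds_of_subset_interior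
    (modelWithCornersSelf ℝ E3) (n := (⊤ : ℕ∞)) hK.isClosed
    (t := Metric.cthickening (r / 2) K)
    ((Metric.self_subset_thickening hr2 K).trans
      (interior_maximal (Metric.thickening_subset_cthickening _ _) Metric.isOpen_thickening))
  have hts : tsupport f ⊆ Metric.cthickening (r / 2) K := by
    refine closure_minimal (fun x hx => ?_) Metric.isClosed_cthickening
    by_contra h
    exact hx (hf0 x h)
  have hfc : ContDiff ℝ ∞ f := f.contMDiff.contDiff
  have hcomp : HasCompactSupport f := hK.cthickening.of_isClosed_subset (isClosed_tsupport _) hts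
  obtain ⟨L, hL⟩ := (hcomp.fderiv (𝕜 := ℝ)).exists_bound_of_continuous
    (hfc.continuous_fderiv (by simp))
  refine ⟨f, L, r / 2, (norm_nonneg _).trans (hL 0), hr2, ⟨hfc, hcomp, hf, hL, ?_⟩,
    fun x hx => hf1.self_of_nhdsSet x hx⟩
  intro x hx
  refine subset_trans ?_ hsub
  have h1 : Metric.closedBall x (r / 2) ⊆
      Metric.cthickening (r / 2) (Metric.cthickening (r / 2) K) :=
    Metric.closedBall_subset_cthickening (hts hx) _
  refine h1.trans ?_
  have h2 := Metric.cthickening_cthickening_subset hr2.le hr2.le K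
  rwa [add_halves] at h2

section

variable {Ω : Set E3} {χ : E3 → ℝ} {L δ : ℝ}

theorem IsCutoff.memLp_smul (hχ : IsCutoff Ω χ L δ) (F : Lp E3 2 (volume : Measure E3)) :
    MemLp (fun x => χ x • F x) 2 (volume : Measure E3) := by
  refine (Lp.memLp F).of_le (hχ.contDiff.continuous.aestronglyMeasurable.smul
    (Lp.aestronglyMeasurable F)) (Eventually.of_forall fun x => ?_)
  rw [norm_smul, Real.norm_of_nonneg (hχ.mem_Icc x).1]
  exact mul_le_of_le_one_left (norm_nonneg _) (hχ.mem_Icc x).2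

theorem IsCutoff.norm_toLp_smul_le (hχ : IsCutoff Ω χ L δ) (F : Lp E3 2 (volume : Measure E3)) :
    ‖(hχ.memLp_smul F).toLp _‖ ≤ ‖F‖ := by
  refine norm_toLp_le_of_lintegral _ (norm_nonneg _) ?_
  rw [ofReal_norm, Lp_enorm_sq]
  refine lintegral_mono fun x => ?_
  gcongr
  rw [enorm_smul]
  refine mul_le_of_le_one_left' ?_
  rw [← ofReal_norm, Real.norm_of_nonneg (hχ.mem_Icc x).1]
  exact ENNReal.ofReal_le_one.2 (hχ.mem_Icc x).2

theorem memLp_gradient_univ {φ : E3 → ℝ} (hφ : ContDiff ℝ ∞ φ) (hφs : HasCompactSupport φ) :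
    MemLp (fun x => gradient φ x) 2 (volume : Measure E3) := by
  have h := memLp_gradient hφ hφs univ
  rwa [Measure.restrict_univ] at h

theorem integral_inner_extendZero_gradient (hΩ : MeasurableSet Ω) {f : L2V Ω}
    (hf : f ∈ solenoidal Ω) {ψ : E3 → ℝ} (hψ : ContDiff ℝ ∞ ψ) (hψs : HasCompactSupport ψ) :
    ∫ x, inner ℝ (extendZero hΩ f x) (gradient ψ x) = 0 := by
  rw [← integral_fderiv_eq_zero_of_mem_solenoidal hf hψ hψs, ← integral_indicator hΩ]
  refine integral_congr_ae ?_
  filter_upwards [extendZero_coeFn hΩ f] with x hx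
  rw [hx]
  by_cases h : x ∈ Ω
  · rw [indicator_of_mem h, indicator_of_mem h, inner_gradient_right]
    simp
  · rw [indicator_of_notMem h, indicator_of_notMem h, inner_zero_left]

theorem inner_increment_gradient (hΩ : MeasurableSet Ω) {f : L2V Ω}
    (hf : f ∈ solenoidal Ω) {ψ : E3 → ℝ} (hψ : ContDiff ℝ ∞ ψ) (hψs : HasCompactSupport ψ) (y : E3) :
    inner ℝ (increment hΩ y f) ((memLp_gradient_univ hψ hψs).toLp _) = 0 := by
  rw [increment_apply, inner_sub_left, inner_toLp_eq, inner_toLp_eq,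
    integral_inner_extendZero_gradient hΩ hf hψ hψs, sub_zero]
  have hs : HasCompactSupport fun x => ψ (x - y) :=
    hψs.comp_homeomorph (Homeomorph.subRight y)
  have hc : ContDiff ℝ ∞ fun x => ψ (x - y) := hψ.comp (contDiff_id.sub contDiff_const)
  rw [← integral_inner_extendZero_gradient hΩ hf hc hs,
    ← integral_add_right_eq_self (fun x => inner ℝ (extendZero hΩ f x)
      (gradient (fun x => ψ (x - y)) x)) y]
  refine integral_congr_ae ?_
  filter_upwards [shiftLp_coeFn y (extendZero hΩ f)] with x hx
  rw [hx]
  congr 1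
  rw [gradient, gradient, fderiv_comp_sub, add_sub_cancel_right]

theorem extendZero_ae_eq_gradient (hΩ : MeasurableSet Ω) {q : L2V Ω} {φ : E3 → ℝ}
    (hq : (q : E3 → E3) =ᵐ[volume.restrict Ω] fun x => gradient φ x) :
    ∀ᵐ x, x ∈ Ω → extendZero hΩ q x = gradient φ x := by
  filter_upwards [extendZero_coeFn hΩ q, ae_imp_of_ae_restrict hq] with x h1 h2 h3
  rw [h1, indicator_of_mem h3, h2 h3]

theorem gradient_mul {a b : E3 → ℝ} {x : E3} (ha : DifferentiableAt ℝ a x)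
    (hb : DifferentiableAt ℝ b x) :
    gradient (fun x => a x * b x) x = a x • gradient b x + b x • gradient a x := by
  rw [gradient, gradient, gradient, fderiv_fun_mul ha hb, map_add, map_smulₛₗ, map_smulₛₗ]
  rfl

theorem gradient_shift_sub {φ : E3 → ℝ} (hφ : Differentiable ℝ φ) (y x : E3) :
    gradient (fun x => φ (x + y) - φ x) x = gradient φ (x + y) - gradient φ x := by
  have h : DifferentiableAt ℝ (fun x => φ (x + y)) x := by fun_prop
  rw [gradient, gradient, gradient, fderiv_fun_sub h (hφ x), fderiv_comp_add_right, map_sub]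

theorem enorm_gradient (g : E3 → ℝ) (x : E3) : ‖gradient g x‖ₑ = ‖fderiv ℝ g x‖ₑ := by
  rw [← ofReal_norm, ← ofReal_norm, gradient, LinearIsometryEquiv.norm_map]

theorem IsCutoff.lintegral_smul_gradient_le (hχ : IsCutoff Ω χ L δ) (hL : 0 ≤ L)
    (hΩ : MeasurableSet Ω) {q : L2V Ω} {φ : E3 → ℝ} (hφ : ContDiff ℝ ∞ φ)
    (hqφ : (q : E3 → E3) =ᵐ[volume.restrict Ω] fun x => gradient φ x) {y : E3}
    (hmem : ∀ x ∈ tsupport χ, ∀ s ∈ Icc (0 : ℝ) 1, x + s • y ∈ Ω) :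
    ∫⁻ x, ‖(φ (x + y) - φ x) • gradient χ x‖ₑ ^ 2 ≤ ENNReal.ofReal (3 * L * ‖y‖ * ‖q‖) ^ 2 := by
  have hχe : ∀ x, ‖gradient χ x‖ₑ ≤ (tsupport χ).indicator (fun _ => ENNReal.ofReal L) x := by
    intro x
    by_cases hx : x ∈ tsupport χ
    · rw [indicator_of_mem hx, enorm_gradient, ← ofReal_norm]
      exact ENNReal.ofReal_le_ofReal (hχ.norm_fderiv_le x)
    · have h0 : fderiv ℝ χ x = 0 := by
        by_contra h
        exact hx (support_fderiv_subset ℝ h)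
      rw [indicator_of_notMem hx, gradient, h0, map_zero, enorm_zero]
  have hms : MeasurableSet (tsupport χ) := (isClosed_tsupport χ).measurableSet
  calc ∫⁻ x, ‖(φ (x + y) - φ x) • gradient χ x‖ₑ ^ 2
      ≤ ∫⁻ x, (tsupport χ).indicator (fun x => ENNReal.ofReal L ^ 2 * ‖(φ (x + y) - φ x)‖ₑ ^ 2) x := by
        refine lintegral_mono fun x => ?_
        have h1 := hχe x
        by_cases hx : x ∈ tsupport χ
        · rw [indicator_of_mem hx] at h1 ⊢
          rw [enorm_smul, mul_pow, mul_comm]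
          gcongr
        · rw [indicator_of_notMem hx] at h1 ⊢
          rw [enorm_smul, le_zero_iff.1 h1]
          simp
    _ = ENNReal.ofReal L ^ 2 * ∫⁻ x in tsupport χ, ‖(φ (x + y) - φ x)‖ₑ ^ 2 := by
        rw [lintegral_indicator hms, lintegral_const_mul' _ _ (by simp)]
    _ ≤ ENNReal.ofReal L ^ 2 * (8 * ENNReal.ofReal ‖y‖ ^ 2 * ∫⁻ x in Ω, ‖fderiv ℝ φ x‖ₑ ^ 2) := by
        gcongr
        exact lintegral_displacement_le (hφ.of_le (by simp)) (ξ := fun _ => y)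
            (LipschitzWith.const' y) (fun _ => le_rfl) hms hΩ hmem
    _ = ENNReal.ofReal L ^ 2 * (8 * ENNReal.ofReal ‖y‖ ^ 2 * ‖q‖ₑ ^ 2) := by
        rw [Lp_enorm_sq]
        congr 2
        refine lintegral_congr_ae (hqφ.mono fun x hx => ?_)
        simp only [hx, enorm_gradient]
    _ ≤ ENNReal.ofReal L ^ 2 * (9 * ENNReal.ofReal ‖y‖ ^ 2 * ‖q‖ₑ ^ 2) := by
        gcongr
        norm_num
    _ = _ := by
        rw [ENNReal.ofReal_mul (by positivity), ENNReal.ofReal_mul (by positivity),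
          ENNReal.ofReal_mul (by norm_num), mul_pow, mul_pow, mul_pow, ENNReal.ofReal_ofNat]
        simp only [ofReal_norm]
        ring

/-- The increments of a gradient are almost orthogonal, after localization, to the increments of
a solenoidal field: `χ ∇Φ` is the gradient of `χ Φ` up to `Φ ∇χ`, and the increment `Φ` of a
potential is small. -/
theorem IsCutoff.abs_inner_increment_testGradients_le (hχ : IsCutoff Ω χ L δ) (hL : 0 ≤ L)
    (hΩ : MeasurableSet Ω) {f : L2V Ω} (hf : f ∈ solenoidal Ω) {q : L2V Ω}
    (hq : q ∈ testGradients Ω) {y : E3} (hy : ‖y‖ ≤ δ) :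
    |inner ℝ ((hχ.memLp_smul (increment hΩ y f)).toLp _) (increment hΩ y q)| ≤
      ‖increment hΩ y f‖ * (3 * L * ‖y‖) * ‖q‖ := by
  obtain ⟨φ, hφ, hφs, hqφ⟩ := hq
  obtain ⟨Φ, hΦdef⟩ : ∃ Φ : E3 → ℝ, Φ = fun x => φ (x + y) - φ x := ⟨_, rfl⟩
  have hφy : ContDiff ℝ ∞ fun x => φ (x + y) := hφ.comp (contDiff_id.add contDiff_const)
  have hΦ : ContDiff ℝ ∞ Φ := hΦdef ▸ hφy.sub hφ
  have hψ : ContDiff ℝ ∞ fun x => χ x * Φ x := hχ.contDiff.mul hΦ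
  have hψs : HasCompactSupport fun x => χ x * Φ x := hχ.compact.mul_right
  have hmem : ∀ x ∈ tsupport χ, ∀ s ∈ Icc (0 : ℝ) 1, x + s • y ∈ Ω := by
    intro x hx s hs
    refine hχ.closedBall_subset x hx ?_
    rw [mem_closedBall_iff_norm, add_sub_cancel_left, norm_smul, Real.norm_of_nonneg hs.1]
    exact (mul_le_of_le_one_left (norm_nonneg _) hs.2).trans hy
  have hgc : Continuous fun x => gradient χ x :=
    (InnerProductSpace.toDual ℝ E3).symm.continuous.comp (hχ.contDiff.continuous_fderiv (by simp))
  have hYc : Continuous fun x => Φ x • gradient χ x := hΦ.continuous.smul hgc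
  have hgs : HasCompactSupport fun x => gradient χ x :=
    (hχ.compact.fderiv (𝕜 := ℝ)).comp_left (g := (InnerProductSpace.toDual ℝ E3).symm) (map_zero _)
  have hYs : HasCompactSupport fun x => Φ x • gradient χ x := by
    refine hgs.mono fun x hx h0 => hx ?_
    dsimp only at h0 ⊢
    rw [h0, smul_zero]
  have hY : MemLp (fun x => Φ x • gradient χ x) 2 (volume : Measure E3) :=
    hYc.memLp_of_hasCompactSupport hYs
  have hgrad : ∀ x, gradient (fun x => χ x * Φ x) x = χ x • gradient Φ x + Φ x • gradient χ x :=
    fun x => gradient_mul (hχ.contDiff.differentiable (by simp) x) (hΦ.differentiable (by simp) x)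
  have hΦgrad : ∀ x, gradient Φ x = gradient φ (x + y) - gradient φ x :=
    fun x => hΦdef ▸ gradient_shift_sub (hφ.differentiable (by simp)) y x
  have hae := extendZero_ae_eq_gradient hΩ hqφ
  have hae' := (measurePreserving_add_right (volume : Measure E3) y).quasiMeasurePreserving.ae hae
  have key : inner ℝ ((hχ.memLp_smul (increment hΩ y f)).toLp _) (increment hΩ y q) =
      -inner ℝ (increment hΩ y f) (hY.toLp _) := by
    have h0 := inner_increment_gradient hΩ hf hψ hψs y
    have h1 : inner ℝ ((hχ.memLp_smul (increment hΩ y f)).toLp _) (increment hΩ y q) =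
        inner ℝ (increment hΩ y f) ((memLp_gradient_univ hψ hψs).toLp _) -
          inner ℝ (increment hΩ y f) (hY.toLp _) := by
      rw [← inner_sub_right, ← MemLp.toLp_sub, inner_toLp_eq, L2.inner_def]
      refine integral_congr_ae ?_
      filter_upwards [(hχ.memLp_smul (increment hΩ y f)).coeFn_toLp, increment_coeFn hΩ y q,
        hae, hae'] with x e1 e2 e3 e4
      rw [e1, e2, Pi.sub_apply, hgrad, add_sub_cancel_right, inner_smul_left, inner_smul_right]
      by_cases hx : χ x = 0
      · simp [hx]
      · have hxs : x ∈ tsupport χ := subset_tsupport _ hx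
        have m0 := hmem x hxs 0 (by simp)
        have m1 := hmem x hxs 1 (by simp)
        rw [zero_smul, add_zero] at m0
        rw [one_smul] at m1
        rw [e3 m0, e4 m1, hΦgrad]
        simp
    rw [h1, h0, zero_sub]
  rw [key, abs_neg]
  refine (abs_real_inner_le_norm _ _).trans ?_
  rw [mul_assoc]
  gcongr
  refine norm_toLp_le_of_lintegral hY (by positivity) ?_
  rw [hΦdef]
  exact hχ.lintegral_smul_gradient_le hL hΩ hφ hqφ hmem

theorem IsCutoff.abs_inner_increment_lerayQ_le (hχ : IsCutoff Ω χ L δ) (hL : 0 ≤ L)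
    (hΩ : MeasurableSet Ω) {f : L2V Ω} (hf : f ∈ solenoidal Ω) (z : L2V Ω) {y : E3}
    (hy : ‖y‖ ≤ δ) :
    |inner ℝ ((hχ.memLp_smul (increment hΩ y f)).toLp _) (increment hΩ y (lerayQ Ω z))| ≤
      ‖increment hΩ y f‖ * (3 * L * ‖y‖) * ‖lerayQ Ω z‖ := by
  have hcl : IsClosed {q : L2V Ω |
      |inner ℝ ((hχ.memLp_smul (increment hΩ y f)).toLp _) (increment hΩ y q)| ≤
        ‖increment hΩ y f‖ * (3 * L * ‖y‖) * ‖q‖} := by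
    have h1 : Continuous fun q : L2V Ω => increment hΩ y q := (increment hΩ y).continuous
    exact isClosed_le (continuous_const.inner h1).abs (by fun_prop)
  have hmem : lerayQ Ω z ∈ closure (Submodule.span ℝ (testGradients Ω) : Set (L2V Ω)) := by
    rw [← Submodule.topologicalClosure_coe]
    exact Submodule.starProjection_apply_mem _ z
  have hsub : (Submodule.span ℝ (testGradients Ω) : Set (L2V Ω)) ⊆ {q : L2V Ω |
      |inner ℝ ((hχ.memLp_smul (increment hΩ y f)).toLp _) (increment hΩ y q)| ≤
        ‖increment hΩ y f‖ * (3 * L * ‖y‖) * ‖q‖} := fun q hq =>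
    hχ.abs_inner_increment_testGradients_le hL hΩ hf (mem_testGradients_of_mem_span hq) hy
  exact closure_minimal hsub hcl hmem

theorem norm_lerayQ_le (z : L2V Ω) : ‖lerayQ Ω z‖ ≤ ‖z‖ := by
  have h := ContinuousLinearMap.le_of_opNorm_le _ (Submodule.starProjection_norm_le
    (Submodule.span ℝ (testGradients Ω)).topologicalClosure) z
  rwa [one_mul] at h

/-- Interior spatial increments of the solenoidal part of a field in `H¹₀(Ω)`. The gradient part is
not smooth in space; it is removed by orthogonality. -/
theorem IsCutoff.setLIntegral_increment_le (hχ : IsCutoff Ω χ L δ) (hL : 0 ≤ L)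
    (hΩ : MeasurableSet Ω) {z : L2V Ω} {g : Fin 3 → L2V Ω} (hz : HasH10Grad Ω z g) {K : Set E3}
    (hK : MeasurableSet K) (hχK : ∀ x ∈ K, χ x = 1) {y : E3} (hy : ‖y‖ ≤ δ) :
    ∫⁻ x in K, ‖extendZero hΩ (lerayP Ω z) (x + y) - extendZero hΩ (lerayP Ω z) x‖ₑ ^ 2 ≤
      ENNReal.ofReal (6 * (1 + L) * ‖y‖ * ‖z‖ * (‖z‖ + ∑ i, ‖g i‖)) := by
  set f := lerayP Ω z with hf
  have hfs : f ∈ solenoidal Ω := lerayP_mem_solenoidal Ω z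
  set X := (hχ.memLp_smul (increment hΩ y f)).toLp _ with hX
  have hS0 : 0 ≤ ∑ i, ‖g i‖ := Finset.sum_nonneg fun i _ => norm_nonneg _
  have hDf : ‖increment hΩ y f‖ ≤ 2 * ‖z‖ :=
    (norm_increment_le hΩ y f).trans (by linarith [norm_lerayP_le z])
  have hsplit : inner ℝ X (increment hΩ y f) =
      inner ℝ X (increment hΩ y z) - inner ℝ X (increment hΩ y (lerayQ Ω z)) := by
    rw [← inner_sub_right, ← map_sub]
    rfl
  have h1 : |inner ℝ X (increment hΩ y z)| ≤ 2 * ‖z‖ * (3 * ‖y‖ * ∑ i, ‖g i‖) := by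
    refine (abs_real_inner_le_norm _ _).trans ?_
    exact mul_le_mul ((hχ.norm_toLp_smul_le _).trans hDf) (hz.norm_increment_le hΩ y)
      (norm_nonneg _) (by positivity)
  have h2 : |inner ℝ X (increment hΩ y (lerayQ Ω z))| ≤ 2 * ‖z‖ * (3 * L * ‖y‖) * ‖z‖ := by
    refine (hχ.abs_inner_increment_lerayQ_le hL hΩ hfs z hy).trans ?_
    gcongr
    exact norm_lerayQ_le z
  have h3 : ∫⁻ x in K, ‖extendZero hΩ f (x + y) - extendZero hΩ f x‖ₑ ^ 2 ≤
      ENNReal.ofReal (inner ℝ X (increment hΩ y f)) := by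
    have hi : inner ℝ X (increment hΩ y f) = ∫ x, χ x * ‖increment hΩ y f x‖ ^ 2 := by
      rw [L2.inner_def]
      refine integral_congr_ae ?_
      filter_upwards [(hχ.memLp_smul (increment hΩ y f)).coeFn_toLp] with x e1
      rw [hX, e1, real_inner_smul_left, real_inner_self_eq_norm_sq]
    have hint : Integrable fun x => χ x * ‖increment hΩ y f x‖ ^ 2 := by
      refine (L2.integrable_inner (𝕜 := ℝ) X (increment hΩ y f)).congr ?_
      filter_upwards [(hχ.memLp_smul (increment hΩ y f)).coeFn_toLp] with x e1
      rw [hX, e1, real_inner_smul_left, real_inner_self_eq_norm_sq]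
    rw [hi, ofReal_integral_eq_lintegral_ofReal hint
      (Eventually.of_forall fun x => mul_nonneg (hχ.mem_Icc x).1 (sq_nonneg _)),
      ← lintegral_indicator hK]
    refine lintegral_mono_ae ?_
    filter_upwards [increment_coeFn hΩ y f] with x e1
    by_cases hx : x ∈ K
    · rw [indicator_of_mem hx, hχK x hx, one_mul, e1, ENNReal.ofReal_pow (norm_nonneg _),
        ofReal_norm]
    · rw [indicator_of_notMem hx]
      exact zero_le
  refine h3.trans (ENNReal.ofReal_le_ofReal ?_)
  rw [hsplit]
  have a1 := (abs_le.1 h1).2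
  have a2 := (abs_le.1 h2).1
  have hexp : 6 * (1 + L) * ‖y‖ * ‖z‖ * (‖z‖ + ∑ i, ‖g i‖) =
    2 * ‖z‖ * (3 * ‖y‖ * ∑ i, ‖g i‖) + 2 * ‖z‖ * (3 * L * ‖y‖) * ‖z‖ +
      (6 * ‖y‖ * ‖z‖ * ‖z‖ + 6 * L * ‖y‖ * ‖z‖ * ∑ i, ‖g i‖) := by ring
  have hpos : 0 ≤ 6 * ‖y‖ * ‖z‖ * ‖z‖ + 6 * L * ‖y‖ * ‖z‖ * ∑ i, ‖g i‖ := by positivity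
  linarith

end

/-! ### Smoothing in space -/

theorem lipschitzWith_zero_half : LipschitzWith (1 / 2) fun _ : E3 => (0 : E3) :=
  LipschitzWith.const' 0

theorem kernelOp_zero_eq {Ω : Set E3} (hΩ : MeasurableSet Ω) (ζ : E3 → ℝ) (f : L2V Ω) (x : E3) :
    kernelOp Ω (fun _ => 0) ζ f x = ∫ y, ζ (-y) • extendZero hΩ f (x + y) := by
  have h1 : kernelOp Ω (fun _ => 0) ζ f x = ∫ w, ζ (x - w) • extendZero hΩ f w := by
    rw [kernelOp, ← integral_indicator hΩ]
    refine integral_congr_ae ?_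
    filter_upwards [extendZero_coeFn hΩ f] with w hw
    rw [hw]
    by_cases h : w ∈ Ω <;> simp [h]
  rw [h1, ← integral_add_left_eq_self _ x]
  simp

/-- Smoothing changes the solenoidal part of a field in `H¹₀(Ω)` little, in the interior. -/
theorem IsCutoff.setLIntegral_sub_kernelOp_le {Ω : Set E3} {χ : E3 → ℝ} {L δ : ℝ}
    (hχ : IsCutoff Ω χ L δ) (hL : 0 ≤ L)
    (hΩ : MeasurableSet Ω) {z : L2V Ω} {g : Fin 3 → L2V Ω} (hz : HasH10Grad Ω z g) {K : Set E3}
    (hK : MeasurableSet K) (hKΩ : K ⊆ Ω) (hχK : ∀ x ∈ K, χ x = 1) {ζ : E3 → ℝ} {r : ℝ}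
    (hζ : IsKernel ζ r) (hr : r ≤ δ) :
    ∫⁻ x in K, ‖lerayP Ω z x - kernelOp Ω (fun _ => 0) ζ (lerayP Ω z) x‖ₑ ^ 2 ≤
      ENNReal.ofReal (6 * (1 + L) * r * ‖z‖ * (‖z‖ + ∑ i, ‖g i‖)) := by
  set f := lerayP Ω z with hf
  have hS0 : 0 ≤ ∑ i, ‖g i‖ := Finset.sum_nonneg fun i _ => norm_nonneg _
  have hFm : StronglyMeasurable (extendZero hΩ f) := Lp.stronglyMeasurable _
  have hζc := hζ.contDiff.continuous
  have hζn : Integrable fun y => ζ (-y) := hζ.integrable.comp_neg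
  have hζ1 : ∫ y, ζ (-y) = 1 := by rw [integral_neg_eq_self ζ, hζ.integral_eq]
  have hζe : ∫⁻ y, ‖ζ (-y)‖ₑ = 1 := by
    rw [← ofReal_integral_norm_eq_lintegral_enorm hζn]
    simp only [Real.norm_of_nonneg (hζ.nonneg _), hζ1, ENNReal.ofReal_one]
  have hpt : ∀ x, ‖extendZero hΩ f x - kernelOp Ω (fun _ => 0) ζ f x‖ₑ ^ 2 ≤
      ∫⁻ y, ‖ζ (-y)‖ₑ * ‖extendZero hΩ f (x + y) - extendZero hΩ f x‖ₑ ^ 2 := by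
    intro x
    have hi : Integrable fun y => ζ (-y) • extendZero hΩ f (x + y) := by
      have h1 := integrable_kernel_smul (Ω := univ) lipschitzWith_zero_half hζc hζ.compact
        (f := extendZero hΩ f) (by rw [Measure.restrict_univ]; exact Lp.memLp _) x
      rw [Measure.restrict_univ] at h1
      simpa using h1.comp_add_left x
    have h1 : extendZero hΩ f x - kernelOp Ω (fun _ => 0) ζ f x =
        -∫ y, ζ (-y) • (extendZero hΩ f (x + y) - extendZero hΩ f x) := by
      simp only [smul_sub]
      rw [kernelOp_zero_eq hΩ, integral_sub hi (hζn.smul_const _), integral_smul_const, hζ1,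
        one_smul, neg_sub]
    rw [h1, enorm_neg]
    have h2 : ‖∫ y, ζ (-y) • (extendZero hΩ f (x + y) - extendZero hΩ f x)‖ₑ ≤
        ∫⁻ y, ‖ζ (-y)‖ₑ * ‖extendZero hΩ f (x + y) - extendZero hΩ f x‖ₑ := by
      refine (enorm_integral_le_lintegral_enorm _).trans_eq ?_
      simp only [enorm_smul]
    have hm1 : Measurable fun y => extendZero hΩ f (x + y) - extendZero hΩ f x :=
      (hFm.measurable.comp (measurable_const_add x)).sub measurable_const
    refine (pow_le_pow_left' h2 2).trans ((sq_lintegral_weight_mul_le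
      (Continuous.measurable (by fun_prop)).aemeasurable hm1.enorm.aemeasurable).trans ?_)
    rw [hζe, one_mul]
  have hm : Measurable fun p : E3 × E3 =>
      ‖ζ (-p.2)‖ₑ * ‖extendZero hΩ f (p.1 + p.2) - extendZero hΩ f p.1‖ₑ ^ 2 := by
    have h1 : Continuous fun p : E3 × E3 => ζ (-p.2) := by fun_prop
    have h2 : Measurable fun p : E3 × E3 => extendZero hΩ f (p.1 + p.2) - extendZero hΩ f p.1 :=
      (hFm.measurable.comp (by fun_prop)).sub (hFm.measurable.comp measurable_fst)
    exact h1.enorm.measurable.mul (h2.enorm.pow_const 2)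
  have hmy : ∀ y, Measurable fun x => ‖extendZero hΩ f (x + y) - extendZero hΩ f x‖ₑ ^ 2 := by
    intro y
    exact ((hFm.measurable.comp (measurable_add_const y)).sub hFm.measurable).enorm.pow_const 2
  calc _ = ∫⁻ x in K, ‖extendZero hΩ f x - kernelOp Ω (fun _ => 0) ζ f x‖ₑ ^ 2 := by
        refine lintegral_congr_ae ?_
        filter_upwards [ae_restrict_of_ae (extendZero_coeFn hΩ f), ae_restrict_mem hK] with x h1 h2
        rw [h1, indicator_of_mem (hKΩ h2)]
    _ ≤ ∫⁻ x in K, ∫⁻ y, ‖ζ (-y)‖ₑ * ‖extendZero hΩ f (x + y) - extendZero hΩ f x‖ₑ ^ 2 :=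
        lintegral_mono hpt
    _ = ∫⁻ y, ‖ζ (-y)‖ₑ * ∫⁻ x in K, ‖extendZero hΩ f (x + y) - extendZero hΩ f x‖ₑ ^ 2 := by
        rw [lintegral_lintegral_swap hm.aemeasurable]
        refine lintegral_congr fun y => ?_
        rw [lintegral_const_mul _ (hmy y)]
    _ ≤ ∫⁻ y, ‖ζ (-y)‖ₑ * ENNReal.ofReal (6 * (1 + L) * r * ‖z‖ * (‖z‖ + ∑ i, ‖g i‖)) := by
        refine lintegral_mono fun y => ?_
        by_cases hy : ζ (-y) = 0
        · simp [hy]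
        have hyr : ‖y‖ ≤ r := by simpa using hζ.norm_le hy
        gcongr
        refine (hχ.setLIntegral_increment_le hL hΩ hz hK hχK (hyr.trans hr)).trans ?_
        refine ENNReal.ofReal_le_ofReal ?_
        gcongr
    _ = _ := by
        rw [lintegral_mul_const _ (Continuous.measurable (by fun_prop)), hζe, one_mul]

theorem lintegral_kernelOp_zero_le {Ω K : Set E3} {ζ : E3 → ℝ} {r : ℝ} (hζ : IsKernel ζ r)
    (f : L2V Ω) : ∫⁻ x in K, ‖kernelOp Ω (fun _ => 0) ζ f x‖ₑ ^ 2 ≤ ENNReal.ofReal (3 * ‖f‖) ^ 2 := by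
  refine (lintegral_mono' Measure.restrict_le_self le_rfl).trans
    ((lintegral_kernelOp_sq_le lipschitzWith_zero_half hζ.contDiff.continuous
      (Lp.aestronglyMeasurable f)).trans ?_)
  rw [hζ.lintegral_eq, one_pow, mul_one, ← Lp_enorm_sq, ENNReal.ofReal_mul (by norm_num), mul_pow,
    ofReal_norm, ENNReal.ofReal_ofNat]
  gcongr
  norm_num

theorem memLp_kernelOp_zero {Ω : Set E3} (K : Set E3) {ζ : E3 → ℝ} {r : ℝ} (hζ : IsKernel ζ r)
    (f : L2V Ω) : MemLp (kernelOp Ω (fun _ => 0) ζ f) 2 (volume.restrict K) :=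
  (memLp_kernelOp lipschitzWith_zero_half hζ.contDiff hζ.compact (Lp.memLp f)).restrict K

/-- The convolution with the kernel `ζ`, followed by the restriction to `K`. -/
def smoothing (Ω K : Set E3) {ζ : E3 → ℝ} {r : ℝ} (hζ : IsKernel ζ r) :
    L2V Ω →L[ℝ] Lp E3 2 (volume.restrict K) :=
  LinearMap.mkContinuous
    { toFun := fun f => (memLp_kernelOp_zero K hζ f).toLp _
      map_add' := fun f g => by
        rw [← MemLp.toLp_add, MemLp.toLp_eq_toLp_iff]
        refine Eventually.of_forall fun x => ?_
        have hi := fun f : L2V Ω => integrable_kernel_smul lipschitzWith_zero_half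
          hζ.contDiff.continuous hζ.compact (Lp.memLp f) x
        rw [Pi.add_apply, kernelOp, kernelOp, kernelOp, ← integral_add (hi f) (hi g)]
        refine integral_congr_ae ?_
        filter_upwards [Lp.coeFn_add f g] with y hy
        rw [hy, Pi.add_apply, smul_add]
      map_smul' := fun c f => by
        rw [RingHom.id_apply, ← MemLp.toLp_const_smul, MemLp.toLp_eq_toLp_iff]
        refine Eventually.of_forall fun x => ?_
        rw [Pi.smul_apply, kernelOp, kernelOp, ← integral_smul]
        refine integral_congr_ae ?_
        filter_upwards [Lp.coeFn_smul c f] with y hy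
        rw [hy, Pi.smul_apply, smul_comm] } 3 fun f =>
    norm_toLp_le_of_lintegral (memLp_kernelOp_zero K hζ f) (by positivity)
      (lintegral_kernelOp_zero_le hζ f)

theorem smoothing_coeFn (Ω K : Set E3) {ζ : E3 → ℝ} {r : ℝ} (hζ : IsKernel ζ r) (f : L2V Ω) :
    smoothing Ω K hζ f =ᵐ[volume.restrict K] kernelOp Ω (fun _ => 0) ζ f :=
  MemLp.coeFn_toLp (memLp_kernelOp_zero K hζ f)

/-- Smoothing and restriction to a compact set is a compact operator: it sends bounded weakly null
sequences to strongly null ones. -/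
theorem tendsto_smoothing {Ω K : Set E3} (hK : IsCompact K) {ζ : E3 → ℝ} {r : ℝ}
    (hζ : IsKernel ζ r) {f : ℕ → L2V Ω} {M : ℝ} (hM : ∀ n, ‖f n‖ ≤ M)
    (hf : ∀ y : L2V Ω, Tendsto (fun n => inner ℝ (f n) y) atTop (𝓝 0)) :
    Tendsto (fun n => ‖smoothing Ω K hζ (f n)‖ₑ ^ 2) atTop (𝓝 0) := by
  have hζc := hζ.contDiff.continuous
  have hζ2 : ∫⁻ x, ‖ζ x‖ₑ ^ 2 < ⊤ :=
    (hζc.memLp_of_hasCompactSupport hζ.compact (p := 2) (μ := volume)).lintegral_sq_lt_top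
  have hpt : ∀ x, Tendsto (fun n => kernelOp Ω (fun _ => 0) ζ (f n) x) atTop (𝓝 0) := by
    intro x
    have hk : ∀ e : E3, MemLp (fun w => ζ (x - w) • e) 2 (volume.restrict Ω) := by
      intro e
      refine MemLp.restrict Ω (Continuous.memLp_of_hasCompactSupport (by fun_prop) ?_)
      have h1 : HasCompactSupport fun w => ζ (x - w) :=
        hζ.compact.comp_homeomorph (Homeomorph.subLeft x)
      exact h1.smul_right
    have he : ∀ (n : ℕ) (e : E3), inner ℝ (kernelOp Ω (fun _ => 0) ζ (f n) x) e =
        inner ℝ (f n) ((hk e).toLp _) := by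
      intro n e
      rw [inner_toLp_eq, kernelOp, real_inner_comm, ← integral_inner
        (integrable_kernel_smul lipschitzWith_zero_half hζc hζ.compact (Lp.memLp (f n)) x)]
      refine integral_congr_ae (Eventually.of_forall fun w => ?_)
      simp only [add_zero]
      rw [real_inner_smul_right, real_inner_smul_right, real_inner_comm]
    have hsum : ∀ v : E3, v = ∑ i, inner ℝ v (e3 i) • e3 i := by
      intro v
      ext j
      fin_cases j <;> simp [Fin.sum_univ_three, EuclideanSpace.inner_single_right]
    have h1 : Tendsto (fun n => ∑ i, inner ℝ (kernelOp Ω (fun _ => 0) ζ (f n) x) (e3 i) • e3 i)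
        atTop (𝓝 (∑ i, (0 : ℝ) • e3 i)) := by
      refine tendsto_finsetSum _ fun i _ => Tendsto.smul_const ?_ _
      simp only [he]
      exact hf _
    simp only [zero_smul, Finset.sum_const_zero] at h1
    exact h1.congr fun n => (hsum _).symm
  have hlim := tendsto_lintegral_of_dominated_convergence (μ := volume.restrict K)
    (F := fun n x => ‖kernelOp Ω (fun _ => 0) ζ (f n) x‖ₑ ^ 2) (f := fun _ => 0)
    (fun _ => 8 * (∫⁻ x, ‖ζ x‖ₑ ^ 2) * ENNReal.ofReal M ^ 2) ?_ ?_ ?_ ?_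
  · rw [lintegral_zero] at hlim
    refine hlim.congr fun n => ?_
    rw [Lp_enorm_sq]
    refine lintegral_congr_ae ?_
    filter_upwards [smoothing_coeFn Ω K hζ (f n)] with x hx
    rw [hx]
  · intro n
    exact ((contDiff_kernelOp lipschitzWith_zero_half hζ.contDiff hζ.compact
      (Lp.memLp (f n))).continuous.enorm.measurable.pow_const 2)
  · intro n
    refine Eventually.of_forall fun x => ?_
    refine (enorm_kernelOp_sq_le lipschitzWith_zero_half hζc (Lp.aestronglyMeasurable (f n)) x).trans ?_
    rw [← Lp_enorm_sq, ← ofReal_norm]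
    dsimp only
    gcongr
    exact hM n
  · rw [lintegral_const]
    refine ENNReal.mul_ne_top (ENNReal.mul_ne_top (ENNReal.mul_ne_top (by simp) hζ2.ne)
      (by simp)) ?_
    rw [Measure.restrict_apply_univ]
    exact hK.measure_lt_top.ne
  · refine Eventually.of_forall fun x => ?_
    have h1 := ENNReal.Tendsto.pow (n := 2) (hpt x).enorm
    simpa using h1

/-! ### Weak convergence in `L²(0,T;H)` -/

/-- A bounded sequence in a separable Hilbert space has a weakly convergent subsequence. -/
theorem exists_weakly_tendsto_subseq {X : Type*} [NormedAddCommGroup X] [InnerProductSpace ℝ X]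
    [CompleteSpace X] [TopologicalSpace.SeparableSpace X] {x : ℕ → X} {M : ℝ}
    (hM : ∀ n, ‖x n‖ ≤ M) :
    ∃ (a : X) (k : ℕ → ℕ), StrictMono k ∧
      ∀ y, Tendsto (fun n => inner ℝ (x (k n)) y) atTop (𝓝 (inner ℝ a y)) := by
  have h := WeakDual.isSeqCompact_closedBall (𝕜 := ℝ) (E := X) 0 M
  obtain ⟨b, -, k, hk, hlim⟩ := h (x := fun n => StrongDual.toWeakDual
    (InnerProductSpace.toDual ℝ X (x n))) fun n => by
      simpa using hM n
  refine ⟨(InnerProductSpace.toDual ℝ X).symm (WeakDual.toStrongDual b), k, hk, fun y => ?_⟩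
  have h1 := (WeakDual.eval_continuous (𝕜 := ℝ) y).tendsto b |>.comp hlim
  simpa [Function.comp_def] using h1

theorem ae_eq_zero_of_integral_norm_sq {E : Type*} [NormedAddCommGroup E] {μ : Measure ℝ} {f : ℝ → E}
    (hf : MemLp f 2 μ)
    (h : ∫ t, ‖f t‖ ^ 2 ∂μ = 0) : ∀ᵐ t ∂μ, f t = 0 := by
  rw [integral_eq_zero_iff_of_nonneg (fun t => sq_nonneg _)
    (hf.integrable_norm_pow two_ne_zero)] at h
  filter_upwards [h] with t ht
  exact norm_eq_zero.1 (pow_eq_zero_iff two_ne_zero |>.1 ht)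

/-- Weak convergence in `L²(0,T;H)`. -/
def TendstoWeakly {H : Type*} [NormedAddCommGroup H] [InnerProductSpace ℝ H] (T : ℝ)
    (f : ℕ → ℝ → H) (a : ℝ → H) : Prop :=
  ∀ Φ : ℝ → H, MemLp Φ 2 (volume.restrict (Ioo 0 T)) →
    Tendsto (fun n => ∫ t in Ioo 0 T, inner ℝ (f n t) (Φ t)) atTop
      (𝓝 (∫ t in Ioo 0 T, inner ℝ (a t) (Φ t)))

section

variable {H : Type*} [NormedAddCommGroup H] [InnerProductSpace ℝ H] {T : ℝ}

theorem exists_tendstoWeakly_subseq [CompleteSpace H] [SecondCountableTopology H]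
    {f : ℕ → ℝ → H} (hf : ∀ n, MemLp (f n) 2 (volume.restrict (Ioo 0 T))) {B : ℝ} (hB : 0 ≤ B)
    (hfB : ∀ n, ∫⁻ t in Ioo 0 T, ‖f n t‖ₑ ^ 2 ≤ ENNReal.ofReal B ^ 2) :
    ∃ (a : ℝ → H) (k : ℕ → ℕ), MemLp a 2 (volume.restrict (Ioo 0 T)) ∧ StrictMono k ∧
      TendstoWeakly T (fun n => f (k n)) a := by
  have : Fact ((2 : ℝ≥0∞) ≠ ⊤) := ⟨by simp⟩
  obtain ⟨a, k, hk, hlim⟩ := exists_weakly_tendsto_subseq (x := fun n => (hf n).toLp (f n))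
    fun n => norm_toLp_le_of_lintegral (hf n) hB (hfB n)
  refine ⟨a, k, Lp.memLp a, hk, fun Φ hΦ => ?_⟩
  have h := hlim (hΦ.toLp Φ)
  simp only [inner_toLp_eq] at h
  refine h.congr fun n => integral_congr_ae ?_
  filter_upwards [(hf (k n)).coeFn_toLp] with t ht
  rw [ht]

theorem TendstoWeakly.clm {H' : Type*} [NormedAddCommGroup H'] [InnerProductSpace ℝ H']
    [CompleteSpace H] [CompleteSpace H'] {f : ℕ → ℝ → H} {a : ℝ → H} (h : TendstoWeakly T f a)
    (A : H →L[ℝ] H') : TendstoWeakly T (fun n t => A (f n t)) fun t => A (a t) := by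
  intro Φ hΦ
  have h1 := h _ (A.adjoint.comp_memLp' hΦ)
  simpa only [Function.comp_def, ContinuousLinearMap.adjoint_inner_right] using h1

theorem TendstoWeakly.sub_const {f : ℕ → ℝ → H} {a : ℝ → H} (h : TendstoWeakly T f a)
    (hf : ∀ n, MemLp (f n) 2 (volume.restrict (Ioo 0 T)))
    (ha : MemLp a 2 (volume.restrict (Ioo 0 T))) :
    TendstoWeakly T (fun n t => f n t - a t) fun _ => 0 := by
  intro Φ hΦ
  have h1 := (h Φ hΦ).sub_const (∫ t in Ioo 0 T, inner ℝ (a t) (Φ t))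
  rw [sub_self] at h1
  simp only [inner_zero_left, integral_zero]
  refine h1.congr fun n => ?_
  simp only [inner_sub_left]
  exact (integral_sub (integrable_inner_of_memLp (hf n) hΦ) (integrable_inner_of_memLp ha hΦ)).symm

theorem TendstoWeakly.congr_limit {f : ℕ → ℝ → H} {a b : ℝ → H} (h : TendstoWeakly T f a)
    (hab : a =ᵐ[volume.restrict (Ioo 0 T)] b) : TendstoWeakly T f b := by
  intro Φ hΦ
  have h1 : ∫ t in Ioo 0 T, inner ℝ (a t) (Φ t) = ∫ t in Ioo 0 T, inner ℝ (b t) (Φ t) :=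
    integral_congr_ae (hab.mono fun t ht => by simp only [ht])
  rw [← h1]
  exact h Φ hΦ

theorem TendstoWeakly.unique {f : ℕ → ℝ → H} {a b : ℝ → H} (h : TendstoWeakly T f a)
    (h' : TendstoWeakly T f b) (ha : MemLp a 2 (volume.restrict (Ioo 0 T)))
    (hb : MemLp b 2 (volume.restrict (Ioo 0 T))) : a =ᵐ[volume.restrict (Ioo 0 T)] b := by
  have hab := ha.sub hb
  have h1 := tendsto_nhds_unique (h _ hab) (h' _ hab)
  have h2 : ∫ t in Ioo 0 T, ‖(a - b) t‖ ^ 2 = 0 := by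
    refine Eq.trans ?_ (sub_eq_zero.2 h1)
    rw [← integral_sub (integrable_inner_of_memLp ha hab) (integrable_inner_of_memLp hb hab)]
    congr 1
    ext t
    rw [← inner_sub_left, Pi.sub_apply, real_inner_self_eq_norm_sq]
  filter_upwards [ae_eq_zero_of_integral_norm_sq hab h2] with t ht
  exact sub_eq_zero.1 ht

/-- A closed subspace is weakly closed. -/
theorem TendstoWeakly.ae_mem [CompleteSpace H] {f : ℕ → ℝ → H} {a : ℝ → H}
    (h : TendstoWeakly T f a) (ha : MemLp a 2 (volume.restrict (Ioo 0 T))) (S : Submodule ℝ H)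
    (hS : IsClosed (S : Set H)) (hf : ∀ n, ∀ᵐ t ∂(volume.restrict (Ioo 0 T)), f n t ∈ S) :
    ∀ᵐ t ∂(volume.restrict (Ioo 0 T)), a t ∈ S := by
  have : CompleteSpace S := hS.completeSpace_coe
  have hπ : MemLp (fun t => S.starProjection (a t)) 2 (volume.restrict (Ioo 0 T)) :=
    S.starProjection.comp_memLp' ha
  have hΦ := ha.sub hπ
  have horth : ∀ x ∈ S, ∀ z : H, inner ℝ x (z - S.starProjection z) = 0 := fun x hx z =>
    Submodule.sub_starProjection_mem_orthogonal z x hx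
  have h1 : ∫ t in Ioo 0 T, inner ℝ (a t) (a t - S.starProjection (a t)) = 0 := by
    refine tendsto_nhds_unique (h _ hΦ) (tendsto_const_nhds.congr fun n => ?_)
    refine (integral_eq_zero_of_ae ?_).symm
    filter_upwards [hf n] with t ht
    exact horth _ ht _
  have h2 : ∫ t in Ioo 0 T, ‖(a - fun t => S.starProjection (a t)) t‖ ^ 2 = 0 := by
    refine Eq.trans ?_ h1
    congr 1
    ext t
    rw [Pi.sub_apply, ← real_inner_self_eq_norm_sq, inner_sub_left,
      horth _ (Submodule.starProjection_apply_mem S (a t)), sub_zero]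
  filter_upwards [ae_eq_zero_of_integral_norm_sq hΦ h2] with t ht
  rw [sub_eq_zero.1 ht]
  exact Submodule.starProjection_apply_mem S (a t)

/-- A uniform bound in `L^∞` passes to the weak limit `a`: the test function is `a` on the set
where the bound fails. -/
theorem TendstoWeakly.ae_norm_le {f : ℕ → ℝ → H} {a : ℝ → H}
    (h : TendstoWeakly T f a) (hm : ∀ n, MemLp (f n) 2 (volume.restrict (Ioo 0 T)))
    (ha : MemLp a 2 (volume.restrict (Ioo 0 T))) {M : ℝ}
    (hf : ∀ n, ∀ᵐ t ∂(volume.restrict (Ioo 0 T)), ‖f n t‖ ≤ M) :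
    ∀ᵐ t ∂(volume.restrict (Ioo 0 T)), ‖a t‖ ≤ M := by
  set b := ha.1.mk a with hb
  have hab : a =ᵐ[volume.restrict (Ioo 0 T)] b := ha.1.ae_eq_mk
  have hbm : StronglyMeasurable b := ha.1.stronglyMeasurable_mk
  have hbL : MemLp b 2 (volume.restrict (Ioo 0 T)) := ha.ae_eq hab
  have hA : MeasurableSet {t | M < ‖b t‖} := measurableSet_lt measurable_const hbm.norm.measurable
  set A := {t | M < ‖b t‖}
  have hΦ : MemLp (A.indicator b) 2 (volume.restrict (Ioo 0 T)) := hbL.indicator hA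
  have hn : Integrable (fun t => ‖A.indicator b t‖) (volume.restrict (Ioo 0 T)) :=
    (hΦ.integrable (by norm_num)).norm
  have hn2 := hΦ.integrable_norm_pow (p := 2) two_ne_zero
  have h1 : ∫ t in Ioo 0 T, ‖A.indicator b t‖ ^ 2 ≤ ∫ t in Ioo 0 T, M * ‖A.indicator b t‖ := by
    have h2 := (h.congr_limit hab) _ hΦ
    have h3 : ∫ t in Ioo 0 T, inner ℝ (b t) (A.indicator b t) =
        ∫ t in Ioo 0 T, ‖A.indicator b t‖ ^ 2 := by
      congr 1
      ext t
      by_cases ht : t ∈ A <;> simp [ht]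
    rw [h3] at h2
    refine le_of_tendsto h2 (Eventually.of_forall fun n => ?_)
    refine integral_mono_ae (integrable_inner_of_memLp (hm n) hΦ) (hn.const_mul M) ?_
    filter_upwards [hf n] with t ht
    exact (real_inner_le_norm _ _).trans (by gcongr)
  have h4 : ∫ t in Ioo 0 T, (‖A.indicator b t‖ ^ 2 - M * ‖A.indicator b t‖) = 0 := by
    refine le_antisymm ?_ (integral_nonneg fun t => ?_)
    · rw [integral_sub hn2 (hn.const_mul M)]
      exact sub_nonpos.2 h1
    · by_cases ht : t ∈ A
      · have : M < ‖b t‖ := ht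
        simp only [ht, indicator_of_mem, Pi.zero_apply]
        nlinarith [norm_nonneg (b t)]
      · simp [ht]
  have hint : Integrable (fun t => ‖A.indicator b t‖ ^ 2 - M * ‖A.indicator b t‖)
    (volume.restrict (Ioo 0 T)) := hn2.sub (hn.const_mul M)
  rw [integral_eq_zero_iff_of_nonneg ?_ hint] at h4
  · filter_upwards [h4, hab, hf 0] with t h5 h6 h7
    rw [h6]
    by_contra! h8
    have ht : t ∈ A := h8
    simp only [ht, indicator_of_mem, Pi.zero_apply] at h5
    have hM0 : 0 ≤ M := (norm_nonneg _).trans h7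
    nlinarith
  · intro t
    by_cases ht : t ∈ A
    · have : M < ‖b t‖ := ht
      simp only [ht, indicator_of_mem, Pi.zero_apply]
      nlinarith [norm_nonneg (b t)]
    · simp [ht]

end

/-! ### Weak compactness of the energy class -/

/-- The pairs `(φ, ∇φ)` with a test field `φ ∈ C_c^∞(Ω; ℝ³)`. -/
def testPairs (Ω : Set E3) : Submodule ℝ (L2V Ω × (Fin 3 → L2V Ω)) where
  carrier := {q : L2V Ω × (Fin 3 → L2V Ω) |
    ∃ φ : E3 → E3, ContDiff ℝ ∞ φ ∧ HasCompactSupport φ ∧ tsupport φ ⊆ Ω ∧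
      (q.1 : E3 → E3) =ᵐ[volume.restrict Ω] φ ∧
      ∀ i, (q.2 i : E3 → E3) =ᵐ[volume.restrict Ω] fun x => fderiv ℝ φ x (e3 i)}
  add_mem' := by
    rintro ⟨z, g⟩ ⟨z', g'⟩ ⟨φ, h1, h2, h3, h4, h5⟩ ⟨ψ, k1, k2, k3, k4, k5⟩
    refine ⟨fun x => φ x + ψ x, h1.add k1, h2.add k2,
      (tsupport_add φ ψ).trans (union_subset h3 k3), ?_, fun i => ?_⟩
    · filter_upwards [Lp.coeFn_add z z', h4, k4] with x e1 e2 e3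
      dsimp only [Prod.mk_add_mk] at *
      rw [e1, Pi.add_apply, e2, e3]
    · filter_upwards [Lp.coeFn_add (g i) (g' i), h5 i, k5 i] with x e1 e2 e3
      dsimp only [Prod.mk_add_mk, Pi.add_apply] at *
      rw [e1, e2, e3,
        fderiv_fun_add (h1.differentiable (by simp) x) (k1.differentiable (by simp) x)]
      rfl
  zero_mem' := by
    refine ⟨fun _ => 0, contDiff_const, HasCompactSupport.zero, ?_, ?_, fun i => ?_⟩
    · have : tsupport (fun _ : E3 => (0 : E3)) = ∅ := by
        rw [tsupport_eq_empty_iff]; rfl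
      rw [this]
      exact empty_subset _
    · filter_upwards [Lp.coeFn_zero E3 2 (volume.restrict Ω)] with x hx
      dsimp only [Prod.fst_zero] at *
      rw [hx]
      rfl
    · filter_upwards [Lp.coeFn_zero E3 2 (volume.restrict Ω)] with x hx
      dsimp only [Prod.snd_zero, Pi.zero_apply] at *
      rw [hx]
      simp
  smul_mem' := by
    rintro c ⟨z, g⟩ ⟨φ, h1, h2, h3, h4, h5⟩
    have hsub : Function.support (fun x => c • φ x) ⊆ Function.support φ := fun x hx h0 => hx <| by
      dsimp only
      rw [h0, smul_zero]
    refine ⟨fun x => c • φ x, h1.const_smul c, h2.mono hsub, (closure_mono hsub).trans h3, ?_,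
      fun i => ?_⟩
    · filter_upwards [Lp.coeFn_smul c z, h4] with x e1 e2
      dsimp only [Prod.smul_mk] at *
      rw [e1, Pi.smul_apply, e2]
    · filter_upwards [Lp.coeFn_smul c (g i), h5 i] with x e1 e2
      dsimp only [Prod.smul_mk, Pi.smul_apply] at *
      rw [e1, e2, fderiv_fun_const_smul (h1.differentiable (by simp) x)]
      rfl

theorem hasH10Grad_iff {Ω : Set E3} {z : L2V Ω} {g : Fin 3 → L2V Ω} :
    HasH10Grad Ω z g ↔ (z, g) ∈ (testPairs Ω).topologicalClosure := Iff.rfl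

theorem HasH10Grad.sub {Ω : Set E3} {z z' : L2V Ω} {g g' : Fin 3 → L2V Ω}
    (h : HasH10Grad Ω z g) (h' : HasH10Grad Ω z' g') :
    HasH10Grad Ω (z - z') (fun i => g i - g' i) :=
  hasH10Grad_iff.2 ((testPairs Ω).topologicalClosure.sub_mem h h')

/-- The Hilbert space in which the pairs `(u, ∇u)` take their values. -/
abbrev PairSpace (Ω : Set E3) : Type := PiLp 2 fun _ : Option (Fin 3) => L2V Ω

theorem secondCountableTopology_pairSpace (Ω : Set E3) :
    SecondCountableTopology (PairSpace Ω) := by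
  have : Fact ((2 : ℝ≥0∞) ≠ ⊤) := ⟨by simp⟩
  have h : SecondCountableTopology (L2V Ω) := inferInstance
  exact (PiLp.continuousLinearEquiv 2 ℝ
    fun _ : Option (Fin 3) => L2V Ω).toHomeomorph.secondCountableTopology

/-- The pair of a field and its partial derivatives, as an element of the Hilbert space. -/
def pairOf {Ω : Set E3} (z : L2V Ω) (g : Fin 3 → L2V Ω) : PairSpace Ω :=
  WithLp.toLp 2 fun o => o.elim z g

/-- The closed subspace of the pairs `(u, ∇u)` with `u ∈ H¹₀(Ω; ℝ³)`. -/
def h10Pairs (Ω : Set E3) : Submodule ℝ (PairSpace Ω) :=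
  (testPairs Ω).topologicalClosure.comap
    ((PiLp.proj 2 (fun _ : Option (Fin 3) => L2V Ω) none : PairSpace Ω →L[ℝ] L2V Ω).prod
      (ContinuousLinearMap.pi fun i : Fin 3 =>
        (PiLp.proj 2 (fun _ : Option (Fin 3) => L2V Ω) (some i) : PairSpace Ω →L[ℝ] L2V Ω))).toLinearMap

theorem mem_h10Pairs {Ω : Set E3} {y : PairSpace Ω} :
    y ∈ h10Pairs Ω ↔ HasH10Grad Ω (y none) fun i => y (some i) := Iff.rfl

theorem isClosed_h10Pairs (Ω : Set E3) : IsClosed (h10Pairs Ω : Set (PairSpace Ω)) :=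
  (testPairs Ω).isClosed_topologicalClosure.preimage
    ((PiLp.proj 2 (fun _ : Option (Fin 3) => L2V Ω) none : PairSpace Ω →L[ℝ] L2V Ω).prod
      (ContinuousLinearMap.pi fun i : Fin 3 =>
        (PiLp.proj 2 (fun _ : Option (Fin 3) => L2V Ω) (some i) : PairSpace Ω →L[ℝ] L2V Ω))).continuous

theorem IsEnergyClass.memLp_two {Ω : Set E3} {T : ℝ} {u : ℝ → L2V Ω} {G : ℝ → Fin 3 → L2V Ω}
    (h : IsEnergyClass Ω T u G) : MemLp u 2 (volume.restrict (Ioo 0 T)) :=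
  h.memLp.mono_exponent le_top

theorem IsEnergyClass.memLp_pairOf {Ω : Set E3} {T : ℝ} {u : ℝ → L2V Ω} {G : ℝ → Fin 3 → L2V Ω}
    (h : IsEnergyClass Ω T u G) :
    MemLp (fun t => pairOf (u t) (G t)) 2 (volume.restrict (Ioo 0 T)) := by
  rw [memLp_piLp_iff]
  rintro (_ | i)
  · exact h.memLp_two
  · exact h.grad_memLp i

theorem enorm_pairOf_sq {Ω : Set E3} (z : L2V Ω) (g : Fin 3 → L2V Ω) :
    ‖pairOf z g‖ₑ ^ 2 = ENNReal.ofReal (‖z‖ ^ 2 + ∑ i, ‖g i‖ ^ 2) := by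
  rw [← ofReal_norm, ← ENNReal.ofReal_pow (norm_nonneg _), PiLp.norm_sq_eq_of_L2,
    Fintype.sum_option]
  rfl

/-- Bounded sequences in the energy class are weakly relatively compact, and the weak limits are
in the energy class: pairs `(u, ∇u)` form a closed subspace. -/
theorem exists_subseq_energyClass {Ω : Set E3} {T : ℝ} (hT : 0 < T) {u : ℕ → ℝ → L2V Ω}
    {G : ℕ → ℝ → Fin 3 → L2V Ω} (hen : ∀ n, IsEnergyClass Ω T (u n) (G n)) {M E : ℝ}
    (hM : ∀ n, ∀ᵐ t ∂(volume.restrict (Ioo 0 T)), ‖u n t‖ ≤ M)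
    (hE : ∀ n, ∫ t in Ioo 0 T, ∑ i, ‖G n t i‖ ^ 2 ≤ E) :
    ∃ k : ℕ → ℕ, StrictMono k ∧ ∃ (v : ℝ → L2V Ω) (H : ℝ → Fin 3 → L2V Ω),
      IsEnergyClass Ω T v H ∧ TendstoWeakly T (fun n => u (k n)) v ∧
      ∀ i, TendstoWeakly T (fun n t => G (k n) t i) fun t => H t i := by
  have hB : ∀ n, ∫⁻ t in Ioo 0 T, ‖pairOf (u n t) (G n t)‖ₑ ^ 2 ≤
      ENNReal.ofReal √(M ^ 2 * T + E) ^ 2 := by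
    intro n
    have hE0 : 0 ≤ E := (integral_nonneg fun t => by positivity).trans (hE n)
    have i2 : Integrable (fun t => ∑ i, ‖G n t i‖ ^ 2) (volume.restrict (Ioo 0 T)) :=
      integrable_finsetSum _ fun i _ => ((hen n).grad_memLp i).integrable_norm_pow two_ne_zero
    have i1 : Integrable (fun t => ‖u n t‖ ^ 2) (volume.restrict (Ioo 0 T)) :=
      (hen n).memLp_two.integrable_norm_pow two_ne_zero
    rw [← ENNReal.ofReal_pow (Real.sqrt_nonneg _), Real.sq_sqrt (by positivity)]
    simp only [enorm_pairOf_sq]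
    have i12 : Integrable (fun t => ‖u n t‖ ^ 2 + ∑ i, ‖G n t i‖ ^ 2) (volume.restrict (Ioo 0 T)) :=
      i1.add i2
    rw [← ofReal_integral_eq_lintegral_ofReal i12 (Eventually.of_forall fun t => by positivity)]
    refine ENNReal.ofReal_le_ofReal ?_
    refine (integral_add i1 i2).le.trans (add_le_add ?_ (hE n))
    calc ∫ t in Ioo 0 T, ‖u n t‖ ^ 2 ≤ ∫ t in Ioo 0 T, M ^ 2 := by
          refine integral_mono_ae i1 (integrable_const _) ?_
          filter_upwards [hM n] with t ht
          gcongr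
      _ = _ := by simp [hT.le, mul_comm]
  have := secondCountableTopology_pairSpace Ω
  obtain ⟨a, k, ha, hk, hlim⟩ := exists_tendstoWeakly_subseq (fun n => (hen n).memLp_pairOf)
    (Real.sqrt_nonneg _) hB
  have hproj := fun o : Option (Fin 3) => hlim.clm
    (PiLp.proj 2 (fun _ : Option (Fin 3) => L2V Ω) o : PairSpace Ω →L[ℝ] L2V Ω)
  have hmem := memLp_piLp_iff.1 ha
  have hu : TendstoWeakly T (fun n => u (k n)) fun t => a t none := hproj none
  refine ⟨k, hk, fun t => a t none, fun t i => a t (some i), ⟨?_, fun i => hmem (some i), ?_⟩, hu,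
    fun i => hproj (some i)⟩
  · exact memLp_top_of_bound (hmem none).1 M
      (hu.ae_norm_le (fun n => (hen _).memLp_two) (hmem none) fun n => hM _)
  · refine hlim.ae_mem ha (h10Pairs Ω) (isClosed_h10Pairs Ω) fun n => ?_
    filter_upwards [(hen (k n)).grad] with t ht
    exact mem_h10Pairs.2 ht

/-! ### Strong compactness from a time modulus and a compact operator -/

theorem enorm_clm_sq_le {H H' : Type*} [NormedAddCommGroup H] [NormedSpace ℝ H]
    [NormedAddCommGroup H'] [NormedSpace ℝ H'] (R : H →L[ℝ] H') (x : H) :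
    ‖R x‖ₑ ^ 2 ≤ ‖R‖ₑ ^ 2 * ‖x‖ₑ ^ 2 := by
  rw [← mul_pow]
  exact pow_le_pow_left' (R.le_opENorm x) 2

theorem integrableOn_shift {H : Type*} [NormedAddCommGroup H] {f : ℝ → H} (hf : StronglyMeasurable f) {M : ℝ}
    (hM : ∀ t, ‖f t‖ ≤ M) (h t : ℝ) : IntegrableOn (fun r => f (t + r)) (Ioo 0 h) :=
  Measure.integrableOn_of_bounded (M := M) (by simp)
    (hf.comp_measurable (measurable_const_add t)).aestronglyMeasurable
    (Eventually.of_forall fun r => hM _)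

section

variable {H : Type*} [NormedAddCommGroup H] [InnerProductSpace ℝ H]

/-- The mean of `f` over `(t, t + h)`. -/
def timeMean (f : ℝ → H) (h t : ℝ) : H := h⁻¹ • ∫ r in Ioo 0 h, f (t + r)

theorem norm_timeMean_le {f : ℝ → H} {M h : ℝ} (hh : 0 < h) (hM : ∀ t, ‖f t‖ ≤ M) (t : ℝ) :
    ‖timeMean f h t‖ ≤ M := by
  have h1 := norm_setIntegral_le_of_norm_le_const (μ := volume) (s := Ioo 0 h) (by simp)
    (fun r _ => hM (t + r))
  rw [timeMean, norm_smul, norm_inv, Real.norm_of_nonneg hh.le, inv_mul_le_iff₀ hh]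
  refine h1.trans_eq ?_
  simp [hh.le, mul_comm]

theorem stronglyMeasurable_timeMean {f : ℝ → H} (hf : StronglyMeasurable f) (h : ℝ) :
    StronglyMeasurable (timeMean f h) := by
  have h1 : StronglyMeasurable fun q : ℝ × ℝ => f (q.1 + q.2) :=
    hf.comp_measurable (by fun_prop)
  exact h1.integral_prod_right'.const_smul h⁻¹

variable [CompleteSpace H]

theorem inner_timeMean {f : ℝ → H} (hf : StronglyMeasurable f) {M h T t : ℝ}
    (hM : ∀ t, ‖f t‖ ≤ M) (ht : t ∈ Ioo 0 (T - h)) (y : H) :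
    inner ℝ (timeMean f h t) y =
      h⁻¹ * ∫ s in Ioo 0 T, inner ℝ (f s) ((Ioo t (t + h)).indicator (fun _ => y) s) := by
  rw [timeMean, real_inner_smul_left, real_inner_comm,
    ← integral_inner (integrableOn_shift hf hM h t)]
  congr 1
  have h1 : ∀ s, inner ℝ (f s) ((Ioo t (t + h)).indicator (fun _ => y) s) =
      (Ioo t (t + h)).indicator (fun s => inner ℝ (f s) y) s := by
    intro s
    by_cases hs : s ∈ Ioo t (t + h) <;> simp [hs]
  simp only [h1]
  rw [setIntegral_indicator measurableSet_Ioo,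
    inter_eq_right.2 (Ioo_subset_Ioo ht.1.le (by linarith [ht.2])),
    ← (measurePreserving_add_left volume t).setIntegral_preimage_emb
      (measurableEmbedding_addLeft t) _ (Ioo t (t + h))]
  have h2 : (fun r => t + r) ⁻¹' Ioo t (t + h) = Ioo 0 h := by
    ext r
    simp [mem_Ioo]
  rw [h2]
  refine integral_congr_ae (Eventually.of_forall fun r => ?_)
  exact real_inner_comm _ _

theorem enorm_sub_timeMean_sq_le {f : ℝ → H} (hf : StronglyMeasurable f) {M h : ℝ} (hh : 0 < h)
    (hM : ∀ t, ‖f t‖ ≤ M) (t : ℝ) :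
    ‖f t - timeMean f h t‖ₑ ^ 2 ≤
      ENNReal.ofReal h⁻¹ * ∫⁻ r in Ioo 0 h, ‖f (t + r) - f t‖ₑ ^ 2 := by
  have hi := integrableOn_shift hf hM h t
  have h1 : f t - timeMean f h t = -(h⁻¹ • ∫ r in Ioo 0 h, (f (t + r) - f t)) := by
    rw [integral_sub hi (integrable_const _), smul_sub, timeMean, setIntegral_const, smul_smul]
    simp [hh.le, hh.ne']
  have hm : Measurable fun r => ‖f (t + r) - f t‖ₑ :=
    ((hf.comp_measurable (measurable_const_add t)).sub stronglyMeasurable_const).enorm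
  have h2 : (∫⁻ r in Ioo 0 h, ‖f (t + r) - f t‖ₑ) ^ 2 ≤
      ENNReal.ofReal h * ∫⁻ r in Ioo 0 h, ‖f (t + r) - f t‖ₑ ^ 2 := by
    have := sq_lintegral_weight_mul_le (μ := volume.restrict (Ioo 0 h)) (k := fun _ => 1)
      aemeasurable_const hm.aemeasurable
    simpa using this
  have hhe : ENNReal.ofReal h⁻¹ ^ 2 * ENNReal.ofReal h = ENNReal.ofReal h⁻¹ := by
    rw [← ENNReal.ofReal_pow (by positivity), ← ENNReal.ofReal_mul (by positivity)]
    congr 1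
    field_simp
  rw [h1, enorm_neg, enorm_smul, mul_pow, ← ofReal_norm h⁻¹, Real.norm_of_nonneg (by positivity)]
  calc _ ≤ ENNReal.ofReal h⁻¹ ^ 2 *
        (ENNReal.ofReal h * ∫⁻ r in Ioo 0 h, ‖f (t + r) - f t‖ₑ ^ 2) := by
        gcongr
        exact (pow_le_pow_left' (enorm_integral_le_lintegral_enorm _) 2).trans h2
    _ = _ := by rw [← mul_assoc, hhe]

theorem lintegral_sub_timeMean_le {f : ℝ → H} (hf : StronglyMeasurable f) {M h T : ℝ} (hh : 0 < h)
    (hM : ∀ t, ‖f t‖ ≤ M) {η : ℝ≥0∞}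
    (hη : ∀ r ∈ Ioo 0 h, ∫⁻ t in Ioo 0 (T - r), ‖f (t + r) - f t‖ₑ ^ 2 ≤ η) :
    ∫⁻ t in Ioo 0 (T - h), ‖f t - timeMean f h t‖ₑ ^ 2 ≤ η := by
  have hm : Measurable fun q : ℝ × ℝ => ‖f (q.1 + q.2) - f q.1‖ₑ ^ 2 :=
    ((hf.comp_measurable (by fun_prop)).sub (hf.comp_measurable measurable_fst)).enorm.pow_const 2
  calc _ ≤ ∫⁻ t in Ioo 0 (T - h), ENNReal.ofReal h⁻¹ * ∫⁻ r in Ioo 0 h, ‖f (t + r) - f t‖ₑ ^ 2 :=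
        lintegral_mono fun t => enorm_sub_timeMean_sq_le hf hh hM t
    _ = ENNReal.ofReal h⁻¹ * ∫⁻ r in Ioo 0 h, ∫⁻ t in Ioo 0 (T - h), ‖f (t + r) - f t‖ₑ ^ 2 := by
        rw [lintegral_const_mul _ hm.lintegral_prod_right', lintegral_lintegral_swap hm.aemeasurable]
    _ ≤ ENNReal.ofReal h⁻¹ * ∫⁻ r in Ioo 0 h, η := by
        gcongr ENNReal.ofReal h⁻¹ * ?_
        refine setLIntegral_mono' measurableSet_Ioo fun r hr => ?_
        exact (lintegral_mono_set (Ioo_subset_Ioo_right (by linarith [hr.2]))).trans (hη r hr)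
    _ = _ := by
        rw [lintegral_const, Measure.restrict_apply_univ, Real.volume_Ioo, sub_zero, mul_comm η,
          ← mul_assoc, ← ENNReal.ofReal_mul (by positivity), inv_mul_cancel₀ hh.ne',
          ENNReal.ofReal_one, one_mul]

variable {H' : Type*} [NormedAddCommGroup H'] [NormedSpace ℝ H']

theorem enorm_add_sq_le {E : Type*} [SeminormedAddCommGroup E] (a b : E) :
    ‖a + b‖ₑ ^ 2 ≤ 2 * ‖a‖ₑ ^ 2 + 2 * ‖b‖ₑ ^ 2 := by
  simp only [← ofReal_norm, ← ENNReal.ofReal_pow (norm_nonneg _)]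
  rw [show (2 : ℝ≥0∞) = ENNReal.ofReal 2 by simp, ← ENNReal.ofReal_mul (by norm_num),
    ← ENNReal.ofReal_mul (by norm_num), ← ENNReal.ofReal_add (by positivity) (by positivity)]
  refine ENNReal.ofReal_le_ofReal ?_
  have h := norm_add_le a b
  have h2 := pow_le_pow_left₀ (norm_nonneg _) h 2
  nlinarith [sq_nonneg (‖a‖ - ‖b‖)]

/-- The means of a weakly null sequence are weakly null at each time, so a compact operator makes
them strongly null. -/
theorem tendsto_lintegral_timeMean {d : ℕ → ℝ → H} (hd : ∀ n, StronglyMeasurable (d n)) {M : ℝ}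
    (hM : ∀ n t, ‖d n t‖ ≤ M) {T h : ℝ} (hh : 0 < h) (hw : TendstoWeakly T d fun _ => 0)
    (R : H →L[ℝ] H')
    (hR : ∀ f : ℕ → H, (∀ n, ‖f n‖ ≤ M) → (∀ y, Tendsto (fun n => inner ℝ (f n) y) atTop (𝓝 0)) →
      Tendsto (fun n => ‖R (f n)‖ₑ ^ 2) atTop (𝓝 0)) :
    Tendsto (fun n => ∫⁻ t in Ioo 0 (T - h), ‖R (timeMean (d n) h t)‖ₑ ^ 2) atTop (𝓝 0) := by
  have hlim := tendsto_lintegral_of_dominated_convergence (μ := volume.restrict (Ioo 0 (T - h)))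
    (F := fun n t => ‖R (timeMean (d n) h t)‖ₑ ^ 2) (f := fun _ => 0)
    (fun _ => ‖R‖ₑ ^ 2 * ENNReal.ofReal M ^ 2) ?_ ?_ ?_ ?_
  · rwa [lintegral_zero] at hlim
  · intro n
    exact (R.continuous.comp_stronglyMeasurable
      (stronglyMeasurable_timeMean (hd n) h)).enorm.pow_const 2
  · intro n
    refine Eventually.of_forall fun t => (enorm_clm_sq_le R _).trans ?_
    rw [← ofReal_norm (timeMean (d n) h t)]
    dsimp only
    gcongr
    exact norm_timeMean_le hh (hM n) t
  · rw [lintegral_const]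
    refine ENNReal.mul_ne_top (ENNReal.mul_ne_top (by simp) (by simp)) (by simp)
  · filter_upwards [ae_restrict_mem measurableSet_Ioo] with t ht
    refine hR _ (fun n => norm_timeMean_le hh (hM n) t) fun y => ?_
    simp only [inner_timeMean (hd _) (hM _) ht]
    have h1 := hw ((Ioo t (t + h)).indicator fun _ => y)
      ((memLp_const y).indicator measurableSet_Ioo)
    simp only [inner_zero_left, integral_zero] at h1
    simpa using h1.const_mul h⁻¹

theorem tendsto_lintegral_of_weakly_null_of_bounded {d : ℕ → ℝ → H}
    (hd : ∀ n, StronglyMeasurable (d n)) {M : ℝ} (hM : ∀ n t, ‖d n t‖ ≤ M) {T : ℝ}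
    (hw : TendstoWeakly T d fun _ => 0)
    (hmod : ∀ η : ℝ≥0∞, 0 < η → ∃ h₀ : ℝ, 0 < h₀ ∧ ∀ n, ∀ r ∈ Ioo 0 h₀,
      ∫⁻ t in Ioo 0 (T - r), ‖d n (t + r) - d n t‖ₑ ^ 2 ≤ η)
    (R : H →L[ℝ] H')
    (hR : ∀ f : ℕ → H, (∀ n, ‖f n‖ ≤ M) → (∀ y, Tendsto (fun n => inner ℝ (f n) y) atTop (𝓝 0)) →
      Tendsto (fun n => ‖R (f n)‖ₑ ^ 2) atTop (𝓝 0)) :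
    Tendsto (fun n => ∫⁻ t in Ioo 0 T, ‖R (d n t)‖ₑ ^ 2) atTop (𝓝 0) := by
  rw [ENNReal.tendsto_nhds_zero]
  intro ε hε
  have hε3 : 0 < ε / 3 := ENNReal.div_pos hε.ne' (by simp)
  set c : ℝ≥0∞ := ‖R‖ₑ ^ 2 with hc
  have hctop : c ≠ ⊤ := by simp [hc]
  obtain ⟨η, hηε, hη⟩ : ∃ η : ℝ≥0∞, 2 * c * η ≤ ε / 3 ∧ 0 < η := by
    have h1 : Tendsto (fun η : ℝ≥0∞ => 2 * c * η) (𝓝[>] 0) (𝓝 (2 * c * 0)) :=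
      (ENNReal.Tendsto.const_mul tendsto_id
        (Or.inr (ENNReal.mul_ne_top (by simp) hctop))).mono_left nhdsWithin_le_nhds
    rw [mul_zero] at h1
    exact ((h1.eventually_le_const hε3).and self_mem_nhdsWithin).exists
  obtain ⟨h₀, hh₀, hmodη⟩ := hmod η hη
  obtain ⟨h, hhε, hh⟩ : ∃ h : ℝ, c * ENNReal.ofReal M ^ 2 * ENNReal.ofReal h ≤ ε / 3 ∧
      h ∈ Ioo 0 h₀ := by
    have h0 : Tendsto (fun h : ℝ => ENNReal.ofReal h) (𝓝[>] 0) (𝓝 0) := by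
      have := (ENNReal.continuous_ofReal.tendsto (0 : ℝ)).mono_left (nhdsWithin_le_nhds (s := Ioi 0))
      rwa [ENNReal.ofReal_zero] at this
    have h1 : Tendsto (fun h : ℝ => c * ENNReal.ofReal M ^ 2 * ENNReal.ofReal h) (𝓝[>] 0)
        (𝓝 (c * ENNReal.ofReal M ^ 2 * 0)) :=
      ENNReal.Tendsto.const_mul h0 (Or.inr (ENNReal.mul_ne_top hctop (by simp)))
    rw [mul_zero] at h1
    exact ((h1.eventually_le_const hε3).and (Ioo_mem_nhdsGT hh₀)).exists
  have hmean := ENNReal.tendsto_nhds_zero.1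
    ((ENNReal.Tendsto.const_mul (a := 2) (tendsto_lintegral_timeMean hd hM hh.1 hw R hR)
      (Or.inr (by simp))).trans (by rw [mul_zero])) (ε / 3) hε3
  filter_upwards [hmean] with n hn
  have hsub : Ioo 0 T ⊆ Ioo 0 (T - h) ∪ Ico (T - h) T := by
    intro t ht
    rcases lt_or_ge t (T - h) with h1 | h1
    · exact Or.inl ⟨ht.1, h1⟩
    · exact Or.inr ⟨h1, ht.2⟩
  have hA : ∫⁻ t in Ioo 0 (T - h), ‖R (d n t)‖ₑ ^ 2 ≤
      2 * (∫⁻ t in Ioo 0 (T - h), ‖R (timeMean (d n) h t)‖ₑ ^ 2) + 2 * c * η := by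
    have hm1 : Measurable fun t => ‖R (timeMean (d n) h t)‖ₑ ^ 2 :=
      (R.continuous.comp_stronglyMeasurable
        (stronglyMeasurable_timeMean (hd n) h)).enorm.pow_const 2
    have hm2 : Measurable fun t => ‖d n t - timeMean (d n) h t‖ₑ ^ 2 :=
      ((hd n).sub (stronglyMeasurable_timeMean (hd n) h)).enorm.pow_const 2
    calc _ ≤ ∫⁻ t in Ioo 0 (T - h), (2 * ‖R (timeMean (d n) h t)‖ₑ ^ 2 +
          2 * c * ‖d n t - timeMean (d n) h t‖ₑ ^ 2) := by
          refine lintegral_mono fun t => ?_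
          have h1 : R (d n t) = R (timeMean (d n) h t) + R (d n t - timeMean (d n) h t) := by
            rw [← map_add, add_sub_cancel]
          rw [h1]
          refine (enorm_add_sq_le _ _).trans ?_
          rw [mul_assoc 2 c]
          gcongr
          exact enorm_clm_sq_le R _
      _ = 2 * (∫⁻ t in Ioo 0 (T - h), ‖R (timeMean (d n) h t)‖ₑ ^ 2) +
          2 * c * ∫⁻ t in Ioo 0 (T - h), ‖d n t - timeMean (d n) h t‖ₑ ^ 2 := by
          rw [lintegral_add_left (hm1.const_mul 2), lintegral_const_mul _ hm1,
            lintegral_const_mul _ hm2]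
      _ ≤ _ := by
          gcongr
          exact lintegral_sub_timeMean_le (hd n) hh.1 (hM n) fun r hr =>
            hmodη n r ⟨hr.1, hr.2.trans hh.2⟩
  have hB : ∫⁻ t in Ico (T - h) T, ‖R (d n t)‖ₑ ^ 2 ≤
      c * ENNReal.ofReal M ^ 2 * ENNReal.ofReal h := by
    calc _ ≤ ∫⁻ t in Ico (T - h) T, c * ENNReal.ofReal M ^ 2 := by
          refine lintegral_mono fun t => (enorm_clm_sq_le R _).trans ?_
          rw [← ofReal_norm (d n t)]
          gcongr
          exact hM n t
      _ = _ := by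
          rw [lintegral_const, Measure.restrict_apply_univ, Real.volume_Ico, sub_sub_cancel]
  calc _ ≤ _ := lintegral_mono_set hsub
    _ ≤ _ := lintegral_union_le _ _ _
    _ ≤ ε / 3 + ε / 3 + ε / 3 :=
        add_le_add (hA.trans (add_le_add hn hηε)) (hB.trans hhε)
    _ = ε := ENNReal.add_thirds ε

/-- A bounded sequence that converges weakly to zero in `L²(0,T;H)` and has a uniform `L²` time
modulus is sent to a strongly null sequence by a compact operator. -/
theorem tendsto_lintegral_of_weakly_null {d : ℕ → ℝ → H} {T : ℝ}
    (hd : ∀ n, AEStronglyMeasurable (d n) (volume.restrict (Ioo 0 T))) {M : ℝ} (hM0 : 0 ≤ M)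
    (hM : ∀ n, ∀ᵐ t ∂(volume.restrict (Ioo 0 T)), ‖d n t‖ ≤ M)
    (hw : TendstoWeakly T d fun _ => 0)
    (hmod : ∀ η : ℝ≥0∞, 0 < η → ∃ h₀ : ℝ, 0 < h₀ ∧ ∀ n, ∀ r ∈ Ioo 0 h₀,
      ∫⁻ t in Ioo 0 (T - r), ‖d n (t + r) - d n t‖ₑ ^ 2 ≤ η)
    (R : H →L[ℝ] H')
    (hR : ∀ f : ℕ → H, (∀ n, ‖f n‖ ≤ M) → (∀ y, Tendsto (fun n => inner ℝ (f n) y) atTop (𝓝 0)) →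
      Tendsto (fun n => ‖R (f n)‖ₑ ^ 2) atTop (𝓝 0)) :
    Tendsto (fun n => ∫⁻ t in Ioo 0 T, ‖R (d n t)‖ₑ ^ 2) atTop (𝓝 0) := by
  -- a representative that is measurable and bounded everywhere
  have hA : ∀ n, MeasurableSet {t | ‖(hd n).mk (d n) t‖ ≤ M} := fun n =>
    measurableSet_le (hd n).stronglyMeasurable_mk.norm.measurable measurable_const
  obtain ⟨d', hd'⟩ : ∃ d' : ℕ → ℝ → H, d' = fun n =>
    {t | ‖(hd n).mk (d n) t‖ ≤ M}.indicator ((hd n).mk (d n)) := ⟨_, rfl⟩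
  have hdm : ∀ n, StronglyMeasurable (d' n) := fun n => by
    rw [hd']
    exact (hd n).stronglyMeasurable_mk.indicator (hA n)
  have hdM : ∀ n t, ‖d' n t‖ ≤ M := fun n t => by
    rw [hd']
    by_cases ht : t ∈ {t | ‖(hd n).mk (d n) t‖ ≤ M}
    · simp only [indicator_of_mem ht]
      exact ht
    · simp only [indicator_of_notMem ht, norm_zero, hM0]
  have heq : ∀ n, ∀ᵐ t ∂(volume.restrict (Ioo 0 T)), d n t = d' n t := fun n => by
    filter_upwards [(hd n).ae_eq_mk, hM n] with t h1 h2
    rw [h1] at h2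
    have h3 : t ∈ {t | ‖(hd n).mk (d n) t‖ ≤ M} := h2
    simp only [hd', indicator_of_mem h3, h1]
  have hlim := tendsto_lintegral_of_weakly_null_of_bounded hdm hdM (T := T) ?_ ?_ R hR
  · refine hlim.congr fun n => lintegral_congr_ae ?_
    filter_upwards [heq n] with t ht
    rw [ht]
  · intro Φ hΦ
    refine (hw Φ hΦ).congr fun n => integral_congr_ae ?_
    filter_upwards [heq n] with t ht
    rw [ht]
  · intro η hη
    obtain ⟨h₀, hh₀, hb⟩ := hmod η hη
    refine ⟨h₀, hh₀, fun n r hr => le_trans (le_of_eq (lintegral_congr_ae ?_)) (hb n r hr)⟩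
    filter_upwards [ae_shift hr.1 (heq n), ae_restrict_sub hr.1 (heq n)] with t h1 h2
    rw [h1, h2]

end

/-- The translations in time are continuous in `L²`. -/
theorem exists_time_modulus_of_memLp {H : Type*} [NormedAddCommGroup H] {T : ℝ} {v : ℝ → H}
    (hv : MemLp v 2 (volume.restrict (Ioo 0 T))) {η : ℝ≥0∞} (hη : 0 < η) :
    ∃ h₀ : ℝ, 0 < h₀ ∧ ∀ r ∈ Ioo 0 h₀, ∫⁻ t in Ioo 0 (T - r), ‖v (t + r) - v t‖ₑ ^ 2 ≤ η := by
  have hV : MemLp ((Ioo 0 T).indicator v) 2 (volume : Measure ℝ) :=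
    (memLp_indicator_iff_restrict measurableSet_Ioo).2 hv
  obtain ⟨V, hVdef⟩ : ∃ V : Lp H 2 (volume : Measure ℝ), V = hV.toLp _ := ⟨_, rfl⟩
  have hVae : V =ᵐ[volume] (Ioo 0 T).indicator v := by rw [hVdef]; exact hV.coeFn_toLp
  have hmp : ∀ r : ℝ, MeasurePreserving (ContinuousMap.addRight r) (volume : Measure ℝ) volume :=
    fun r => measurePreserving_add_right volume r
  have hcont : Continuous fun r : ℝ =>
      Lp.compMeasurePreserving (ContinuousMap.addRight r) (hmp r) V := by
    refine Continuous.compMeasurePreservingLp continuous_const ?_ hmp (by simp)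
    exact ContinuousMap.continuous_of_continuous_uncurry _ (continuous_snd.add continuous_fst)
  have hlim : Tendsto (fun r : ℝ =>
      ‖Lp.compMeasurePreserving (ContinuousMap.addRight r) (hmp r) V - V‖ₑ ^ 2) (𝓝[>] 0) (𝓝 0) := by
    have hc : Continuous fun r : ℝ =>
        ‖Lp.compMeasurePreserving (ContinuousMap.addRight r) (hmp r) V - V‖ₑ :=
      (hcont.sub continuous_const).enorm
    have h1 := hc.tendsto 0
    have h0 : Lp.compMeasurePreserving (ContinuousMap.addRight (0 : ℝ)) (hmp 0) V = V := by
      refine Lp.ext ?_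
      filter_upwards [Lp.coeFn_compMeasurePreserving V (hmp 0)] with t ht
      rw [ht]
      simp
    rw [h0, sub_self, enorm_zero] at h1
    have h2 := ENNReal.Tendsto.pow (n := 2) (h1.mono_left (nhdsWithin_le_nhds (s := Ioi 0)))
    simpa using h2
  obtain ⟨h₀, hh₀, hb⟩ := mem_nhdsGT_iff_exists_Ioo_subset.1 (hlim.eventually_le_const hη)
  refine ⟨h₀, hh₀, fun r hr => le_trans ?_ (hb hr)⟩
  rw [Lp_enorm_sq]
  refine (lintegral_mono_ae ?_).trans (lintegral_mono' Measure.restrict_le_self le_rfl)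
  have h3 := (hmp r).quasiMeasurePreserving.ae hVae
  filter_upwards [ae_restrict_of_ae hVae, ae_restrict_of_ae h3, ae_restrict_of_ae
    (Lp.coeFn_compMeasurePreserving V (hmp r)), ae_restrict_of_ae (Lp.coeFn_sub
      (Lp.compMeasurePreserving (ContinuousMap.addRight r) (hmp r) V) V),
    ae_restrict_mem measurableSet_Ioo] with t h4 h5 h6 h7 ht
  have ht1 : t ∈ Ioo 0 T := ⟨ht.1, by linarith [ht.2, hr.1]⟩
  have ht2 : t + r ∈ Ioo 0 T := Ioo_subset_preimage_add hr.1 ht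
  have h8 : (ContinuousMap.addRight r : C(ℝ, ℝ)) t = t + r := rfl
  rw [h8, indicator_of_mem ht2] at h5
  rw [h7, Pi.sub_apply, h6, Function.comp_apply, h8, h5, h4, indicator_of_mem ht1]

/-! ### Convergence of the solenoidal parts -/

theorem IsCutoff.setLIntegral_lerayP_le {Ω : Set E3} {χ : E3 → ℝ} {L δ : ℝ}
    (hχ : IsCutoff Ω χ L δ) (hL : 0 ≤ L)
    (hΩ : MeasurableSet Ω) {z : L2V Ω} {g : Fin 3 → L2V Ω} (hz : HasH10Grad Ω z g) {K : Set E3}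
    (hK : MeasurableSet K) (hKΩ : K ⊆ Ω) (hχK : ∀ x ∈ K, χ x = 1) {ζ : E3 → ℝ} {r : ℝ}
    (hζ : IsKernel ζ r) (hr : r ≤ δ) :
    ∫⁻ x in K, ‖lerayP Ω z x‖ₑ ^ 2 ≤
      2 * ENNReal.ofReal (6 * (1 + L) * r * ‖z‖ * (‖z‖ + ∑ i, ‖g i‖)) +
        2 * ‖smoothing Ω K hζ (lerayP Ω z)‖ₑ ^ 2 := by
  have hcont : Continuous (kernelOp Ω (fun _ => 0) ζ (lerayP Ω z)) :=
    (contDiff_kernelOp lipschitzWith_zero_half hζ.contDiff hζ.compact (Lp.memLp _)).continuous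
  have hm : Measurable fun x => ‖kernelOp Ω (fun _ => 0) ζ (lerayP Ω z) x‖ₑ ^ 2 :=
    hcont.enorm.measurable.pow_const 2
  calc _ ≤ ∫⁻ x in K, (2 * ‖lerayP Ω z x - kernelOp Ω (fun _ => 0) ζ (lerayP Ω z) x‖ₑ ^ 2 +
        2 * ‖kernelOp Ω (fun _ => 0) ζ (lerayP Ω z) x‖ₑ ^ 2) := by
        refine lintegral_mono fun x => ?_
        have h := enorm_add_sq_le (lerayP Ω z x - kernelOp Ω (fun _ => 0) ζ (lerayP Ω z) x)
          (kernelOp Ω (fun _ => 0) ζ (lerayP Ω z) x)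
        rwa [sub_add_cancel] at h
    _ = 2 * (∫⁻ x in K, ‖lerayP Ω z x - kernelOp Ω (fun _ => 0) ζ (lerayP Ω z) x‖ₑ ^ 2) +
        2 * ∫⁻ x in K, ‖kernelOp Ω (fun _ => 0) ζ (lerayP Ω z) x‖ₑ ^ 2 := by
        rw [lintegral_add_right _ (hm.const_mul 2), lintegral_const_mul _ hm,
          lintegral_const_mul' _ _ (by simp)]
    _ ≤ _ := by
        gcongr
        · exact hχ.setLIntegral_sub_kernelOp_le hL hΩ hz hK hKΩ hχK hζ hr
        · rw [Lp_enorm_sq]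
          refine le_of_eq (lintegral_congr_ae ?_)
          filter_upwards [smoothing_coeFn Ω K hζ (lerayP Ω z)] with x hx
          rw [hx]

/-- The compactness in space: interior strong convergence of the solenoidal parts follows from that
of their smoothings. -/
theorem tendsto_lintegral_lerayP_of_smoothing {Ω K : Set E3} (hΩ : IsOpen Ω) (hK : IsCompact K)
    (hKΩ : K ⊆ Ω) {T : ℝ} {z : ℕ → ℝ → L2V Ω} {g : ℕ → ℝ → Fin 3 → L2V Ω}
    (hz : ∀ n, ∀ᵐ t ∂(volume.restrict (Ioo 0 T)), HasH10Grad Ω (z n t) (g n t))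
    (hzm : ∀ n, AEStronglyMeasurable (z n) (volume.restrict (Ioo 0 T))) {M : ℝ}
    (hM0 : 0 ≤ M) (hM : ∀ n, ∀ᵐ t ∂(volume.restrict (Ioo 0 T)), ‖z n t‖ ≤ M) {B : ℝ≥0∞}
    (hB : B ≠ ⊤) (hgB : ∀ n, ∫⁻ t in Ioo 0 T, ENNReal.ofReal (M + ∑ i, ‖g n t i‖) ≤ B)
    (hR : ∀ (ζ : E3 → ℝ) (r : ℝ) (hζ : IsKernel ζ r),
      Tendsto (fun n => ∫⁻ t in Ioo 0 T, ‖smoothing Ω K hζ (lerayP Ω (z n t))‖ₑ ^ 2) atTop (𝓝 0)) :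
    Tendsto (fun n => ∫⁻ t in Ioo 0 T, ∫⁻ x in K, ‖lerayP Ω (z n t) x‖ₑ ^ 2) atTop (𝓝 0) := by
  obtain ⟨χ, L, δ, hL, hδ, hχ, hχK⟩ := exists_isCutoff hΩ hK hKΩ
  rw [ENNReal.tendsto_nhds_zero]
  intro ε hε
  have hε2 : 0 < ε / 2 := ENNReal.div_pos hε.ne' (by simp)
  obtain ⟨r, hrε, hr⟩ : ∃ r : ℝ, 2 * (ENNReal.ofReal (6 * (1 + L) * r * M) * B) ≤ ε / 2 ∧
      r ∈ Ioo 0 δ := by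
    have h0 : Tendsto (fun r : ℝ => ENNReal.ofReal (6 * (1 + L) * r * M)) (𝓝[>] 0) (𝓝 0) := by
      have hc : Continuous fun r : ℝ => ENNReal.ofReal (6 * (1 + L) * r * M) :=
        ENNReal.continuous_ofReal.comp (by fun_prop)
      have := (hc.tendsto 0).mono_left (nhdsWithin_le_nhds (s := Ioi 0))
      simpa using this
    have h1 := ENNReal.Tendsto.const_mul (a := 2)
      (ENNReal.Tendsto.mul_const h0 (Or.inr hB)) (Or.inr (by simp))
    rw [zero_mul, mul_zero] at h1
    exact ((h1.eventually_le_const hε2).and (Ioo_mem_nhdsGT hδ)).exists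
  obtain ⟨ζ, hζ⟩ := exists_isKernel hr.1
  have hsm := ENNReal.tendsto_nhds_zero.1
    ((ENNReal.Tendsto.const_mul (a := 2) (hR ζ r hζ) (Or.inr (by simp))).trans
      (by rw [mul_zero])) (ε / 2) hε2
  filter_upwards [hsm] with n hn
  have hmR : AEMeasurable (fun t => 2 * ‖smoothing Ω K hζ (lerayP Ω (z n t))‖ₑ ^ 2)
      (volume.restrict (Ioo 0 T)) := by
    have h1 : AEStronglyMeasurable (fun t => smoothing Ω K hζ (lerayP Ω (z n t)))
        (volume.restrict (Ioo 0 T)) :=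
      ((smoothing Ω K hζ).continuous.comp (lerayP Ω).continuous).comp_aestronglyMeasurable (hzm n)
    exact (h1.enorm.pow_const 2).const_mul 2
  calc _ ≤ ∫⁻ t in Ioo 0 T, (2 * (ENNReal.ofReal (6 * (1 + L) * r * M) *
          ENNReal.ofReal (M + ∑ i, ‖g n t i‖)) +
          2 * ‖smoothing Ω K hζ (lerayP Ω (z n t))‖ₑ ^ 2) := by
        refine lintegral_mono_ae ?_
        filter_upwards [hz n, hM n] with t h1 h2
        refine (hχ.setLIntegral_lerayP_le hL hΩ.measurableSet h1 hK.measurableSet hKΩ hχK hζ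
          hr.2.le).trans ?_
        have hr0 := hr.1.le
        have hS0 : 0 ≤ ∑ i, ‖g n t i‖ := Finset.sum_nonneg fun i _ => norm_nonneg _
        rw [← ENNReal.ofReal_mul (by positivity)]
        gcongr
    _ = 2 * (ENNReal.ofReal (6 * (1 + L) * r * M) *
          ∫⁻ t in Ioo 0 T, ENNReal.ofReal (M + ∑ i, ‖g n t i‖)) +
          2 * ∫⁻ t in Ioo 0 T, ‖smoothing Ω K hζ (lerayP Ω (z n t))‖ₑ ^ 2 := by
        rw [lintegral_add_right' _ hmR, lintegral_const_mul' _ _ (by simp),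
          lintegral_const_mul' _ _ (by simp), lintegral_const_mul' _ _ (by simp)]
    _ ≤ 2 * (ENNReal.ofReal (6 * (1 + L) * r * M) * B) + ε / 2 := by
        gcongr
        exact hgB n
    _ ≤ ε / 2 + ε / 2 := by gcongr
    _ = ε := ENNReal.add_halves ε

theorem isLimitProfile_iff {Ω : Set E3} {T : ℝ} {u : ℕ → ℝ → L2V Ω} {G : ℕ → ℝ → Fin 3 → L2V Ω}
    (hen : ∀ n, IsEnergyClass Ω T (u n) (G n)) {v : ℝ → L2V Ω} :
    IsLimitProfile Ω T G v ↔ ∃ H : ℝ → Fin 3 → L2V Ω, IsEnergyClass Ω T v H ∧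
      ∀ i, TendstoWeakly T (fun n t => G n t i) fun t => H t i := by
  constructor
  · rintro ⟨H, hH, hlim⟩
    refine ⟨H, hH, fun i Φ hΦ => ?_⟩
    have h1 := hlim (fun t => Pi.single i (Φ t)) fun j => by
      by_cases hj : j = i
      · subst hj
        simpa using hΦ
      · simp [hj]
    have h2 : ∀ (a : Fin 3 → L2V Ω) (t : ℝ),
        ∑ j, inner ℝ (a j) ((Pi.single i (Φ t) : Fin 3 → L2V Ω) j) = inner ℝ (a i) (Φ t) := by
      intro a t
      rw [Finset.sum_eq_single i]
      · simp
      · intro j _ hj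
        simp [hj]
      · simp
    simpa only [h2] using h1
  · rintro ⟨H, hH, hlim⟩
    refine ⟨H, hH, fun Φ hΦ => ?_⟩
    have h1 := tendsto_finsetSum Finset.univ fun i _ => hlim i _ (hΦ i)
    rw [integral_finsetSum _ fun i _ => integrable_inner_of_memLp (hH.grad_memLp i) (hΦ i)]
    refine h1.congr fun n => ?_
    rw [integral_finsetSum _ fun i _ =>
      integrable_inner_of_memLp ((hen n).grad_memLp i) (hΦ i)]

/-- In a bounded sequence of the energy class, weak convergence of the gradients implies weak
convergence of the fields, since a field in `H¹₀` is determined by its gradient. -/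
theorem tendstoWeakly_of_grad {Ω : Set E3} (hΩ : IsExteriorDomain Ω) {T : ℝ} (hT : 0 < T)
    {u : ℕ → ℝ → L2V Ω} {G : ℕ → ℝ → Fin 3 → L2V Ω} (hen : ∀ n, IsEnergyClass Ω T (u n) (G n))
    {M E : ℝ} (hM : ∀ n, ∀ᵐ t ∂(volume.restrict (Ioo 0 T)), ‖u n t‖ ≤ M)
    (hE : ∀ n, ∫ t in Ioo 0 T, ∑ i, ‖G n t i‖ ^ 2 ≤ E) {v : ℝ → L2V Ω} {H : ℝ → Fin 3 → L2V Ω}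
    (hv : IsEnergyClass Ω T v H)
    (hG : ∀ i, TendstoWeakly T (fun n t => G n t i) fun t => H t i) :
    TendstoWeakly T u v := by
  intro Φ hΦ
  refine tendsto_of_subseq_tendsto fun ns hns => ?_
  obtain ⟨k, hk, v', H', hv', huv', hGH'⟩ := exists_subseq_energyClass hT
    (u := fun n => u (ns n)) (G := fun n => G (ns n)) (fun n => hen _) (fun n => hM _) fun n => hE _
  have hHH' : ∀ i, (fun t => H t i) =ᵐ[volume.restrict (Ioo 0 T)] fun t => H' t i := by
    intro i
    refine TendstoWeakly.unique (f := fun n t => G (ns (k n)) t i) (fun Ψ hΨ => ?_) (hGH' i)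
      (hv.grad_memLp i) (hv'.grad_memLp i)
    exact (hG i Ψ hΨ).comp (hns.comp hk.tendsto_atTop)
  have hvv' : v' =ᵐ[volume.restrict (Ioo 0 T)] v := by
    filter_upwards [ae_all_iff.2 hHH', hv.grad, hv'.grad] with t h1 h2 h3
    have h4 := h3.sub h2
    have h5 : (fun i => H' t i - H t i) = 0 := by
      funext i
      rw [h1 i, sub_self, Pi.zero_apply]
    rw [h5] at h4
    exact sub_eq_zero.1 (h4.eq_zero hΩ)
  exact ⟨k, (huv'.congr_limit hvv') Φ hΦ⟩

theorem aestronglyMeasurable_shift {E : Type*} [TopologicalSpace E] {T h : ℝ} (hh : 0 < h)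
    {f : ℝ → E} (hf : AEStronglyMeasurable f (volume.restrict (Ioo 0 T))) :
    AEStronglyMeasurable (fun t => f (t + h)) (volume.restrict (Ioo 0 (T - h))) := by
  have hmp := (measurePreserving_add_right volume h).restrict_preimage
    (measurableSet_Ioo (a := (0 : ℝ)) (b := T))
  exact (hf.comp_quasiMeasurePreserving hmp.quasiMeasurePreserving).mono_measure
    (Measure.restrict_mono (Ioo_subset_preimage_add hh) le_rfl)

/-- A common time modulus of `f n - a`, from one of the sequence `f n`. -/
theorem exists_time_modulus_sub {H : Type*} [NormedAddCommGroup H] {T : ℝ} {f : ℕ → ℝ → H}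
    {a : ℝ → H} (ha : MemLp a 2 (volume.restrict (Ioo 0 T))) {C : ℝ}
    (hf : ∀ n, ∀ δ, 0 < δ → δ < 1 →
      ∫⁻ t in Ioo 0 (T - δ), ‖f n (t + δ) - f n t‖ₑ ^ 2 ≤ ENNReal.ofReal (C * δ ^ (2 / 5 : ℝ)))
    {η : ℝ≥0∞} (hη : 0 < η) :
    ∃ h₀ : ℝ, 0 < h₀ ∧ ∀ n, ∀ r ∈ Ioo 0 h₀,
      ∫⁻ t in Ioo 0 (T - r), ‖(f n (t + r) - a (t + r)) - (f n t - a t)‖ₑ ^ 2 ≤ η := by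
  have hη4 : 0 < η / 4 := ENNReal.div_pos hη.ne' (by simp)
  obtain ⟨h₁, hh₁, hb₁⟩ := exists_time_modulus_of_memLp ha hη4
  have hlim : Tendsto (fun δ : ℝ => ENNReal.ofReal (C * δ ^ (2 / 5 : ℝ))) (𝓝[>] 0) (𝓝 0) := by
    have hc : Continuous fun δ : ℝ => ENNReal.ofReal (C * δ ^ (2 / 5 : ℝ)) :=
      ENNReal.continuous_ofReal.comp
        (continuous_const.mul (Real.continuous_rpow_const (by norm_num)))
    have := (hc.tendsto 0).mono_left (nhdsWithin_le_nhds (s := Ioi 0))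
    simpa [Real.zero_rpow] using this
  obtain ⟨h₂, hh₂, hb₂⟩ := mem_nhdsGT_iff_exists_Ioo_subset.1 (hlim.eventually_le_const hη4)
  refine ⟨min h₁ (min h₂ 1), lt_min hh₁ (lt_min hh₂ one_pos), fun n r hr => ?_⟩
  have hr1 : r ∈ Ioo 0 h₁ := ⟨hr.1, hr.2.trans_le (min_le_left _ _)⟩
  have hr2 : r ∈ Ioo 0 h₂ := ⟨hr.1, hr.2.trans_le ((min_le_right _ _).trans (min_le_left _ _))⟩
  have hr3 : r < 1 := hr.2.trans_le ((min_le_right _ _).trans (min_le_right _ _))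
  have hm : AEMeasurable (fun t => ‖a (t + r) - a t‖ₑ ^ 2) (volume.restrict (Ioo 0 (T - r))) :=
    ((aestronglyMeasurable_shift hr.1 ha.1).sub (ha.1.mono_measure (Measure.restrict_mono
      (Ioo_subset_Ioo_right (by linarith [hr.1])) le_rfl))).enorm.pow_const 2
  have h4 : η / 4 + η / 4 = η / 2 := by
    rw [ENNReal.div_add_div_same, ← two_mul, show (4 : ℝ≥0∞) = 2 * 2 by norm_num]
    rw [ENNReal.mul_div_mul_left _ _ (by simp) (by simp)]
  calc _ ≤ ∫⁻ t in Ioo 0 (T - r), (2 * ‖f n (t + r) - f n t‖ₑ ^ 2 +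
        2 * ‖a (t + r) - a t‖ₑ ^ 2) := by
        refine lintegral_mono fun t => ?_
        have h := enorm_add_sq_le (f n (t + r) - f n t) (-(a (t + r) - a t))
        rw [enorm_neg] at h
        convert h using 3
        abel
    _ = 2 * (∫⁻ t in Ioo 0 (T - r), ‖f n (t + r) - f n t‖ₑ ^ 2) +
        2 * ∫⁻ t in Ioo 0 (T - r), ‖a (t + r) - a t‖ₑ ^ 2 := by
        rw [lintegral_add_right' _ (hm.const_mul 2), lintegral_const_mul' _ _ (by simp),
          lintegral_const_mul' _ _ (by simp)]
    _ ≤ 2 * (η / 4) + 2 * (η / 4) := by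
        gcongr
        · exact (hf n r hr.1 hr3).trans (hb₂ hr2)
        · exact hb₁ r hr1
    _ = η := by rw [← mul_add, h4, ENNReal.mul_div_cancel (by simp) (by simp)]

/-- Strong interior convergence of the solenoidal parts of a bounded sequence in the energy class
that has a uniform time modulus and converges weakly. -/
theorem tendstoL2Loc_lerayP {Ω : Set E3} (hΩ : IsOpen Ω) {T : ℝ}
    {u : ℕ → ℝ → L2V Ω} {G : ℕ → ℝ → Fin 3 → L2V Ω} (hen : ∀ n, IsEnergyClass Ω T (u n) (G n))
    {M B C : ℝ} (hM0 : 0 ≤ M) (hM : ∀ n, ∀ᵐ t ∂(volume.restrict (Ioo 0 T)), ‖u n t‖ ≤ M)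
    (hB : ∀ n, ∫⁻ t in Ioo 0 T, ENNReal.ofReal (∑ i, ‖G n t i‖) ≤ ENNReal.ofReal B)
    (hmod : ∀ n, ∀ δ, 0 < δ → δ < 1 →
      ∫⁻ t in Ioo 0 (T - δ), ‖lerayP Ω (u n (t + δ)) - lerayP Ω (u n t)‖ₑ ^ 2 ≤
        ENNReal.ofReal (C * δ ^ (2 / 5 : ℝ)))
    {v : ℝ → L2V Ω} {H : ℝ → Fin 3 → L2V Ω} (hv : IsEnergyClass Ω T v H)
    (huv : TendstoWeakly T u v) :
    TendstoL2Loc Ω T (fun n t => lerayP Ω (u n t)) fun t => lerayP Ω (v t) := by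
  intro K hK hKΩ
  have hvM := huv.ae_norm_le (fun n => (hen n).memLp_two) hv.memLp_two hM
  have hPu : ∀ n, MemLp (fun t => lerayP Ω (u n t)) 2 (volume.restrict (Ioo 0 T)) := fun n =>
    (lerayP Ω).comp_memLp' (hen n).memLp_two
  have hPv : MemLp (fun t => lerayP Ω (v t)) 2 (volume.restrict (Ioo 0 T)) :=
    (lerayP Ω).comp_memLp' hv.memLp_two
  have hzM : ∀ n, ∀ᵐ t ∂(volume.restrict (Ioo 0 T)), ‖u n t - v t‖ ≤ 2 * M := fun n => by
    filter_upwards [hM n, hvM] with t h1 h2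
    exact (norm_sub_le _ _).trans (by linarith)
  have hzm : ∀ n, AEStronglyMeasurable (fun t => u n t - v t) (volume.restrict (Ioo 0 T)) := fun n =>
    (hen n).memLp.1.sub hv.memLp.1
  have hHi : Integrable (fun t => ∑ i, ‖H t i‖) (volume.restrict (Ioo 0 T)) :=
    integrable_finsetSum _ fun i _ => ((hv.grad_memLp i).integrable (by norm_num)).norm
  have hlim := tendsto_lintegral_lerayP_of_smoothing hΩ hK hKΩ (T := T)
    (z := fun n t => u n t - v t) (g := fun n t i => G n t i - H t i) (M := 2 * M)
    (B := ENNReal.ofReal (2 * M) * ENNReal.ofReal T + (ENNReal.ofReal B +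
      ∫⁻ t in Ioo 0 T, ENNReal.ofReal (∑ i, ‖H t i‖))) ?_ hzm (by positivity) hzM ?_ ?_ ?_
  · refine hlim.congr fun n => lintegral_congr fun t => lintegral_congr_ae ?_
    have h1 := Lp.coeFn_sub (lerayP Ω (u n t)) (lerayP Ω (v t))
    filter_upwards [ae_restrict_of_ae_restrict_of_subset hKΩ h1] with x hx
    rw [map_sub, hx, Pi.sub_apply]
  · intro n
    filter_upwards [(hen n).grad, hv.grad] with t h1 h2
    exact h1.sub h2
  · refine ENNReal.add_ne_top.2 ⟨ENNReal.mul_ne_top ENNReal.ofReal_ne_top ENNReal.ofReal_ne_top,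
      ENNReal.add_ne_top.2 ⟨ENNReal.ofReal_ne_top, ?_⟩⟩
    rw [← ofReal_integral_eq_lintegral_ofReal hHi
      (Eventually.of_forall fun t => Finset.sum_nonneg fun i _ => norm_nonneg _)]
    exact ENNReal.ofReal_ne_top
  · intro n
    calc _ ≤ ∫⁻ t in Ioo 0 T, (ENNReal.ofReal (2 * M) + (ENNReal.ofReal (∑ i, ‖G n t i‖) +
          ENNReal.ofReal (∑ i, ‖H t i‖))) := by
          refine lintegral_mono fun t => ?_
          have hG0 : 0 ≤ ∑ i, ‖G n t i‖ := Finset.sum_nonneg fun i _ => norm_nonneg _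
          have hH0 : 0 ≤ ∑ i, ‖H t i‖ := Finset.sum_nonneg fun i _ => norm_nonneg _
          rw [← ENNReal.ofReal_add hG0 hH0, ← ENNReal.ofReal_add (by positivity) (by positivity),
            ← Finset.sum_add_distrib]
          refine ENNReal.ofReal_le_ofReal ?_
          gcongr
          exact norm_sub_le _ _
      _ = ENNReal.ofReal (2 * M) * ENNReal.ofReal T +
          ((∫⁻ t in Ioo 0 T, ENNReal.ofReal (∑ i, ‖G n t i‖)) +
            ∫⁻ t in Ioo 0 T, ENNReal.ofReal (∑ i, ‖H t i‖)) := by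
          rw [lintegral_add_left measurable_const,
            lintegral_add_right' _ hHi.aemeasurable.ennreal_ofReal, lintegral_const,
            Measure.restrict_apply_univ, Real.volume_Ioo, sub_zero]
      _ ≤ _ := by
          gcongr
          exact hB n
  · intro ζ r hζ
    simp only [map_sub (lerayP Ω)]
    refine tendsto_lintegral_of_weakly_null (d := fun n t => lerayP Ω (u n t) - lerayP Ω (v t))
      (M := 2 * M) (fun n => ((hPu n).sub hPv).1) (by positivity) ?_
      ((huv.clm (lerayP Ω)).sub_const hPu hPv)
      (fun η hη => exists_time_modulus_sub hPv hmod hη) (smoothing Ω K hζ)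
      fun f hf hw => tendsto_smoothing hK hζ hf hw
    intro n
    filter_upwards [hzM n] with t ht
    rw [← map_sub]
    exact (norm_lerayP_le _).trans ht

theorem exists_energy_bound {Ω : Set E3} {ε : ℕ → ℝ} (hε : ∀ n, 0 < ε n)
    {u₀ : ℕ → L2V Ω} {p₀ : ℕ → L2S Ω} {u₀lim : L2V Ω} (hu₀ : Tendsto u₀ atTop (𝓝 u₀lim))
    (hp₀ : Tendsto (fun n => Real.sqrt (ε n) • p₀ n) atTop (𝓝 0)) :
    ∃ E : ℝ, 0 ≤ E ∧ ∀ n, 1 / 2 * ‖u₀ n‖ ^ 2 + ε n / 2 * ‖p₀ n‖ ^ 2 ≤ E := by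
  have h1 : Tendsto (fun n => 1 / 2 * ‖u₀ n‖ ^ 2 + 1 / 2 * ‖√(ε n) • p₀ n‖ ^ 2) atTop
      (𝓝 (1 / 2 * ‖u₀lim‖ ^ 2 + 1 / 2 * ‖(0 : L2S Ω)‖ ^ 2)) :=
    ((hu₀.norm.pow 2).const_mul _).add ((hp₀.norm.pow 2).const_mul _)
  obtain ⟨E, hE⟩ := h1.bddAbove_range
  have h2 : ∀ n, 1 / 2 * ‖u₀ n‖ ^ 2 + ε n / 2 * ‖p₀ n‖ ^ 2 ≤ E := by
    intro n
    have h3 := hE ⟨n, rfl⟩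
    dsimp only at h3
    rw [norm_smul, mul_pow, Real.norm_of_nonneg (Real.sqrt_nonneg _), Real.sq_sqrt (hε n).le] at h3
    linarith
  refine ⟨E, le_trans ?_ (h2 0), h2⟩
  have := hε 0
  positivity

theorem eLpNorm_two_le_of_lintegral {α E : Type*} [MeasurableSpace α] {μ : Measure α}
    [NormedAddCommGroup E] {f : α → E} {b : ℝ≥0∞} (h : ∫⁻ x, ‖f x‖ₑ ^ 2 ∂μ ≤ b ^ 2) :
    eLpNorm f 2 μ ≤ b := by
  refine (ENNReal.pow_le_pow_left_iff two_ne_zero).1 (le_trans (le_of_eq ?_) h)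
  rw [eLpNorm_eq_lintegral_rpow_enorm_toReal (by simp) (by simp),
    ← ENNReal.rpow_natCast, ← ENNReal.rpow_mul]
  simp

end

theorem theorem6p2 (Ω : Set E3) (hΩ : IsExteriorDomain Ω) (T : ℝ) (hT : 0 < T)
    (ε : ℕ → ℝ) (hε : ∀ n, 0 < ε n) (hε0 : Tendsto ε atTop (𝓝 0))
    (u₀ : ℕ → L2V Ω) (p₀ : ℕ → L2S Ω) (u₀lim : L2V Ω)
    (u : ℕ → ℝ → L2V Ω) (G : ℕ → ℝ → Fin 3 → L2V Ω) (p : ℕ → ℝ → L2S Ω)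
    (hsol : ∀ n, IsWeakSolution Ω T (ε n) (u₀ n) (p₀ n) (u n) (G n) (p n))
    (hu₀ : Tendsto u₀ atTop (𝓝 u₀lim))
    (hp₀ : Tendsto (fun n => Real.sqrt (ε n) • p₀ n) atTop (𝓝 0)) :
    (∃ C : ℝ, ∀ n, ∀ h : ℝ, 0 < h → h < 1 →
      eLpNorm (fun t => lerayP Ω (u n (t + h)) - lerayP Ω (u n t)) 2
        (volume.restrict (Ioo 0 (T - h))) ≤ ENNReal.ofReal (C * h ^ (1 / 5 : ℝ))) ∧
    (∃ k : ℕ → ℕ, StrictMono k ∧ ∃ v : ℝ → L2V Ω, IsLimitProfile Ω T (fun n => G (k n)) v) ∧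
    (∀ k : ℕ → ℕ, StrictMono k → ∀ v : ℝ → L2V Ω, IsLimitProfile Ω T (fun n => G (k n)) v →
      TendstoL2Loc Ω T (fun n t => lerayP Ω (u (k n) t)) (fun t => lerayP Ω (v t))) := by
  obtain ⟨E, hE0, hE⟩ := exists_energy_bound hε hu₀ hp₀
  obtain ⟨C, hC, hmod⟩ := hΩ.exists_time_modulus hT E hE0
  have hmod' := fun n => hmod (ε n) (u₀ n) (p₀ n) (u n) (G n) (p n) (hε n) (hsol n) (hE n)
  have hb := fun n => (hsol n).energy_bounds hT (hε n) (hE n)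
  have hen := fun n => (hsol n).velocity
  refine ⟨⟨√C, fun n h hh hh1 => ?_⟩, ?_, fun k hk v hv => ?_⟩
  · refine eLpNorm_two_le_of_lintegral ((hmod' n h hh hh1).trans_eq ?_)
    rw [← ENNReal.ofReal_pow (by positivity), mul_pow, Real.sq_sqrt hC, ← Real.rpow_natCast,
      ← Real.rpow_mul hh.le]
    norm_num
  · obtain ⟨k, hk, v, H, hv, -, hGH⟩ := exists_subseq_energyClass hT hen (fun n => (hb n).1)
      fun n => (hb n).2
    exact ⟨k, hk, v, (isLimitProfile_iff fun n => hen (k n)).2 ⟨H, hv, hGH⟩⟩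
  · obtain ⟨H, hvH, hG⟩ := (isLimitProfile_iff fun n => hen (k n)).1 hv
    have huv := tendstoWeakly_of_grad hΩ hT (fun n => hen (k n)) (fun n => (hb (k n)).1)
      (fun n => (hb (k n)).2) hvH hG
    exact tendstoL2Loc_lerayP hΩ.isOpen (fun n => hen (k n)) (Real.sqrt_nonneg _)
      (fun n => (hb (k n)).1)
      (fun n => (hsol (k n)).lintegral_sum_le hT (hε (k n)) (hE (k n))) (fun n => hmod' (k n)) hvH
      huv
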